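/- Let $m>0$, $\alpha\in(2,\tfrac83]$, and let $F\in C^2(\mathbb C^4,\mathbb R)$ satisfy ($\mathbb C^4$ being regarded as a real Euclidean space with scalar product $\Re\langle\cdot,\cdot\rangle$, $\langle\xi,\eta\rangle=\sum_i\bar\xi_i\eta_i$): (i) $\nabla F(0)=0$, $D^2F(0)=0$; (ii) for some $R>0$, $|D^2F(\phi)|\le|\phi|^{\alpha-2}$ whenever $|\phi|\ge R$; (iii) $\Re\langle\nabla F(\phi),\phi\rangle\ge\alpha F(\phi)\ge0$ for all $\phi$; (iv) $\Re\langle D^2F(\phi)\zeta,\zeta\rangle\ge0$ for all $\phi,\zeta$. Let $\mu$ be any constant with $|\nabla F(\phi)|\le|\phi|+\mu|\phi|^{\alpha-1}$ for all $\phi\in\mathbb C^4$. Let $X=H^{1/2}(\mathbb R^3,\mathbb C^4)$ with $\|\psi\|^2=\int\sqrt{|\xi|^2+m^2}\,|\hat\psi(\xi)|^2d\xi$ ($\hat{\ }$ the unitary Fourier transform). Write $|\psi|_p$ for the $L^p$ norm, $\langle\cdot,\cdot\rangle_{L^2}$ for the $L^2$ scalar product, and $S_p$ for the best constant in $|\psi|_p\le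 S_p\|\psi\|$, $\psi\in X$ ($2\le p\le3$). Let $\Lambda_\pm$ be the projections on the positive and negative spectral subspaces of the Dirac operator $H=-i\boldsymbol\alpha\cdot\nabla+m\beta$, and $X_\pm=\Lambda_\pm X$. Fix $\lambda\in(0,1]$ and $\gamma>0$ with $$\gamma\Big(S_2^2+\mu\lambda^{\frac{\alpha-2}2}S_3^{3(\alpha-2)}S_2^{3\alpha-8}\Big)<\tfrac1{16},\qquad \gamma\Big(S_2^2+\mu\lambda^{\frac{\alpha-2}2}S_{4/(4-\alpha)}^2\Big)<\tfrac14,$$ and put $C_{\alpha,\lambda}=4\big(S_2^2+\mu\lambda^{\frac{\alpha-2}2}S_3^{3(\alpha-2)}S_2^{3\alpha-8}\big)$. Define $I(\psi)=\frac12\|\Lambda_+\psi\|^2-\frac12\|\Lambda_-\psi\|^2-\gamma\int_{\mathbb R^3}F(\psi)$ on $X$, $\Sigma^\lambda=\{\psi\in X:|\psi|_2^2=\lambda\}$, $\Sigma_+=\{w\in X_+:|w|_2=1\}$, $B_\lambda=\{\eta\in X_-:|\eta|_2^2<\lambda\}$, $a(\eta)=\sqrt{\lambda-|\eta|_2^2}$,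 $J_w(\eta)=I(a(\eta)w+\eta)$ for $w\in\Sigma_+$, $\eta\in B_\lambda$, and $E(w)=\sup_{\eta\in B_\lambda}J_{w/|w|_2}(\eta)$ for $w\in X_+\setminus\{0\}$. Derivatives are Fréchet derivatives over $\mathbb R$; a critical point of a functional on an $L^2$-sphere is a point of differentiability at which the derivative vanishes on the tangent space of that sphere. Then for each $w\in\Sigma_+$ the functional $J_w$ has exactly one maximizer $\eta(w)$ on $B_\lambda$, and $E$ is differentiable on $X_+\setminus\{0\}$. Moreover: (a) Let $w_0\in\Sigma_+$ be a critical point of $E$ restricted to $\Sigma_+$. Then $w_0$ is a critical point of $E$ on $X_+\setminus\{0\}$; the function $\psi_0=a(\eta(w_0))w_0+\eta(w_0)$ lies in $\Sigma^\lambda$, is a critical point of $I$ on $\Sigma^\lambda$, satisfies $I(\psi_0)=E(w_0)$, and with $\omega=a(\eta(w_0))^{-1}dI(\psi_0)[w_0]\in\mathbb R$ $$dI(\psi_0)[h]=\omega\,\Re\langle\psi_0,h\rangle_{L^2}\quad\text{for all }h\in X,\qquad(1-\gamma C_{\alpha,\lambda})\|w_0\|^2\le\omega,\qquad \lambda\,\omega\le2I(\psi_0)=2E(w_0).$$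 (b) Conversely, if $\psi_0\in\Sigma^\lambda$ satisfies $dI(\psi_0)[h]=\omega\,\Re\langle\psi_0,h\rangle_{L^2}$ for all $h\in X$, for some $\omega>0$, then $\Lambda_+\psi_0\ne0$ and $w=|\Lambda_+\psi_0|_2^{-1}\Lambda_+\psi_0$ is a critical point of $E$. -/

import Mathlib

open MeasureTheory Complex
open scoped FourierTransform ENNReal

noncomputable section

namespace NLDirac

/-- Physical space `ℝ³`. -/
abbrev R3 : Type := EuclideanSpace ℝ (Fin 3)

/-- The space of spinors `ℂ⁴` with its Hermitian norm. -/
abbrev C4 : Type := EuclideanSpace ℂ (Fin 4)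

/-- `L²(ℝ³, ℂ⁴)`. -/
abbrev L2 : Type := Lp C4 2 (volume : Measure R3)

/-! ### The Dirac operator as a Fourier multiplier

Mathlib's Fourier transform uses the kernel `exp (-2πi⟨x, ξ⟩)`, hence `-i∂ₖ` is the multiplier
`2π ξₖ` and `-Δ` is the multiplier `(2π‖ξ‖)²`. -/

/-- The Pauli matrices. -/
def pauli : Fin 3 → Matrix (Fin 2) (Fin 2) ℂ :=
  ![!![0, 1; 1, 0], !![0, -I; I, 0], !![1, 0; 0, -1]]

/-- The Dirac matrices `αᵏ`. -/
def alphaMat (k : Fin 3) : Matrix (Fin 4) (Fin 4) ℂ :=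
  Matrix.reindex finSumFinEquiv finSumFinEquiv (Matrix.fromBlocks 0 (pauli k) (pauli k) 0)

/-- The Dirac matrix `β`. -/
def betaMat : Matrix (Fin 4) (Fin 4) ℂ :=
  Matrix.reindex finSumFinEquiv finSumFinEquiv
    (Matrix.fromBlocks (1 : Matrix (Fin 2) (Fin 2) ℂ) 0 0 (-1 : Matrix (Fin 2) (Fin 2) ℂ))

/-- The symbol `√((2π‖ξ‖)² + m²)` of `√(-Δ + m²)`. -/
def energy (m : ℝ) (ξ : R3) : ℝ := √((2 * Real.pi * ‖ξ‖) ^ 2 + m ^ 2)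

/-- The symbol of the Dirac operator `H = -i α·∇ + m β`. -/
def diracSymbol (m : ℝ) (ξ : R3) : Matrix (Fin 4) (Fin 4) ℂ :=
  ∑ k, ((2 * Real.pi * ξ k : ℝ) : ℂ) • alphaMat k + (m : ℂ) • betaMat

/-- The symbol of `H |H|⁻¹`, the sign of the Dirac operator. -/
def signSymbol (m : ℝ) (ξ : R3) : C4 →L[ℂ] C4 :=
  (((energy m ξ)⁻¹ : ℝ) : ℂ) • Matrix.toEuclideanCLM (n := Fin 4) (𝕜 := ℂ) (diracSymbol m ξ)

theorem diracSymbol_eq (m : ℝ) (ξ : R3) : diracSymbol m ξ =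
    let p : Fin 3 → ℂ := fun k => ((2 * Real.pi * ξ k : ℝ) : ℂ)
    !![(m : ℂ), 0, p 2, p 0 - I * p 1;
       0, (m : ℂ), p 0 + I * p 1, -p 2;
       p 2, p 0 - I * p 1, -(m : ℂ), 0;
       p 0 + I * p 1, -p 2, 0, -(m : ℂ)] := by
  have h (A B C D : Matrix (Fin 2) (Fin 2) ℂ) :
      Matrix.reindex (finSumFinEquiv (m := 2) (n := 2)) (finSumFinEquiv (m := 2) (n := 2))
        (Matrix.fromBlocks A B C D) =
      (!![A 0 0, A 0 1, B 0 0, B 0 1; A 1 0, A 1 1, B 1 0, B 1 1;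
        C 0 0, C 0 1, D 0 0, D 0 1; C 1 0, C 1 1, D 1 0, D 1 1] :
        Matrix (Fin 4) (Fin 4) ℂ) := by
    ext i j
    fin_cases i <;> fin_cases j <;> rfl
  unfold diracSymbol alphaMat betaMat
  simp only [h, Fin.sum_univ_three, pauli]
  ext i j
  fin_cases i <;> fin_cases j <;> simp <;> ring

theorem energy_sq (m : ℝ) (ξ : R3) : energy m ξ ^ 2 = (2 * Real.pi * ‖ξ‖) ^ 2 + m ^ 2 :=
  Real.sq_sqrt (by positivity)

theorem energy_nonneg (m : ℝ) (ξ : R3) : 0 ≤ energy m ξ := Real.sqrt_nonneg _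

theorem diracSymbol_isHermitian (m : ℝ) (ξ : R3) : (diracSymbol m ξ).IsHermitian := by
  rw [diracSymbol_eq]
  ext i j
  fin_cases i <;> fin_cases j <;> simp [Matrix.conjTranspose_apply] <;> ring

theorem diracSymbol_mul_self (m : ℝ) (ξ : R3) :
    diracSymbol m ξ * diracSymbol m ξ = ((energy m ξ ^ 2 : ℝ) : ℂ) • 1 := by
  have hn : ‖ξ‖ ^ 2 = ξ 0 ^ 2 + ξ 1 ^ 2 + ξ 2 ^ 2 := by
    rw [EuclideanSpace.norm_sq_eq, Fin.sum_univ_three]; simp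
  have hI : I ^ 2 = -1 := I_sq
  rw [energy_sq, mul_pow, hn, diracSymbol_eq]
  ext i j
  fin_cases i <;> fin_cases j <;>
    simp [Matrix.mul_apply, Fin.sum_univ_four] <;> ring_nf <;> (try rw [hI]) <;> ring_nf

theorem norm_signSymbol_le (m : ℝ) (ξ : R3) (v : C4) : ‖signSymbol m ξ v‖ ≤ ‖v‖ := by
  set A := Matrix.toEuclideanCLM (n := Fin 4) (𝕜 := ℂ) (diracSymbol m ξ) with hA
  have hsa : IsSelfAdjoint A := by
    have h1 : star (diracSymbol m ξ) = diracSymbol m ξ := diracSymbol_isHermitian m ξ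
    rw [IsSelfAdjoint, hA, ← map_star, h1]
  have hAA : A * A = ((energy m ξ ^ 2 : ℝ) : ℂ) • 1 := by
    rw [hA, ← map_mul, diracSymbol_mul_self, map_smul, map_one]
  have hn : ‖A v‖ ^ 2 = (energy m ξ * ‖v‖) ^ 2 := by
    have h2 : inner ℂ (A v) (A v) = inner ℂ v ((A * A) v) := by
      rw [mul_apply_eq_comp]
      conv_rhs => rw [← ContinuousLinearMap.adjoint_inner_left]
      rw [← ContinuousLinearMap.star_eq_adjoint, hsa.star_eq]
    rw [hAA] at h2
    simp only [smul_apply, one_apply_eq_self, inner_smul_right,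
      inner_self_eq_norm_sq_to_K] at h2
    rw [mul_pow]
    have h3 : ((‖A v‖ ^ 2 : ℝ) : ℂ) = ((energy m ξ ^ 2 * ‖v‖ ^ 2 : ℝ) : ℂ) := by
      push_cast
      push_cast at h2
      exact h2
    exact_mod_cast h3
  have hn' : ‖A v‖ = energy m ξ * ‖v‖ :=
    (sq_eq_sq₀ (norm_nonneg _) (mul_nonneg (energy_nonneg m ξ) (norm_nonneg _))).1 hn
  rw [signSymbol, smul_apply, norm_smul, ← hA, hn', Complex.norm_real,
    norm_inv, Real.norm_of_nonneg (energy_nonneg m ξ), ← mul_assoc]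
  exact mul_le_of_le_one_left (norm_nonneg _) (inv_mul_le_one)

theorem measurable_energy (m : ℝ) : Measurable (energy m) := by
  unfold energy; fun_prop

theorem aestronglyMeasurable_signSymbol (m : ℝ) {f : R3 → C4}
    (hf : AEStronglyMeasurable f volume) :
    AEStronglyMeasurable (fun ξ => signSymbol m ξ (f ξ)) volume := by
  have h : (fun ξ => signSymbol m ξ (f ξ)) = fun ξ => (((energy m ξ)⁻¹ : ℝ) : ℂ) •
      (∑ k, ((2 * Real.pi * ξ k : ℝ) : ℂ) •
        Matrix.toEuclideanCLM (n := Fin 4) (𝕜 := ℂ) (alphaMat k) (f ξ) +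
        (m : ℂ) • Matrix.toEuclideanCLM (n := Fin 4) (𝕜 := ℂ) betaMat (f ξ)) := by
    funext ξ
    simp only [signSymbol, diracSymbol, map_add, map_sum, map_smul, sum_apply, smul_apply,
      add_apply]
  rw [h]
  have hc (B : C4 →L[ℂ] C4) : AEStronglyMeasurable (fun ξ => B (f ξ)) volume :=
    B.continuous.comp_aestronglyMeasurable hf
  refine AEStronglyMeasurable.fun_smul ?_ (AEStronglyMeasurable.fun_add ?_ ((hc _).fun_const_smul _))
  · exact (Complex.measurable_ofReal.comp (measurable_energy m).inv).aestronglyMeasurable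
  · simp only [Fin.sum_univ_three]
    have hs (k : Fin 3) : AEStronglyMeasurable
        (fun ξ : R3 => ((2 * Real.pi * ξ k : ℝ) : ℂ)) volume := by
      apply Measurable.aestronglyMeasurable
      fun_prop
    exact (((hs 0).fun_smul (hc _)).fun_add ((hs 1).fun_smul (hc _))).fun_add ((hs 2).fun_smul (hc _))

theorem memLp_signSymbol (m : ℝ) {f : R3 → C4} (hf : MemLp f 2 volume) :
    MemLp (fun ξ => signSymbol m ξ (f ξ)) 2 volume :=
  hf.of_le (aestronglyMeasurable_signSymbol m hf.1)
    (Filter.Eventually.of_forall fun ξ => norm_signSymbol_le m ξ (f ξ))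

/-- Multiplication by the symbol of `H |H|⁻¹` on the Fourier side. -/
def signMul (m : ℝ) : L2 →ₗ[ℂ] L2 where
  toFun f := (memLp_signSymbol m (Lp.memLp f)).toLp _
  map_add' f g := by
    rw [← MemLp.toLp_add]
    apply MemLp.toLp_congr
    filter_upwards [Lp.coeFn_add f g] with ξ h
    rw [h, Pi.add_apply, map_add, Pi.add_apply]
  map_smul' c f := by
    rw [RingHom.id_apply, ← MemLp.toLp_const_smul]
    apply MemLp.toLp_congr
    filter_upwards [Lp.coeFn_smul c f] with ξ h
    rw [h, Pi.smul_apply, map_smul, Pi.smul_apply]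

/-- The operator `H |H|⁻¹` on `L²(ℝ³, ℂ⁴)`. -/
def signL2 (m : ℝ) : L2 →ₗ[ℂ] L2 :=
  (Lp.fourierTransformₗᵢ R3 C4).symm.toLinearEquiv.toLinearMap ∘ₗ signMul m ∘ₗ
    (Lp.fourierTransformₗᵢ R3 C4).toLinearEquiv.toLinearMap

theorem fourier_signL2 (m : ℝ) (ψ : L2) : 𝓕 (signL2 m ψ) = signMul m (𝓕 ψ) :=
  (Lp.fourierTransformₗᵢ R3 C4).apply_symm_apply _

/-! ### The space `X = H^{1/2}(ℝ³, ℂ⁴)` -/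

/-- `H^{1/2}(ℝ³, ℂ⁴)` as a subspace of `L²`: those `ψ` for which
`∫ √((2π‖ξ‖)² + m²) |ψ̂(ξ)|² dξ` is finite. -/
def halfSobolev (m : ℝ) : Submodule ℂ L2 where
  carrier := {ψ | MemLp (fun ξ => √(energy m ξ) • (𝓕 ψ : L2) ξ) 2 volume}
  zero_mem' := by
    have h : (𝓕 (0 : L2) : L2) = 0 := (Lp.fourierTransformₗᵢ R3 C4).map_zero
    refine (memLp_congr_ae ?_).2 (MemLp.zero' (ε := C4))
    rw [h]
    filter_upwards [Lp.coeFn_zero C4 2 (volume : Measure R3)] with ξ hξ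
    rw [hξ, Pi.zero_apply, smul_zero]
  add_mem' {ψ φ} hψ hφ := by
    have h : (𝓕 (ψ + φ) : L2) = 𝓕 ψ + 𝓕 φ := (Lp.fourierTransformₗᵢ R3 C4).map_add ψ φ
    refine (memLp_congr_ae ?_).2 (MemLp.add hψ hφ)
    rw [h]
    filter_upwards [Lp.coeFn_add (𝓕 ψ : L2) (𝓕 φ)] with ξ hξ
    rw [hξ, Pi.add_apply, smul_add, Pi.add_apply]
  smul_mem' c ψ hψ := by
    have h : (𝓕 (c • ψ) : L2) = c • 𝓕 ψ := (Lp.fourierTransformₗᵢ R3 C4).map_smul c ψ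
    refine (memLp_congr_ae ?_).2 (MemLp.const_smul hψ c)
    rw [h]
    filter_upwards [Lp.coeFn_smul c (𝓕 ψ : L2)] with ξ hξ
    rw [hξ, Pi.smul_apply, smul_comm, Pi.smul_apply]

/-- The Hilbert space `X = H^{1/2}(ℝ³, ℂ⁴)`; it gets its own norm below. -/
def X (m : ℝ) : Type := halfSobolev m

instance (m : ℝ) : AddCommGroup (X m) := inferInstanceAs (AddCommGroup (halfSobolev m))

instance (m : ℝ) : Module ℂ (X m) := inferInstanceAs (Module ℂ (halfSobolev m))

/-- The inclusion `X ⊂ L²`. -/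
def toL2 (m : ℝ) : X m →ₗ[ℂ] L2 := (halfSobolev m).subtype

theorem memLp_weighted (m : ℝ) (ψ : X m) :
    MemLp (fun ξ => √(energy m ξ) • (𝓕 (toL2 m ψ) : L2) ξ) 2 volume := ψ.2

/-- The map `ψ ↦ (|2πξ|² + m²)^{1/4} ψ̂`. -/
def weightedFourier (m : ℝ) : X m →ₗ[ℂ] L2 where
  toFun ψ := (memLp_weighted m ψ).toLp _
  map_add' ψ φ := by
    rw [← MemLp.toLp_add]
    apply MemLp.toLp_congr
    have h : (𝓕 (toL2 m (ψ + φ)) : L2) = 𝓕 (toL2 m ψ) + 𝓕 (toL2 m φ) := by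
      rw [map_add]; exact (Lp.fourierTransformₗᵢ R3 C4).map_add _ _
    rw [h]
    filter_upwards [Lp.coeFn_add (𝓕 (toL2 m ψ) : L2) (𝓕 (toL2 m φ))] with ξ hξ
    rw [hξ, Pi.add_apply, smul_add, Pi.add_apply]
  map_smul' c ψ := by
    rw [RingHom.id_apply, ← MemLp.toLp_const_smul]
    apply MemLp.toLp_congr
    have h : (𝓕 (toL2 m (c • ψ)) : L2) = c • 𝓕 (toL2 m ψ) := by
      rw [map_smul]; exact (Lp.fourierTransformₗᵢ R3 C4).map_smul _ _
    rw [h]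
    filter_upwards [Lp.coeFn_smul c (𝓕 (toL2 m ψ) : L2)] with ξ hξ
    rw [hξ, Pi.smul_apply, smul_comm, Pi.smul_apply]

theorem weightedFourier_injective (m : ℝ) : Function.Injective (weightedFourier m) := by
  rw [injective_iff_map_eq_zero]
  intro ψ hψ
  have h1 : (fun ξ => √(energy m ξ) • (𝓕 (toL2 m ψ) : L2) ξ) =ᵐ[volume] 0 := by
    have h2 := (memLp_weighted m ψ).coeFn_toLp
    have h3 : (memLp_weighted m ψ).toLp _ = 0 := hψ
    rw [h3] at h2
    exact h2.symm.trans (Lp.coeFn_zero C4 2 (volume : Measure R3))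
  have h4 : ∀ᵐ ξ : R3, ξ ≠ 0 := by
    rw [ae_iff]; simp
  have h5 : (𝓕 (toL2 m ψ) : L2) = 0 := by
    apply Lp.ext
    filter_upwards [h1, h4, Lp.coeFn_zero C4 2 (volume : Measure R3)] with ξ hξ hne h0
    have hpos : 0 < energy m ξ := by
      have : 0 < ‖ξ‖ := norm_pos_iff.2 hne
      have := Real.pi_pos
      exact Real.sqrt_pos.2 (by positivity)
    rw [h0]
    simpa [(Real.sqrt_pos.2 hpos).ne'] using hξ
  have h6 : toL2 m ψ = 0 := by
    have : (Lp.fourierTransformₗᵢ R3 C4) (toL2 m ψ) = 0 := h5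
    simpa using this
  exact Subtype.ext h6

/-- `‖ψ‖_X² = ∫ √((2π‖ξ‖)² + m²) |ψ̂(ξ)|² dξ`. -/
instance (m : ℝ) : NormedAddCommGroup (X m) :=
  NormedAddCommGroup.induced (X m) L2 (weightedFourier m) (weightedFourier_injective m)

theorem norm_eq (m : ℝ) (ψ : X m) : ‖ψ‖ = ‖weightedFourier m ψ‖ := rfl

/-- `⟨ψ₁, ψ₂⟩_X = ∫ √((2π‖ξ‖)² + m²) ⟨ψ̂₁(ξ), ψ̂₂(ξ)⟩ dξ`. -/
instance (m : ℝ) : InnerProductSpace ℂ (X m) where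
  toModule := inferInstance
  norm_smul_le c ψ := by rw [norm_eq, norm_eq, map_smul, norm_smul]
  inner ψ φ := inner ℂ (weightedFourier m ψ) (weightedFourier m φ)
  norm_sq_eq_re_inner ψ := by rw [norm_eq]; exact norm_sq_eq_re_inner _
  conj_inner_symm ψ φ := inner_conj_symm _ _
  add_left ψ φ χ := by rw [map_add, inner_add_left]
  smul_left ψ φ c := by rw [map_smul, inner_smul_left]

/-! ### The spectral projections `Λ₊`, `Λ₋` -/

/-- `H |H|⁻¹` maps `X` to itself. -/
theorem signL2_mem (m : ℝ) (ψ : X m) : signL2 m (toL2 m ψ) ∈ halfSobolev m := by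
  have h2 := memLp_signSymbol m (memLp_weighted m ψ)
  change MemLp (fun ξ => √(energy m ξ) • (𝓕 (signL2 m (toL2 m ψ)) : L2) ξ) 2 volume
  refine (memLp_congr_ae ?_).2 h2
  rw [fourier_signL2]
  filter_upwards [MemLp.coeFn_toLp
    (memLp_signSymbol m (Lp.memLp (𝓕 (toL2 m ψ) : L2)))] with ξ hξ
  change √(energy m ξ) • ((memLp_signSymbol m (Lp.memLp (𝓕 (toL2 m ψ) : L2))).toLp _ : L2) ξ = _
  rw [hξ, ContinuousLinearMap.map_smul_of_tower]

/-- The sign `H |H|⁻¹` of the Dirac operator on `X`. -/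
def signX (m : ℝ) : X m →ₗ[ℂ] X m where
  toFun ψ := ⟨signL2 m (toL2 m ψ), signL2_mem m ψ⟩
  map_add' ψ φ := Subtype.ext (by
    change signL2 m (toL2 m (ψ + φ)) = signL2 m (toL2 m ψ) + signL2 m (toL2 m φ)
    rw [map_add, map_add])
  map_smul' c ψ := Subtype.ext (by
    change signL2 m (toL2 m (c • ψ)) = c • signL2 m (toL2 m ψ)
    rw [map_smul, map_smul])

/-- `Λ₊ = (1 + H |H|⁻¹) / 2`, the projection on the positive part of the spectrum of `H`. -/
def lambdaPos (m : ℝ) : X m →ₗ[ℂ] X m := (1 / 2 : ℂ) • (LinearMap.id + signX m)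

/-- `Λ₋ = (1 - H |H|⁻¹) / 2`, the projection on the negative part of the spectrum of `H`. -/
def lambdaNeg (m : ℝ) : X m →ₗ[ℂ] X m := (1 / 2 : ℂ) • (LinearMap.id - signX m)

/-- `X₊ = Λ₊ X`. -/
abbrev XPos (m : ℝ) : Submodule ℂ (X m) := LinearMap.range (lambdaPos m)

/-- `X₋ = Λ₋ X`. -/
abbrev XNeg (m : ℝ) : Submodule ℂ (X m) := LinearMap.range (lambdaNeg m)

/-- The `L²` norm of an element of `X`. -/
def normL2 {m : ℝ} (ψ : X m) : ℝ := ‖toL2 m ψ‖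

/-- The real part of the `L²` scalar product of two elements of `X`. -/
def reInnerL2 {m : ℝ} (ψ φ : X m) : ℝ := (inner ℂ (toL2 m ψ) (toL2 m φ)).re

/-! ### Functionals and critical points -/

/-- `I(ψ) = ½‖Λ₊ψ‖² - ½‖Λ₋ψ‖² - γ ∫ F(ψ)`. -/
def action (m γ : ℝ) (F : C4 → ℝ) (ψ : X m) : ℝ :=
  1 / 2 * ‖lambdaPos m ψ‖ ^ 2 - 1 / 2 * ‖lambdaNeg m ψ‖ ^ 2 - γ * ∫ x, F (toL2 m ψ x)

/-- `B_λ`, the open `L²`-ball of radius `√λ` in `X₋`. -/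
def negBall (m lam : ℝ) : Set (XNeg m) := {η | normL2 (η : X m) ^ 2 < lam}

/-- `a(η) = √(λ - |η|²)`, with the `L²` norm. -/
def coefA {m : ℝ} (lam : ℝ) (η : XNeg m) : ℝ := √(lam - normL2 (η : X m) ^ 2)

/-- `a(η) w + η`. -/
def combine {m : ℝ} (lam : ℝ) (w : XPos m) (η : XNeg m) : X m :=
  coefA lam η • (w : X m) + (η : X m)

/-- `J_w(η) = I(a(η) w + η)`. -/
def J (m γ : ℝ) (F : C4 → ℝ) (lam : ℝ) (w : XPos m) (η : XNeg m) : ℝ :=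
  action m γ F (combine lam w η)

/-- The reduced functional `E(w) = sup_{η ∈ B_λ} J_{w/|w|}(η)` on `X₊ ∖ {0}`. -/
def reducedE (m γ : ℝ) (F : C4 → ℝ) (lam : ℝ) (w : XPos m) : ℝ :=
  ⨆ η : negBall m lam, J m γ F lam ((normL2 (w : X m))⁻¹ • w) η

/-- `η` maximizes `J_w` over `B_λ`. -/
def IsMaximizer (m γ : ℝ) (F : C4 → ℝ) (lam : ℝ) (w : XPos m) (η : XNeg m) : Prop :=
  η ∈ negBall m lam ∧ ∀ η' ∈ negBall m lam, J m γ F lam w η' ≤ J m γ F lam w η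

/-- `x` is a (Fréchet) critical point of `f`. -/
def IsCriticalPoint {V : Type*} [NormedAddCommGroup V] [NormedSpace ℝ V] (f : V → ℝ) (x : V) :
    Prop :=
  DifferentiableAt ℝ f x ∧ ∀ h, fderiv ℝ f x h = 0

/-- `w` is a critical point of `f : X₊ ∖ {0} → ℝ` restricted to the `L²`-sphere of `X₊` through
`w`: the derivative vanishes on the tangent space of that sphere. -/
def IsCriticalOnPosSphere {m : ℝ} (f : XPos m → ℝ) (w : XPos m) : Prop :=
  DifferentiableAt ℝ f w ∧ ∀ v : XPos m, reInnerL2 (w : X m) v = 0 → fderiv ℝ f w v = 0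

/-- `ψ` is a critical point of `f : X → ℝ` restricted to the `L²`-sphere of `X` through `ψ`. -/
def IsCriticalOnSphere {m : ℝ} (f : X m → ℝ) (ψ : X m) : Prop :=
  DifferentiableAt ℝ f ψ ∧ ∀ h : X m, reInnerL2 ψ h = 0 → fderiv ℝ f ψ h = 0

/-- `df(ψ)[h] = ω Re⟨ψ, h⟩_{L²}` for all `h ∈ X`. -/
def SolvesMultiplierEq {m : ℝ} (f : X m → ℝ) (ψ : X m) (ω : ℝ) : Prop :=
  DifferentiableAt ℝ f ψ ∧ ∀ h : X m, fderiv ℝ f ψ h = ω * reInnerL2 ψ h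

/-! ### Hypotheses on the nonlinearity and constants -/

/-- The assumptions on `F`. With respect to the real scalar product `Re⟨·,·⟩` of `ℂ⁴`, the
derivative `fderiv ℝ F φ` is `⟨∇F(φ), ·⟩`, and its operator norm is `|∇F(φ)|`. -/
structure Nonlinearity (F : C4 → ℝ) (α : ℝ) : Prop where
  contDiff : ContDiff ℝ 2 F
  grad_zero : fderiv ℝ F 0 = 0
  hess_zero : fderiv ℝ (fderiv ℝ F) 0 = 0
  hess_bound : ∃ R > 0, ∀ φ : C4, R ≤ ‖φ‖ → ‖fderiv ℝ (fderiv ℝ F) φ‖ ≤ ‖φ‖ ^ (α - 2)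
  superquadratic : ∀ φ : C4, α * F φ ≤ fderiv ℝ F φ φ ∧ 0 ≤ α * F φ
  convex : ∀ φ ζ : C4, 0 ≤ fderiv ℝ (fderiv ℝ F) φ ζ ζ

/-- `S_p`, the best constant in `|ψ|_p ≤ S_p ‖ψ‖_X`. -/
def sobolevConst (m p : ℝ) : ℝ :=
  sInf {S : ℝ | 0 ≤ S ∧
    ∀ ψ : X m, eLpNorm (toL2 m ψ) (ENNReal.ofReal p) volume ≤ ENNReal.ofReal (S * ‖ψ‖)}

/-- `S₂² + μ λ^{(α-2)/2} S₃^{3(α-2)} S₂^{3α-8}`. -/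
def sizeConst (m α lam μ : ℝ) : ℝ :=
  sobolevConst m 2 ^ 2 + μ * lam ^ ((α - 2) / 2) * sobolevConst m 3 ^ (3 * (α - 2)) *
    sobolevConst m 2 ^ (3 * α - 8)

/-- `C_{α,λ} = 4 (S₂² + μ λ^{(α-2)/2} S₃^{3(α-2)} S₂^{3α-8})`. -/
def constC (m α lam μ : ℝ) : ℝ := 4 * sizeConst m α lam μ

end NLDirac

end

/-! The constraint is resolved by maximizing over the negative directions first. On the fibre of
points a(η)w + η, with w of unit L² norm, the quadratic part of I equals ½λ‖w‖² − ½|η|₂²‖w‖² −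
½‖η‖², and −γ∫F is concave in ψ because F is convex. The map η ↦ a(η)w + η is not affine, though:
the curvature of a(η) produces an error γ dG(ψ)[w] of second order, where G = ∫F. The smallness γK <
1/4, with K = `growthConst`, lets ½|η|₂²‖w‖² absorb it. Comparing with η = 0 confines every relevant
competitor to a small set, and there J_w lies below its tangents by ½‖·‖² (`reduced_le_tangent`).

Everything else follows from this inequality. Maximizing sequences are Cauchy, so a maximizer exists
without any compactness, and it is unique (`exists_isMax`, `IsMax.unique`). The quadratic gap makes
η(w) Hölder continuous of order 1/2, which suffices for an envelope argument: the value has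
derivative a(η) dI(ψ) along the unit sphere (`value_expansion`), and since E is invariant under
scaling it is differentiable on X₊ ∖ {0}. The radial derivative of E vanishes, so critical points on
the sphere are critical points.

For (a), criticality of E controls dI(ψ₀) on X₊ and maximality of η controls it along the fibre;
together they give the multiplier equation (`IsMax.dAction_eq`). Testing it with w₀ bounds ω below,
and testing it with ψ₀, with 2F ≤ ⟨∇F(φ), φ⟩, gives λω ≤ 2I(ψ₀). For (b), positivity of ω and
testing with both components of ψ₀ show that Λ₋ψ₀ lies in the small set. It is a critical point of
J_w, hence the maximizer (`isMax_of_multiplier`).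

The analytic input is H^{1/2} ⊂ L³ with constant at most 1 (`lintegral_norm_cube_le`), Hölder's
inequality, and two bounds for d∫F. The bound by `growthConst` drives the concavity. The one by
`sizeConst` is needed for the constant in the lower bound of ω. Interpolation gives the exponent 8 −
3α of S₂, while `sizeConst` contains 3α − 8; the case S₂ > 1 is saved by S₃ ≤ 1, λ ≤ 1 and a bound
|∇F(φ)| ≤ (16/5)|φ|^{α−1} that follows from the structure of F alone
(`potentialDeriv_le_sizeConst`). -/

namespace NLDirac

/-! ### The critical Sobolev embedding `H^{1/2} ⊂ L³` -/

section Fourier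

variable {E F : Type*} [NormedAddCommGroup E] [InnerProductSpace ℝ E] [FiniteDimensional ℝ E]
  [MeasurableSpace E] [BorelSpace E]
  [NormedAddCommGroup F] [InnerProductSpace ℂ F] [CompleteSpace F]

/-- On `L¹ ∩ L²` the inverse Fourier transform is given by the Fourier integral. -/
theorem coeFn_fourierInv_of_integrable (h : Lp (α := E) F 2) (hi : Integrable h volume) :
    ((𝓕⁻ h : Lp (α := E) F 2) : E → F) =ᵐ[volume] 𝓕⁻ (h : E → F) := by
  have hL : Continuous fun p : E × E => (-innerₗ E) p.1 p.2 := by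
    simp only [LinearMap.neg_apply]
    exact (continuous_inner (𝕜 := ℝ) (E := E)).neg
  have hcont : Continuous (𝓕⁻ (h : E → F)) :=
    VectorFourier.fourierIntegral_continuous Real.continuous_fourierChar hL hi
  have hloc : LocallyIntegrable ((𝓕⁻ h : Lp F 2 (volume : Measure E)) : E → F) volume :=
    MemLp.locallyIntegrable (Lp.memLp _) (by norm_num)
  apply ae_eq_of_integral_contDiff_smul_eq hloc
    hcont.locallyIntegrable
  -- Testing against smooth compactly supported functions: the L² inverse transform is the
  -- distributional one, and self-adjointness of the Fourier integral moves it from the test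
  -- function to the integrable function.
  intro g hg hgc
  have hg1 : ContDiff ℝ (⊤ : ℕ∞) (fun x => ((g x : ℝ) : ℂ)) := Complex.ofRealCLM.contDiff.comp hg
  have hg2 : HasCompactSupport (fun x => ((g x : ℝ) : ℂ)) := hgc.comp_left Complex.ofReal_zero
  let φ : SchwartzMap E ℂ := hg2.toSchwartzMap hg1
  have hφ (x : E) : φ x = ((g x : ℝ) : ℂ) := rfl
  have h1 := congrArg (fun T => T φ) (Lp.fourierInv_toTemperedDistribution_eq h)
  simp only [TemperedDistribution.fourierInv_apply, Lp.toTemperedDistribution_apply] at h1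
  have h2 := VectorFourier.integral_fourierIntegral_smul_eq_flip (μ := volume) (ν := volume)
    (L := -innerₗ E) (f := φ) (g := h) Real.continuous_fourierChar hL φ.integrable hi
  have h3 : ∀ ξ : E, VectorFourier.fourierIntegral Real.fourierChar volume (-innerₗ E) φ ξ =
      (𝓕⁻ φ : SchwartzMap E ℂ) ξ := by
    intro ξ
    rw [SchwartzMap.fourierInv_coe]; rfl
  have h4 : ∀ x : E, VectorFourier.fourierIntegral Real.fourierChar volume (-innerₗ E).flip h x =
      𝓕⁻ (h : E → F) x := by
    intro x
    have : (-innerₗ E).flip = -innerₗ E := by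
      ext a b; simp [real_inner_comm]
    rw [this]; rfl
  simp only [h3, h4] at h2
  rw [h2] at h1
  simp only [hφ, Complex.coe_smul] at h1
  exact h1.symm

theorem ae_norm_fourierInv_le (h : Lp (α := E) F 2) (hi : Integrable h volume) :
    ∀ᵐ x, ‖(𝓕⁻ h : Lp (α := E) F 2) x‖ ≤ ∫ ξ, ‖h ξ‖ := by
  filter_upwards [coeFn_fourierInv_of_integrable h hi] with x hx
  rw [hx]
  exact VectorFourier.norm_fourierIntegral_le_integral_norm _ _ _ _ _

end Fourier

/-! ### Frequency splitting and the layer-cake proof of H^{1/2} ⊂ L³ -/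

theorem volume_real_ball_one : (volume : Measure R3).real (Metric.ball 0 1) = Real.pi * 4 / 3 := by
  rw [Measure.real, EuclideanSpace.volume_ball_fin_three]
  simp
  positivity

/-- Polar coordinates: 4π ∫₀^A r² r⁻¹ dr. The value 2πA² cancels the 2π of
`lintegral_norm_mul_fourier_le` in the low-frequency estimate. -/
theorem lintegral_inv_norm_ball {A : ℝ} (hA : 0 ≤ A) :
    ∫⁻ ξ in Metric.ball (0 : R3) A, ENNReal.ofReal ‖ξ‖⁻¹ = ENNReal.ofReal (2 * Real.pi * A ^ 2) := by
  have hint : IntegrableOn (fun y : ℝ => y) (Set.Ioo 0 A) :=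
    (continuous_id.integrableOn_Icc (a := 0) (b := A)).mono_set Set.Ioo_subset_Icc_self
  have hcongr : ∀ y ∈ Set.Ioo (0 : ℝ) A, y ^ (Module.finrank ℝ R3 - 1) • y⁻¹ = y := by
    intro y hy
    have : y ≠ 0 := hy.1.ne'
    simp
    field_simp
  have hi : IntegrableOn (fun ξ : R3 => ‖ξ‖⁻¹) (Metric.ball 0 A) := by
    rw [integrableOn_fun_norm_addHaar (volume : Measure R3) (f := fun r => r⁻¹)]
    exact hint.congr_fun (fun y hy => (hcongr y hy).symm) measurableSet_Ioo
  rw [← ofReal_integral_eq_lintegral_ofReal hi (Filter.Eventually.of_forall fun ξ => by positivity)]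
  congr 1
  rw [← integral_indicator measurableSet_ball]
  have h1 : (fun ξ : R3 => (Metric.ball (0 : R3) A).indicator (fun ξ => ‖ξ‖⁻¹) ξ) =
      fun ξ => (Set.Iio A).indicator (fun r => r⁻¹) ‖ξ‖ := by
    funext ξ; simp [Set.indicator]
  rw [h1, integral_fun_norm_addHaar (volume : Measure R3) ((Set.Iio A).indicator (fun r => r⁻¹)),
    volume_real_ball_one]
  have h2 : ∫ y in Set.Ioi (0 : ℝ), y ^ (Module.finrank ℝ R3 - 1) •
      (Set.Iio A).indicator (fun r => r⁻¹) y = A ^ 2 / 2 := by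
    have h3 : (fun y : ℝ => y ^ (Module.finrank ℝ R3 - 1) •
        (Set.Iio A).indicator (fun r => r⁻¹) y) = (Set.Iio A).indicator
          (fun y => y ^ (Module.finrank ℝ R3 - 1) • y⁻¹) := by
      funext y; simp [Set.indicator]
    rw [h3, setIntegral_indicator measurableSet_Iio, Set.Ioi_inter_Iio,
      setIntegral_congr_fun measurableSet_Ioo hcongr, ← integral_Ioc_eq_integral_Ioo,
      ← intervalIntegral.integral_of_le hA, integral_id]
    ring
  rw [h2]
  simp
  ring

theorem norm_sq_lintegral (ψ : L2) : ∫⁻ x, ‖ψ x‖ₑ ^ 2 = ENNReal.ofReal (‖ψ‖ ^ 2) := by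
  have h := Lp.enorm_def ψ
  rw [eLpNorm_eq_lintegral_rpow_enorm_toReal (by norm_num) (by norm_num)] at h
  have h2 : ‖ψ‖ₑ ^ 2 = ∫⁻ x, ‖ψ x‖ₑ ^ 2 := by
    rw [h, ← ENNReal.rpow_natCast, ← ENNReal.rpow_mul]
    simp
  rw [← h2, ENNReal.ofReal_pow (norm_nonneg _), ofReal_norm]

theorem norm_sq_eq_lintegral {m : ℝ} (ψ : X m) :
    ∫⁻ ξ, ENNReal.ofReal (energy m ξ) * ‖(𝓕 (toL2 m ψ) : L2) ξ‖ₑ ^ 2 =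
      ENNReal.ofReal (‖ψ‖ ^ 2) := by
  rw [norm_eq, ← norm_sq_lintegral]
  apply lintegral_congr_ae
  filter_upwards [(memLp_weighted m ψ).coeFn_toLp] with ξ hξ
  change _ = ‖((memLp_weighted m ψ).toLp _ : L2) ξ‖ₑ ^ 2
  rw [hξ, enorm_smul, mul_pow, Real.enorm_of_nonneg (Real.sqrt_nonneg _),
    ← ENNReal.ofReal_pow (Real.sqrt_nonneg _), Real.sq_sqrt (energy_nonneg m ξ)]

theorem le_energy (m : ℝ) (ξ : R3) : 2 * Real.pi * ‖ξ‖ ≤ energy m ξ :=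
  Real.le_sqrt_of_sq_le (by nlinarith [sq_nonneg m])

theorem mass_le_energy (m : ℝ) (ξ : R3) : m ≤ energy m ξ :=
  Real.le_sqrt_of_sq_le (by nlinarith [sq_nonneg (2 * Real.pi * ‖ξ‖)])

theorem lintegral_norm_mul_fourier_le {m : ℝ} (ψ : X m) :
    ∫⁻ ξ, ENNReal.ofReal ‖ξ‖ * ‖(𝓕 (toL2 m ψ) : L2) ξ‖ₑ ^ 2 ≤
      ENNReal.ofReal (‖ψ‖ ^ 2 / (2 * Real.pi)) := by
  have hpi : (0 : ℝ) < 2 * Real.pi := by positivity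
  rw [ENNReal.ofReal_div_of_pos hpi, ENNReal.le_div_iff_mul_le (Or.inl (ENNReal.ofReal_pos.2 hpi).ne')
      (Or.inl ENNReal.ofReal_ne_top),
    ← lintegral_mul_const' _ _ ENNReal.ofReal_ne_top, ← norm_sq_eq_lintegral]
  apply lintegral_mono
  intro ξ
  have : ENNReal.ofReal ‖ξ‖ * ENNReal.ofReal (2 * Real.pi) ≤ ENNReal.ofReal (energy m ξ) := by
    rw [← ENNReal.ofReal_mul (norm_nonneg _)]
    exact ENNReal.ofReal_le_ofReal (by linarith [le_energy m ξ])
  calc _ = ENNReal.ofReal ‖ξ‖ * ENNReal.ofReal (2 * Real.pi) * ‖(𝓕 (toL2 m ψ) : L2) ξ‖ₑ ^ 2 := by ring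
    _ ≤ _ := mul_le_mul_left this _

/-- Frequencies below `A` contribute at most `A ‖ψ‖` to the supremum norm. -/
theorem lintegral_low_frequency_le {m : ℝ} (ψ : X m) {A : ℝ} (hA : 0 ≤ A) :
    ∫⁻ ξ in Metric.ball (0 : R3) A, ‖(𝓕 (toL2 m ψ) : L2) ξ‖ₑ ≤ ENNReal.ofReal (A * ‖ψ‖) := by
  set u : L2 := 𝓕 (toL2 m ψ)
  have hum : AEMeasurable (fun ξ => ‖u ξ‖ₑ) volume := (Lp.aestronglyMeasurable u).enorm
  have h0 : ∀ᵐ ξ : R3, ξ ≠ 0 := by rw [ae_iff]; simp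
  -- Cauchy–Schwarz for the factorization |û| = |ξ|^{−1/2} · (|ξ|^{1/2}|û|), valid off the null set
  -- {0}.
  have h1 : ∫⁻ ξ in Metric.ball (0 : R3) A, ‖u ξ‖ₑ = ∫⁻ ξ in Metric.ball (0 : R3) A,
      (ENNReal.ofReal ‖ξ‖⁻¹) ^ (1 / 2 : ℝ) * (ENNReal.ofReal ‖ξ‖ * ‖u ξ‖ₑ ^ 2) ^ (1 / 2 : ℝ) := by
    apply lintegral_congr_ae
    filter_upwards [ae_restrict_of_ae h0] with ξ hξ
    have hξ' : 0 < ‖ξ‖ := norm_pos_iff.2 hξ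
    rw [← ENNReal.mul_rpow_of_nonneg _ _ (by norm_num), ← mul_assoc,
      ← ENNReal.ofReal_mul (by positivity), inv_mul_cancel₀ hξ'.ne', ENNReal.ofReal_one, one_mul,
      ← ENNReal.rpow_natCast, ← ENNReal.rpow_mul]
    simp
  rw [h1]
  refine (ENNReal.lintegral_mul_norm_pow_le (by fun_prop) (by fun_prop) (by norm_num) (by norm_num)
    (by norm_num)).trans ?_
  rw [lintegral_inv_norm_ball hA]
  have h2 : ∫⁻ ξ in Metric.ball (0 : R3) A, ENNReal.ofReal ‖ξ‖ * ‖u ξ‖ₑ ^ 2 ≤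
      ENNReal.ofReal (‖ψ‖ ^ 2 / (2 * Real.pi)) :=
    (setLIntegral_le_lintegral _ _).trans (lintegral_norm_mul_fourier_le ψ)
  refine (mul_le_mul_right (ENNReal.rpow_le_rpow h2 (by norm_num)) _).trans ?_
  rw [← ENNReal.mul_rpow_of_nonneg _ _ (by norm_num), ← ENNReal.ofReal_mul (by positivity),
    ENNReal.ofReal_rpow_of_nonneg (by positivity) (by norm_num)]
  apply ENNReal.ofReal_le_ofReal
  have hpi := Real.pi_pos
  have : 2 * Real.pi * A ^ 2 * (‖ψ‖ ^ 2 / (2 * Real.pi)) = (A * ‖ψ‖) ^ 2 := by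
    field_simp
  rw [this, ← Real.sqrt_eq_rpow, Real.sqrt_sq (by positivity)]

/-- Layer-cake weight for the cube. Since `ENNReal.ofReal` truncates at 0, the integrand is the
square of the positive part (r − t)₊. -/
theorem lintegral_sq_sub {r : ℝ} (hr : 0 ≤ r) :
    ∫⁻ t in Set.Ioi (0 : ℝ), ENNReal.ofReal (r - t) ^ 2 = ENNReal.ofReal (r ^ 3 / 3) := by
  have h1 : ∫⁻ t in Set.Ioi (0 : ℝ), ENNReal.ofReal (r - t) ^ 2 =
      ∫⁻ t in Set.Ioc (0 : ℝ) r, ENNReal.ofReal ((r - t) ^ 2) := by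
    rw [← Set.Ioc_union_Ioi_eq_Ioi hr, lintegral_union measurableSet_Ioi (by
      rw [Set.disjoint_left]; intro x hx hx'; exact absurd hx.2 (not_le.2 hx'))]
    rw [setLIntegral_congr_fun (g := fun _ => 0) measurableSet_Ioi (fun t ht => by
      simp [ENNReal.ofReal_of_nonpos (show r - t ≤ 0 by linarith [Set.mem_Ioi.1 ht])])]
    rw [lintegral_zero, add_zero]
    apply setLIntegral_congr_fun measurableSet_Ioc
    intro t ht
    exact (ENNReal.ofReal_pow (by linarith [ht.2]) 2).symm
  have hcont : Continuous fun t : ℝ => (r - t) ^ 2 := by fun_prop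
  rw [h1, ← ofReal_integral_eq_lintegral_ofReal
    (hcont.integrableOn_Ioc) (Filter.Eventually.of_forall fun t => sq_nonneg _),
    ← intervalIntegral.integral_of_le hr]
  congr 1
  rw [intervalIntegral.integral_comp_sub_left (fun t => t ^ 2) r]
  simp
  norm_num

/-- The excess of `|ψ|` over the level `t` is controlled by the frequencies above `t / ‖ψ‖`. -/
theorem lintegral_excess_le {m : ℝ} (ψ : X m) (hψ : 0 < ‖ψ‖) {t : ℝ} (ht : 0 < t) :
    ∫⁻ x, ENNReal.ofReal (‖toL2 m ψ x‖ - t) ^ 2 ≤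
      ∫⁻ ξ, {ξ : R3 | t ≤ ‖ψ‖ * ‖ξ‖}.indicator (fun ξ => ‖(𝓕 (toL2 m ψ) : L2) ξ‖ₑ ^ 2) ξ := by
  set u : L2 := 𝓕 (toL2 m ψ) with hu
  -- This radius makes the low-frequency bound A‖ψ‖ equal to t, so whatever exceeds t is due to the
  -- high frequencies.
  set B : Set R3 := Metric.ball 0 (t / ‖ψ‖) with hB
  have hBm : MeasurableSet B := measurableSet_ball
  have hml : MemLp (B.indicator u) 2 volume := (Lp.memLp u).indicator hBm
  set h : L2 := hml.toLp _ with hh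
  have hcoe : h =ᵐ[volume] B.indicator u := hml.coeFn_toLp
  have hlow : ∫⁻ ξ, ‖h ξ‖ₑ ≤ ENNReal.ofReal t := by
    have h1 : ∫⁻ ξ, ‖h ξ‖ₑ = ∫⁻ ξ in B, ‖u ξ‖ₑ := by
      rw [← lintegral_indicator hBm]
      apply lintegral_congr_ae
      filter_upwards [hcoe] with ξ hξ
      rw [hξ, enorm_indicator_eq_indicator_enorm]
    rw [h1]
    refine (lintegral_low_frequency_le ψ (by positivity)).trans ?_
    rw [div_mul_cancel₀ _ hψ.ne']
  have hint : Integrable h volume :=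
    ⟨Lp.aestronglyMeasurable h, hlow.trans_lt ENNReal.ofReal_lt_top⟩
  have hsup : ∀ᵐ x, ‖(𝓕⁻ h : L2) x‖ ≤ t := by
    have h2 : ∫ ξ, ‖h ξ‖ ≤ t := by
      rw [integral_norm_eq_lintegral_enorm hint.1]
      exact ENNReal.toReal_le_of_le_ofReal ht.le hlow
    filter_upwards [ae_norm_fourierInv_le h hint] with x hx
    exact hx.trans h2
  set k : L2 := 𝓕⁻ (u - h) with hk
  have hfk : toL2 m ψ = 𝓕⁻ h + k := by
    have h3 : (𝓕⁻ (u - h) : L2) = 𝓕⁻ u - 𝓕⁻ h := (Lp.fourierTransformₗᵢ R3 C4).symm.map_sub u h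
    have h4 : (𝓕⁻ u : L2) = toL2 m ψ := (Lp.fourierTransformₗᵢ R3 C4).symm_apply_apply _
    rw [hk, h3, h4]; abel
  have hkn : ‖k‖ = ‖u - h‖ := (Lp.fourierTransformₗᵢ R3 C4).symm.norm_map _
  calc ∫⁻ x, ENNReal.ofReal (‖toL2 m ψ x‖ - t) ^ 2 ≤ ∫⁻ x, ‖k x‖ₑ ^ 2 := by
        apply lintegral_mono_ae
        have h5 := Lp.coeFn_add (𝓕⁻ h : L2) k
        rw [← hfk] at h5
        filter_upwards [hsup, h5] with x hx h6
        rw [← ofReal_norm]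
        gcongr
        rw [h6, Pi.add_apply]
        linarith [norm_add_le ((𝓕⁻ h : L2) x) (k x)]
    _ = ∫⁻ ξ, ‖(u - h) ξ‖ₑ ^ 2 := by rw [norm_sq_lintegral, norm_sq_lintegral, hkn]
    _ ≤ _ := by
        apply lintegral_mono_ae
        filter_upwards [hcoe, Lp.coeFn_sub u h] with ξ h7 h8
        rw [h8, Pi.sub_apply, h7]
        by_cases hξ : ξ ∈ B
        · simp [hξ]
        · have : ξ ∈ {ξ : R3 | t ≤ ‖ψ‖ * ‖ξ‖} := by
            rw [hB, mem_ball_zero_iff, not_lt, div_le_iff₀ hψ] at hξ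
            rw [Set.mem_ofPred_eq]; linarith
          rw [Set.indicator_of_notMem hξ, Set.indicator_of_mem this, sub_zero]

/-- Write |f|³ = 3∫(|f| − t)₊² dt, bound each level by the frequencies above t/‖ψ‖, and exchange the
integrals: the set of admissible t has length ‖ψ‖|ξ|, which leaves 3‖ψ‖∫|ξ||û|² ≤ (3/2π)‖ψ‖³. The
constant 1 suffices because 3 < 2π. -/
theorem lintegral_norm_cube_le {m : ℝ} (ψ : X m) :
    ∫⁻ x, ‖toL2 m ψ x‖ₑ ^ 3 ≤ ENNReal.ofReal (‖ψ‖ ^ 3) := by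
  rcases (norm_nonneg ψ).eq_or_lt with h0 | hψ
  · have h1 : ψ = 0 := norm_eq_zero.1 h0.symm
    have h2 : ∫⁻ x, ‖toL2 m ψ x‖ₑ ^ 3 = 0 := by
      rw [h1, map_zero, ← lintegral_zero (μ := (volume : Measure R3))]
      apply lintegral_congr_ae
      filter_upwards [Lp.coeFn_zero C4 2 (volume : Measure R3)] with x hx
      rw [hx]; simp
    rw [h2]; exact zero_le
  set f : L2 := toL2 m ψ with hf
  set u : L2 := 𝓕 f with hu
  have hfm : Measurable f := (Lp.stronglyMeasurable f).measurable
  have hum : Measurable u := (Lp.stronglyMeasurable u).measurable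
  have h1 : ∀ x, ‖f x‖ₑ ^ 3 = 3 * ∫⁻ t in Set.Ioi (0 : ℝ), ENNReal.ofReal (‖f x‖ - t) ^ 2 := by
    intro x
    rw [lintegral_sq_sub (norm_nonneg _), ← ofReal_norm, ← ENNReal.ofReal_pow (norm_nonneg _)]
    rw [show (3 : ℝ≥0∞) = ENNReal.ofReal 3 by simp, ← ENNReal.ofReal_mul (by norm_num)]
    congr 1; ring
  have hpi := Real.pi_gt_three
  have hset : MeasurableSet {p : R3 × ℝ | p.2 ≤ ‖ψ‖ * ‖p.1‖} :=
    measurableSet_le measurable_snd (by fun_prop)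
  calc ∫⁻ x, ‖f x‖ₑ ^ 3 = 3 * ∫⁻ x, ∫⁻ t in Set.Ioi (0 : ℝ), ENNReal.ofReal (‖f x‖ - t) ^ 2 := by
        simp_rw [h1]
        rw [lintegral_const_mul' _ _ (by norm_num)]
    _ = 3 * ∫⁻ t in Set.Ioi (0 : ℝ), ∫⁻ x, ENNReal.ofReal (‖f x‖ - t) ^ 2 := by
        rw [lintegral_lintegral_swap]
        apply Measurable.aemeasurable
        exact (ENNReal.measurable_ofReal.comp
          ((hfm.comp measurable_fst).norm.sub measurable_snd)).pow_const 2
    _ ≤ 3 * ∫⁻ t in Set.Ioi (0 : ℝ), ∫⁻ ξ,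
          {ξ : R3 | t ≤ ‖ψ‖ * ‖ξ‖}.indicator (fun ξ => ‖u ξ‖ₑ ^ 2) ξ := by
        gcongr 3 * ?_
        exact setLIntegral_mono' measurableSet_Ioi fun t ht => lintegral_excess_le ψ hψ ht
    _ = 3 * ∫⁻ ξ, ∫⁻ t in Set.Ioi (0 : ℝ),
          {ξ : R3 | t ≤ ‖ψ‖ * ‖ξ‖}.indicator (fun ξ => ‖u ξ‖ₑ ^ 2) ξ := by
        rw [lintegral_lintegral_swap]
        apply Measurable.aemeasurable
        have h2 : Measurable ({p : R3 × ℝ | p.2 ≤ ‖ψ‖ * ‖p.1‖}.indicator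
            (fun p => ‖u p.1‖ₑ ^ 2)) :=
          ((hum.comp measurable_fst).enorm.pow_const 2).indicator hset
        exact h2.comp measurable_swap
    _ = 3 * ∫⁻ ξ, ENNReal.ofReal ‖ψ‖ * (ENNReal.ofReal ‖ξ‖ * ‖u ξ‖ₑ ^ 2) := by
        congr 2
        funext ξ
        have h3 : (fun t => {ξ : R3 | t ≤ ‖ψ‖ * ‖ξ‖}.indicator (fun ξ => ‖u ξ‖ₑ ^ 2) ξ) =
            (Set.Iic (‖ψ‖ * ‖ξ‖)).indicator (fun _ => ‖u ξ‖ₑ ^ 2) := by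
          funext t; simp [Set.indicator]
        rw [h3, setLIntegral_indicator measurableSet_Iic, Set.inter_comm, Set.Ioi_inter_Iic,
          setLIntegral_const, Real.volume_Ioc, sub_zero, ENNReal.ofReal_mul (norm_nonneg _)]
        ring
    _ = 3 * (ENNReal.ofReal ‖ψ‖ * ∫⁻ ξ, ENNReal.ofReal ‖ξ‖ * ‖u ξ‖ₑ ^ 2) := by
        rw [lintegral_const_mul' _ _ ENNReal.ofReal_ne_top]
    _ ≤ 3 * (ENNReal.ofReal ‖ψ‖ * ENNReal.ofReal (‖ψ‖ ^ 2 / (2 * Real.pi))) := by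
        gcongr
        exact lintegral_norm_mul_fourier_le ψ
    _ ≤ _ := by
        rw [show (3 : ℝ≥0∞) = ENNReal.ofReal 3 by simp, ← ENNReal.ofReal_mul (by positivity),
          ← ENNReal.ofReal_mul (by norm_num)]
        apply ENNReal.ofReal_le_ofReal
        have : 3 * (‖ψ‖ * (‖ψ‖ ^ 2 / (2 * Real.pi))) = (3 / (2 * Real.pi)) * ‖ψ‖ ^ 3 := by
          field_simp
        rw [this]
        apply mul_le_of_le_one_left (by positivity)
        rw [div_le_one (by positivity)]; linarith

/-! ### Hölder and interpolation inequalities -/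

section Holder

variable {Ω E : Type*} [MeasurableSpace Ω] {ν : Measure Ω} [NormedAddCommGroup E]

theorem lintegral_rpow_enorm_rpow_eq {f : Ω → E} {p : ℝ} (hp : 0 < p) (s : ℝ) :
    (∫⁻ x, ‖f x‖ₑ ^ p ∂ν) ^ s = eLpNorm f (ENNReal.ofReal p) ν ^ (p * s) := by
  rw [eLpNorm_eq_lintegral_rpow_enorm_toReal (by simpa using hp) (by simp),
    ENNReal.toReal_ofReal hp.le, ← ENNReal.rpow_mul]
  congr 1
  field_simp

theorem eLpNorm_le_interpolation {f : Ω → E} (hf : AEStronglyMeasurable f ν) {α : ℝ}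
    (hα : 2 < α) (hα' : α ≤ 8 / 3) :
    eLpNorm f (ENNReal.ofReal (4 / (4 - α))) ν ≤
      eLpNorm f (ENNReal.ofReal 3) ν ^ (3 * (α - 2) / 2) *
        eLpNorm f (ENNReal.ofReal 2) ν ^ ((8 - 3 * α) / 2) := by
  have h4 : 0 < 4 - α := by linarith
  have hp : 0 < 4 / (4 - α) := by positivity
  -- The weights solve 3s + 2t = 4/(4 − α) and s + t = 1; t ≥ 0 is the condition α ≤ 8/3.
  set s := 2 * (α - 2) / (4 - α) with hs
  set t := (8 - 3 * α) / (4 - α) with ht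
  have hs0 : 0 ≤ s := by apply div_nonneg <;> linarith
  have ht0 : 0 ≤ t := by apply div_nonneg <;> linarith
  have hst : s + t = 1 := by rw [hs, ht]; field_simp; ring
  have h1 : ∫⁻ x, ‖f x‖ₑ ^ (4 / (4 - α)) ∂ν =
      ∫⁻ x, (‖f x‖ₑ ^ (3 : ℝ)) ^ s * (‖f x‖ₑ ^ (2 : ℝ)) ^ t ∂ν := by
    congr with x
    rw [← ENNReal.rpow_mul, ← ENNReal.rpow_mul, ← ENNReal.rpow_add_of_nonneg _ _
      (by positivity) (by positivity)]
    congr 1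
    rw [hs, ht]; field_simp; ring
  have hfm := hf.enorm
  have h2 := ENNReal.lintegral_mul_norm_pow_le (μ := ν) (f := fun x => ‖f x‖ₑ ^ (3 : ℝ))
    (g := fun x => ‖f x‖ₑ ^ (2 : ℝ)) (by fun_prop) (by fun_prop) hs0 ht0 hst
  rw [← h1, lintegral_rpow_enorm_rpow_eq (by norm_num), lintegral_rpow_enorm_rpow_eq (by norm_num)]
    at h2
  have h3 := ENNReal.rpow_le_rpow h2 (show 0 ≤ (4 - α) / 4 by linarith)
  rw [lintegral_rpow_enorm_rpow_eq hp, ENNReal.mul_rpow_of_nonneg _ _ (by linarith),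
    ← ENNReal.rpow_mul, ← ENNReal.rpow_mul] at h3
  convert h3 using 2
  · rw [show 4 / (4 - α) * ((4 - α) / 4) = 1 by field_simp, ENNReal.rpow_one]
  · congr 1; rw [hs]; field_simp; ring
  · congr 1; rw [ht]; field_simp; ring

/-- Hölder with exponents 2/(α − 2), 4/(4 − α), 4/(4 − α). The power α − 2 falls on an L² norm,
which the constraint fixes. -/
theorem lintegral_rpow_mul_mul_le {E₁ E₂ E₃ : Type*} [NormedAddCommGroup E₁]
    [NormedAddCommGroup E₂] [NormedAddCommGroup E₃] {f : Ω → E₁} {g : Ω → E₂} {h : Ω → E₃}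
    (hf : AEStronglyMeasurable f ν) (hg : AEStronglyMeasurable g ν)
    (hh : AEStronglyMeasurable h ν) {α : ℝ} (hα : 2 ≤ α) (hα' : α < 4) :
    ∫⁻ x, ‖f x‖ₑ ^ (α - 2) * (‖g x‖ₑ * ‖h x‖ₑ) ∂ν ≤
      eLpNorm f (ENNReal.ofReal 2) ν ^ (α - 2) *
        (eLpNorm g (ENNReal.ofReal (4 / (4 - α))) ν * eLpNorm h (ENNReal.ofReal (4 / (4 - α))) ν) := by
  have h4 : 0 < 4 - α := by linarith
  set p := 4 / (4 - α) with hp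
  have hp0 : 0 < p := by positivity
  have hfm := hf.enorm
  have hgm := hg.enorm
  have hhm := hh.enorm
  have h1 := ENNReal.lintegral_mul_norm_pow_le (μ := ν) (f := fun x => ‖f x‖ₑ ^ (2 : ℝ))
    (g := fun x => (‖g x‖ₑ ^ p) ^ (1 / 2 : ℝ) * (‖h x‖ₑ ^ p) ^ (1 / 2 : ℝ))
    (p := (α - 2) / 2) (q := (4 - α) / 2) (by fun_prop) (by fun_prop) (by linarith) (by linarith)
    (by ring)
  have h2 := ENNReal.lintegral_mul_norm_pow_le (μ := ν) (f := fun x => ‖g x‖ₑ ^ p)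
    (g := fun x => ‖h x‖ₑ ^ p) (p := 1 / 2) (q := 1 / 2) (by fun_prop) (by fun_prop)
    (by norm_num) (by norm_num) (by norm_num)
  have h3 := ENNReal.rpow_le_rpow h2 (show 0 ≤ (4 - α) / 2 by linarith)
  have h5 : ∀ x, ‖f x‖ₑ ^ (α - 2) * (‖g x‖ₑ * ‖h x‖ₑ) = (‖f x‖ₑ ^ (2 : ℝ)) ^ ((α - 2) / 2) *
      ((‖g x‖ₑ ^ p) ^ (1 / 2 : ℝ) * (‖h x‖ₑ ^ p) ^ (1 / 2 : ℝ)) ^ ((4 - α) / 2) := by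
    intro x
    rw [ENNReal.mul_rpow_of_nonneg _ _ (by linarith)]
    simp only [← ENNReal.rpow_mul]
    rw [show p * (1 / 2) * ((4 - α) / 2) = 1 by rw [hp]; field_simp; norm_num, ENNReal.rpow_one,
      ENNReal.rpow_one, show 2 * ((α - 2) / 2) = α - 2 by ring]
  simp_rw [h5]
  refine h1.trans ?_
  refine (mul_le_mul_right h3 _).trans ?_
  rw [lintegral_rpow_enorm_rpow_eq (by norm_num), lintegral_rpow_enorm_rpow_eq hp0,
    lintegral_rpow_enorm_rpow_eq hp0, ENNReal.mul_rpow_of_nonneg _ _ (by linarith)]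
  simp only [← ENNReal.rpow_mul]
  rw [show p * (1 / 2) * ((4 - α) / 2) = 1 by rw [hp]; field_simp; norm_num, ENNReal.rpow_one,
      ENNReal.rpow_one, show 2 * ((α - 2) / 2) = α - 2 by ring]

end Holder

/-! ### The Sobolev constants -/

/-- `S` is an admissible constant in `|ψ|_p ≤ S ‖ψ‖`. -/
def IsSobolevBound (m p S : ℝ) : Prop :=
  0 ≤ S ∧ ∀ ψ : X m, eLpNorm (toL2 m ψ) (ENNReal.ofReal p) volume ≤ ENNReal.ofReal (S * ‖ψ‖)

theorem eLpNorm_toL2 {m : ℝ} (ψ : X m) :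
    eLpNorm (toL2 m ψ) (ENNReal.ofReal 2) volume = ENNReal.ofReal (normL2 ψ) := by
  rw [normL2, ofReal_norm, Lp.enorm_def]
  simp

theorem mass_mul_normL2_sq_le {m : ℝ} (hm : 0 < m) (ψ : X m) : m * normL2 ψ ^ 2 ≤ ‖ψ‖ ^ 2 := by
  have h1 : ENNReal.ofReal (m * normL2 ψ ^ 2) ≤ ENNReal.ofReal (‖ψ‖ ^ 2) := by
    rw [← norm_sq_eq_lintegral, ENNReal.ofReal_mul hm.le, normL2,
      ← Lp.norm_fourier_eq (toL2 m ψ), ← norm_sq_lintegral, ← lintegral_const_mul' _ _ (by simp)]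
    exact lintegral_mono fun ξ =>
      mul_le_mul_left (ENNReal.ofReal_le_ofReal (mass_le_energy m ξ)) _
  exact (ENNReal.ofReal_le_ofReal_iff (by positivity)).1 h1

theorem isSobolevBound_two {m : ℝ} (hm : 0 < m) : IsSobolevBound m 2 (√m)⁻¹ := by
  refine ⟨by positivity, fun ψ => ?_⟩
  rw [eLpNorm_toL2]
  apply ENNReal.ofReal_le_ofReal
  have hs : 0 < √m := Real.sqrt_pos.2 hm
  rw [← div_eq_inv_mul, le_div_iff₀ hs]
  apply le_of_sq_le_sq _ (norm_nonneg _)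
  rw [mul_pow, Real.sq_sqrt hm.le]
  linarith [mass_mul_normL2_sq_le hm ψ]

theorem isSobolevBound_three (m : ℝ) : IsSobolevBound m 3 1 := by
  refine ⟨zero_le_one, fun ψ => ?_⟩
  rw [eLpNorm_eq_lintegral_rpow_enorm_toReal (by simp) (by simp)]
  have h := ENNReal.rpow_le_rpow (lintegral_norm_cube_le ψ) (show (0 : ℝ) ≤ 1 / 3 by norm_num)
  rw [ENNReal.ofReal_rpow_of_nonneg (by positivity) (by norm_num), ← Real.rpow_natCast,
    ← Real.rpow_mul (norm_nonneg _)] at h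
  simpa using h

theorem IsSobolevBound.interpolate {m α S₂ S₃ : ℝ} (h₂ : IsSobolevBound m 2 S₂)
    (h₃ : IsSobolevBound m 3 S₃) (hα : 2 < α) (hα' : α ≤ 8 / 3) :
    IsSobolevBound m (4 / (4 - α)) (S₃ ^ (3 * (α - 2) / 2) * S₂ ^ ((8 - 3 * α) / 2)) := by
  have hS₂ := h₂.1
  have hS₃ := h₃.1
  refine ⟨by positivity, fun ψ => ?_⟩
  refine (eLpNorm_le_interpolation (Lp.aestronglyMeasurable _) hα hα').trans ?_
  have ha : 0 ≤ 3 * (α - 2) / 2 := by linarith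
  have hb : 0 ≤ (8 - 3 * α) / 2 := by linarith
  refine (mul_le_mul' (ENNReal.rpow_le_rpow (h₃.2 ψ) ha)
    (ENNReal.rpow_le_rpow (h₂.2 ψ) hb)).trans ?_
  have hn := norm_nonneg ψ
  rw [ENNReal.ofReal_rpow_of_nonneg (by positivity) ha,
    ENNReal.ofReal_rpow_of_nonneg (by positivity) hb, ← ENNReal.ofReal_mul (by positivity)]
  apply ENNReal.ofReal_le_ofReal
  rw [Real.mul_rpow hS₃ hn, Real.mul_rpow hS₂ hn]
  apply le_of_eq
  have : ‖ψ‖ ^ (3 * (α - 2) / 2) * ‖ψ‖ ^ ((8 - 3 * α) / 2) = ‖ψ‖ := by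
    rw [← Real.rpow_add_of_nonneg hn ha hb]
    rw [show 3 * (α - 2) / 2 + (8 - 3 * α) / 2 = 1 by ring, Real.rpow_one]
  linear_combination S₃ ^ (3 * (α - 2) / 2) * S₂ ^ ((8 - 3 * α) / 2) * this

theorem IsSobolevBound.sobolevConst_le {m p S : ℝ} (h : IsSobolevBound m p S) :
    sobolevConst m p ≤ S :=
  csInf_le ⟨0, fun _ hS => hS.1⟩ h

/-- The admissible constants form a closed set bounded below, so the infimum is attained as soon as
one exists. -/
theorem IsSobolevBound.sobolevConst {m p S : ℝ} (h : IsSobolevBound m p S) :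
    IsSobolevBound m p (NLDirac.sobolevConst m p) := by
  have hcl : IsClosed {S : ℝ | IsSobolevBound m p S} := by
    simp only [IsSobolevBound, Set.ofPred_and, Set.ofPred_forall]
    refine isClosed_Ici.inter (isClosed_iInter fun ψ => ?_)
    exact isClosed_le continuous_const (ENNReal.continuous_ofReal.comp (continuous_mul_const _))
  exact hcl.csInf_mem ⟨S, h⟩ ⟨0, fun _ hS => hS.1⟩

theorem sobolevConst_three_le_one (m : ℝ) : sobolevConst m 3 ≤ 1 :=
  (isSobolevBound_three m).sobolevConst_le

theorem isSobolevBound_sobolevConst_two {m : ℝ} (hm : 0 < m) :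
    IsSobolevBound m 2 (sobolevConst m 2) := (isSobolevBound_two hm).sobolevConst

theorem isSobolevBound_sobolevConst_exponent {m α : ℝ} (hm : 0 < m) (hα : 2 < α)
    (hα' : α ≤ 8 / 3) :
    IsSobolevBound m (4 / (4 - α)) (sobolevConst m (4 / (4 - α))) :=
  ((isSobolevBound_two hm).interpolate (isSobolevBound_three m) hα hα').sobolevConst

theorem normL2_le_sobolevConst {m : ℝ} (hm : 0 < m) (ψ : X m) :
    normL2 ψ ≤ sobolevConst m 2 * ‖ψ‖ := by
  have h := isSobolevBound_sobolevConst_two hm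
  have h1 := h.2 ψ
  rw [eLpNorm_toL2] at h1
  exact (ENNReal.ofReal_le_ofReal_iff (mul_nonneg h.1 (norm_nonneg _))).1 h1

/-- Interpolation yields S₂ with exponent 8 − 3α, opposite to the one in `sizeConst`; the two are
reconciled in `potentialDeriv_le_sizeConst`. -/
theorem sobolevConst_exponent_sq_le {m α : ℝ} (hm : 0 < m) (hα : 2 < α) (hα' : α ≤ 8 / 3) :
    sobolevConst m (4 / (4 - α)) ^ 2 ≤
      sobolevConst m 3 ^ (3 * (α - 2)) * sobolevConst m 2 ^ (8 - 3 * α) := by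
  have h2 := isSobolevBound_sobolevConst_two hm
  have h3 := (isSobolevBound_three m).sobolevConst
  have h := (h2.interpolate h3 hα hα').sobolevConst_le
  have h0 := (isSobolevBound_sobolevConst_exponent hm hα hα').1
  refine (pow_le_pow_left₀ h0 h 2).trans (le_of_eq ?_)
  rw [mul_pow, ← Real.rpow_natCast, ← Real.rpow_natCast, ← Real.rpow_mul h3.1,
    ← Real.rpow_mul h2.1]
  congr 2 <;> push_cast <;> ring

/-! ### Pointwise properties of the nonlinearity -/

namespace Nonlinearity

variable {F : C4 → ℝ} {α : ℝ}

theorem differentiable (hF : Nonlinearity F α) : Differentiable ℝ F :=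
  hF.contDiff.differentiable (by norm_num)

theorem contDiff_fderiv (hF : Nonlinearity F α) : ContDiff ℝ 1 (fderiv ℝ F) :=
  hF.contDiff.fderiv_right (by norm_num)

theorem differentiable_fderiv (hF : Nonlinearity F α) : Differentiable ℝ (fderiv ℝ F) :=
  hF.contDiff_fderiv.differentiable (by norm_num)

theorem continuous_fderiv (hF : Nonlinearity F α) : Continuous (fderiv ℝ F) :=
  hF.contDiff_fderiv.continuous

theorem nonneg (hF : Nonlinearity F α) (hα : 2 < α) (φ : C4) : 0 ≤ F φ :=
  nonneg_of_mul_nonneg_right (hF.superquadratic φ).2 (by linarith)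

theorem two_mul_le (hF : Nonlinearity F α) (hα : 2 < α) (φ : C4) : 2 * F φ ≤ fderiv ℝ F φ φ := by
  nlinarith [hF.nonneg hα φ, (hF.superquadratic φ).1]

theorem tangent_le (hF : Nonlinearity F α) (φ ζ : C4) :
    F φ + fderiv ℝ F φ ζ ≤ F (φ + ζ) := by
  have hline (t : ℝ) : HasDerivAt (fun t : ℝ => φ + t • ζ) ζ t := by
    simpa using ((hasDerivAt_id t).smul_const ζ).const_add φ
  have h1 (t : ℝ) : HasDerivAt (fun t : ℝ => F (φ + t • ζ)) (fderiv ℝ F (φ + t • ζ) ζ) t :=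
    (hF.differentiable _).hasFDerivAt.comp_hasDerivAt t (hline t)
  have h2 (t : ℝ) : HasDerivAt (fun t : ℝ => fderiv ℝ F (φ + t • ζ) ζ)
      (fderiv ℝ (fderiv ℝ F) (φ + t • ζ) ζ ζ) t := by
    have := ((hF.differentiable_fderiv _).hasFDerivAt (x := φ + t • ζ)).comp_hasDerivAt t (hline t)
    simpa using this.clm_apply (hasDerivAt_const t ζ)
  -- Mean value theorem twice: the increment of F is the slope at some c, and by convexity this
  -- slope is at least the slope at 0.
  obtain ⟨c, hc, hc'⟩ := exists_hasDerivAt_eq_slope (fun t : ℝ => F (φ + t • ζ)) _ zero_lt_one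
    (fun t _ => (h1 t).continuousAt.continuousWithinAt) (fun t _ => h1 t)
  obtain ⟨d, hd, hd'⟩ := exists_hasDerivAt_eq_slope (fun t : ℝ => fderiv ℝ F (φ + t • ζ) ζ) _ hc.1
    (fun t _ => (h2 t).continuousAt.continuousWithinAt) (fun t _ => h2 t)
  have h3 := hF.convex (φ + d • ζ) ζ
  rw [hd', sub_zero, le_div_iff₀ hc.1] at h3
  simp at h3 hc'
  linarith

theorem exists_hess_le (hF : Nonlinearity F α) :
    ∃ M, 0 ≤ M ∧ ∀ φ, ‖fderiv ℝ (fderiv ℝ F) φ‖ ≤ M + ‖φ‖ ^ (α - 2) := by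
  obtain ⟨R, hR, hb⟩ := hF.hess_bound
  have hc : Continuous fun φ => ‖fderiv ℝ (fderiv ℝ F) φ‖ :=
    continuous_norm.comp (hF.contDiff_fderiv.continuous_fderiv (by norm_num))
  obtain ⟨M, hM'⟩ := (isCompact_closedBall (0 : C4) R).exists_bound_of_continuousOn hc.continuousOn
  have hM : ∀ φ ∈ Metric.closedBall (0 : C4) R, ‖fderiv ℝ (fderiv ℝ F) φ‖ ≤ M := fun φ hφ =>
    (le_abs_self _).trans (hM' φ hφ)
  refine ⟨max M 0, le_max_right _ _, fun φ => ?_⟩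
  have hp : 0 ≤ ‖φ‖ ^ (α - 2) := by positivity
  rcases le_total R ‖φ‖ with h | h
  · linarith [hb φ h, le_max_right M 0]
  · linarith [hM φ (by simpa using h), le_max_left M 0]

theorem exists_lipschitz (hF : Nonlinearity F α) (hα : 2 < α) :
    ∃ M, 0 ≤ M ∧ ∀ φ h, ‖fderiv ℝ F (φ + h) - fderiv ℝ F φ‖ ≤
      (M + (‖φ‖ + ‖h‖) ^ (α - 2)) * ‖h‖ := by
  obtain ⟨M, hM0, hM⟩ := hF.exists_hess_le
  refine ⟨M, hM0, fun φ h => ?_⟩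
  have hn := norm_nonneg h
  have hφ := norm_nonneg φ
  have := (convex_closedBall (0 : C4) (‖φ‖ + ‖h‖)).norm_image_sub_le_of_norm_fderiv_le
    (𝕜 := ℝ) (f := fderiv ℝ F) (x := φ) (y := φ + h) (C := M + (‖φ‖ + ‖h‖) ^ (α - 2))
    (fun z _ => hF.differentiable_fderiv z)
    (fun z hz => (hM z).trans (by
      rw [mem_closedBall_zero_iff] at hz
      gcongr)) (by simp) (by simpa using norm_add_le φ h)
  simpa using this

theorem growth_nonneg (hα : 2 < α) {μ : ℝ}
    (hμ : ∀ φ : C4, ‖fderiv ℝ F φ‖ ≤ ‖φ‖ + μ * ‖φ‖ ^ (α - 1)) : 0 ≤ μ := by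
  by_contra! h
  -- Chosen so that μ t^{α−2} = −2: a vector of length t would make the right side of the growth
  -- bound equal to −t.
  set t : ℝ := (2 / (-μ)) ^ (1 / (α - 2)) with ht
  have h2 : 0 < 2 / (-μ) := div_pos two_pos (by linarith)
  have ht0 : 0 < t := by positivity
  obtain ⟨φ, hφ⟩ : ∃ φ : C4, ‖φ‖ = t :=
    ⟨EuclideanSpace.single 0 (t : ℂ), by simp [abs_of_pos ht0]⟩
  have h3 := (norm_nonneg _).trans (hμ φ)
  rw [hφ, show α - 1 = (α - 2) + 1 by ring, Real.rpow_add_one ht0.ne', ht, ← Real.rpow_mul h2.le,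
    one_div_mul_cancel (by linarith), Real.rpow_one, ← ht] at h3
  have h4 : μ * (2 / (-μ) * t) = -2 * t := by
    have : μ ≠ 0 := by linarith
    field_simp
  linarith

/-- The condition ⟨∇F(φ), φ⟩ ≥ αF(φ) says that s ↦ s^{−α}F(sφ) is nondecreasing. -/
theorem rpow_mul_le (hF : Nonlinearity F α) (φ : C4) {t : ℝ} (ht : 1 ≤ t) :
    F φ ≤ t ^ (-α) * F (t • φ) := by
  have hd (s : ℝ) (hs : 0 < s) : HasDerivAt (fun s : ℝ => s ^ (-α) * F (s • φ))
      (-α * s ^ (-α - 1) * F (s • φ) + s ^ (-α) * fderiv ℝ F (s • φ) φ) s := by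
    have h1 : HasDerivAt (fun s : ℝ => F (s • φ)) (fderiv ℝ F (s • φ) φ) s :=
      (hF.differentiable _).hasFDerivAt.comp_hasDerivAt s
        (by simpa using (hasDerivAt_id s).smul_const φ)
    exact (Real.hasDerivAt_rpow_const (Or.inl hs.ne')).mul h1
  have hmono : MonotoneOn (fun s : ℝ => s ^ (-α) * F (s • φ)) (Set.Ici 1) := by
    apply monotoneOn_of_deriv_nonneg (convex_Ici 1)
    · exact fun s hs => (hd s (zero_lt_one.trans_le hs)).continuousAt.continuousWithinAt
    · intro s hs
      rw [interior_Ici] at hs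
      exact (hd s (zero_lt_one.trans hs)).differentiableAt.differentiableWithinAt
    · intro s hs
      rw [interior_Ici] at hs
      have hs0 : 0 < s := zero_lt_one.trans hs
      rw [(hd s hs0).deriv]
      have h2 := (hF.superquadratic (s • φ)).1
      rw [map_smul, smul_eq_mul] at h2
      have h3 : s ^ (-α) = s ^ (-α - 1) * s := by
        rw [← Real.rpow_add_one hs0.ne']; congr 1; ring
      rw [h3]
      have h4 : 0 < s ^ (-α - 1) := by positivity
      nlinarith
  have h := hmono (Set.mem_Ici.2 le_rfl) (Set.mem_Ici.2 ht) ht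
  simpa using h

/-- The growth of the second derivative at infinity and superquadraticity bound `F` globally. -/
theorem le_rpow (hF : Nonlinearity F α) (hα : 2 < α) (φ : C4) : F φ ≤ 1 / 2 * ‖φ‖ ^ α := by
  obtain ⟨M, hM0, hM⟩ := hF.exists_lipschitz hα
  have h1 (ζ : C4) : 2 * F ζ ≤ (M + ‖ζ‖ ^ (α - 2)) * ‖ζ‖ ^ 2 := by
    refine (hF.two_mul_le hα ζ).trans ((le_abs_self _).trans
      (((fderiv ℝ F ζ).le_opNorm ζ).trans ?_))
    have := hM 0 ζ
    simp only [zero_add, hF.grad_zero, sub_zero, norm_zero] at this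
    nlinarith [norm_nonneg ζ]
  have h2 : ∀ t : ℝ, 1 ≤ t →
      F φ ≤ 1 / 2 * (M * ‖φ‖ ^ 2) * t ^ (-(α - 2)) + 1 / 2 * ‖φ‖ ^ α := by
    intro t ht
    have ht0 : 0 < t := zero_lt_one.trans_le ht
    refine (hF.rpow_mul_le φ ht).trans ?_
    have h3 := h1 (t • φ)
    rw [norm_smul, Real.norm_of_nonneg ht0.le] at h3
    have h4 : t ^ (-α) * (t * ‖φ‖) ^ 2 = t ^ (-(α - 2)) * ‖φ‖ ^ 2 := by
      rw [mul_pow, ← mul_assoc, ← Real.rpow_natCast, ← Real.rpow_add ht0]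
      congr 2; push_cast; ring
    have h5 : (t * ‖φ‖) ^ (α - 2) * (t ^ (-α) * (t * ‖φ‖) ^ 2) = ‖φ‖ ^ α := by
      have h6 : (t * ‖φ‖) ^ (α - 2) * (t * ‖φ‖) ^ 2 = (t * ‖φ‖) ^ α := by
        rcases (norm_nonneg φ).eq_or_lt with h | h
        · rw [← h]; simp [Real.zero_rpow (show α ≠ 0 by linarith)]
        · rw [← Real.rpow_natCast, ← Real.rpow_add (by positivity)]
          congr 1; push_cast; ring
      rw [mul_left_comm, h6, Real.mul_rpow ht0.le (norm_nonneg φ), ← mul_assoc,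
        ← Real.rpow_add ht0]
      simp
    have h7 := mul_le_mul_of_nonneg_left h3 (show 0 ≤ t ^ (-α) by positivity)
    have h8 : t ^ (-α) * ((M + (t * ‖φ‖) ^ (α - 2)) * (t * ‖φ‖) ^ 2) =
        M * (t ^ (-(α - 2)) * ‖φ‖ ^ 2) + ‖φ‖ ^ α := by
      rw [← h4, ← h5]; ring
    rw [h8] at h7
    linarith
  -- As t → ∞ the contribution of the constant M decays like t^{−(α−2)}; only the coefficient 1 of
  -- the Hessian bound at infinity survives.
  have h9 : Filter.Tendsto (fun t : ℝ => 1 / 2 * (M * ‖φ‖ ^ 2) * t ^ (-(α - 2)) +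
      1 / 2 * ‖φ‖ ^ α) Filter.atTop (nhds (1 / 2 * (M * ‖φ‖ ^ 2) * 0 + 1 / 2 * ‖φ‖ ^ α)) :=
    ((tendsto_rpow_neg_atTop (by linarith)).const_mul _).add_const _
  rw [mul_zero, zero_add] at h9
  exact ge_of_tendsto h9 (Filter.eventually_atTop.2 ⟨1, h2⟩)

/-- By convexity and F ≥ 0, dF(φ)[ζ] ≤ F(φ + ζ) ≤ ½|2φ|^α for all ζ with |ζ| = |φ|, and 2^α/2 ≤
2^{8/3}/2 ≤ 16/5. -/
theorem fderiv_le_rpow (hF : Nonlinearity F α) (hα : 2 < α) (hα' : α ≤ 8 / 3) (φ : C4) :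
    ‖fderiv ℝ F φ‖ ≤ 16 / 5 * ‖φ‖ ^ (α - 1) := by
  rcases (norm_nonneg φ).eq_or_lt with h0 | h0
  · rw [norm_eq_zero.1 h0.symm, hF.grad_zero]; simp; positivity
  have h2 : (2 : ℝ) ^ α ≤ 32 / 5 := by
    have h3 : (2 : ℝ) ^ α ≤ 2 ^ (8 / 3 : ℝ) :=
      Real.rpow_le_rpow_of_exponent_le (by norm_num) hα'
    refine h3.trans ?_
    rw [show (8 / 3 : ℝ) = 8 * (1 / 3) by norm_num, Real.rpow_mul (by norm_num)]
    -- Compare cubes: 2⁸ = 256 ≤ (32/5)³.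
    have : (32 / 5 : ℝ) = ((32 / 5 : ℝ) ^ (3 : ℝ)) ^ (1 / 3 : ℝ) := by
      rw [← Real.rpow_mul (by norm_num)]; norm_num
    rw [this]
    apply Real.rpow_le_rpow (by positivity) _ (by norm_num)
    norm_num
  have key : ∀ ζ : C4, ‖ζ‖ = ‖φ‖ → fderiv ℝ F φ ζ ≤ 16 / 5 * ‖φ‖ ^ α := by
    intro ζ hζ
    have h4 : fderiv ℝ F φ ζ ≤ F (φ + ζ) := by
      linarith [hF.tangent_le φ ζ, hF.nonneg hα φ]
    have h5 : ‖φ + ζ‖ ≤ 2 * ‖φ‖ := by linarith [norm_add_le φ ζ]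
    have h6 : ‖φ + ζ‖ ^ α ≤ 2 ^ α * ‖φ‖ ^ α := by
      rw [← Real.mul_rpow (by norm_num) h0.le]
      exact Real.rpow_le_rpow (norm_nonneg _) h5 (by linarith)
    have h7 : 0 ≤ ‖φ‖ ^ α := by positivity
    nlinarith [hF.le_rpow hα (φ + ζ)]
  have hs : ‖φ‖ ^ α = ‖φ‖ ^ (α - 1) * ‖φ‖ := by
    rw [← Real.rpow_add_one h0.ne']; congr 1; ring
  apply ContinuousLinearMap.opNorm_le_bound _ (by positivity)
  intro v
  rcases (norm_nonneg v).eq_or_lt with hv | hv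
  · rw [norm_eq_zero.1 hv.symm]; simp
  set c : ℝ := ‖φ‖ / ‖v‖ with hc
  have hc0 : 0 < c := by positivity
  have hn : ‖c • v‖ = ‖φ‖ := by
    rw [norm_smul, Real.norm_of_nonneg hc0.le, hc, div_mul_cancel₀ _ hv.ne']
  have h8 := key (c • v) hn
  have h9 := key (-(c • v)) (by rw [norm_neg, hn])
  rw [map_neg] at h9
  rw [map_smul, smul_eq_mul] at h8 h9
  have h10 : c * |fderiv ℝ F φ v| ≤ 16 / 5 * ‖φ‖ ^ α := by
    rcases abs_cases (fderiv ℝ F φ v) with h | h <;> rw [h.1] <;> linarith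
  have h11 : 16 / 5 * ‖φ‖ ^ α = c * (16 / 5 * ‖φ‖ ^ (α - 1) * ‖v‖) := by
    rw [hs, hc]; field_simp
  rw [h11] at h10
  exact le_of_mul_le_mul_left h10 hc0

end Nonlinearity

/-! ### The potential energy `∫ F(ψ)` -/

theorem lintegral_enorm_mul_le {m : ℝ} (h k : X m) :
    ∫⁻ x, ‖toL2 m h x‖ₑ * ‖toL2 m k x‖ₑ ≤ ENNReal.ofReal (normL2 h * normL2 k) := by
  have h1 := lintegral_rpow_mul_mul_le (ν := volume) (f := toL2 m h)
    (Lp.aestronglyMeasurable (toL2 m h)) (Lp.aestronglyMeasurable (toL2 m h))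
    (Lp.aestronglyMeasurable (toL2 m k)) le_rfl (by norm_num)
  rw [show (4 : ℝ) / (4 - 2) = 2 by norm_num, eLpNorm_toL2, eLpNorm_toL2] at h1
  simpa [ENNReal.ofReal_mul (show 0 ≤ normL2 h from norm_nonneg _)] using h1

section Potential

variable {m α : ℝ} {F : C4 → ℝ} {μ : ℝ}

-- Common source of all integral estimates for ∇F: f = ψ gives the size of the derivative of ∫F, and
-- f = |ψ| + |h| its Lipschitz bound.
set_option maxHeartbeats 800000 in
theorem integrable_of_growth (hm : 0 < m) (hα : 2 < α) (hα' : α ≤ 8 / 3) {E : Type*}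
    [NormedAddCommGroup E] {g : R3 → ℝ} (hg : AEStronglyMeasurable g volume) {f : R3 → E}
    (hf : AEStronglyMeasurable f volume) {r : ℝ} (hr : 0 ≤ r)
    (hfr : eLpNorm f (ENNReal.ofReal 2) volume ≤ ENNReal.ofReal r) {a b : ℝ} (ha : 0 ≤ a)
    (hb : 0 ≤ b) (h k : X m)
    (hle : ∀ᵐ x, |g x| ≤ (a + b * ‖f x‖ ^ (α - 2)) * (‖toL2 m h x‖ * ‖toL2 m k x‖)) :
    Integrable g volume ∧ |∫ x, g x| ≤ (a * sobolevConst m 2 ^ 2 +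
      b * r ^ (α - 2) * sobolevConst m (4 / (4 - α)) ^ 2) * ‖h‖ * ‖k‖ := by
  obtain ⟨hS2, -⟩ := isSobolevBound_sobolevConst_two hm
  obtain ⟨hSp, hSp'⟩ := isSobolevBound_sobolevConst_exponent hm hα hα'
  have hS2' := normL2_le_sobolevConst hm
  revert hS2 hSp hSp' hS2'
  generalize sobolevConst m 2 = S
  generalize sobolevConst m (4 / (4 - α)) = T
  intro hS2 hSp hSp' hS2'
  have hn := norm_nonneg h
  have hk := norm_nonneg k
  have hα0 : 0 ≤ α - 2 := by linarith
  have h1 : ∫⁻ x, ‖toL2 m h x‖ₑ * ‖toL2 m k x‖ₑ ≤ ENNReal.ofReal (S ^ 2 * ‖h‖ * ‖k‖) := by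
    refine (lintegral_enorm_mul_le h k).trans (ENNReal.ofReal_le_ofReal ?_)
    calc normL2 h * normL2 k ≤ (S * ‖h‖) * (S * ‖k‖) :=
          mul_le_mul (hS2' h) (hS2' k) (norm_nonneg _)
            (by positivity)
      _ = _ := by ring
  have h2 : ∫⁻ x, ‖f x‖ₑ ^ (α - 2) * (‖toL2 m h x‖ₑ * ‖toL2 m k x‖ₑ) ≤
      ENNReal.ofReal (r ^ (α - 2) * T ^ 2 * ‖h‖ * ‖k‖) := by
    refine (lintegral_rpow_mul_mul_le hf (Lp.aestronglyMeasurable _) (Lp.aestronglyMeasurable _)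
      hα.le (by linarith)).trans ?_
    refine (mul_le_mul' (ENNReal.rpow_le_rpow hfr hα0) (mul_le_mul' (hSp' h) (hSp' k))).trans
      (le_of_eq ?_)
    rw [ENNReal.ofReal_rpow_of_nonneg hr hα0, ← ENNReal.ofReal_mul (by positivity),
      ← ENNReal.ofReal_mul (by positivity)]
    congr 1; ring
  have hhm : AEMeasurable (fun x => ‖toL2 m h x‖ₑ) volume := (Lp.aestronglyMeasurable _).enorm
  have hkm : AEMeasurable (fun x => ‖toL2 m k x‖ₑ) volume := (Lp.aestronglyMeasurable _).enorm
  have h3 : ∫⁻ x, ‖g x‖ₑ ≤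
      ENNReal.ofReal ((a * S ^ 2 + b * r ^ (α - 2) * T ^ 2) * ‖h‖ * ‖k‖) := by
    calc ∫⁻ x, ‖g x‖ₑ ≤ ∫⁻ x, (ENNReal.ofReal a * (‖toL2 m h x‖ₑ * ‖toL2 m k x‖ₑ) +
          ENNReal.ofReal b * (‖f x‖ₑ ^ (α - 2) * (‖toL2 m h x‖ₑ * ‖toL2 m k x‖ₑ))) := by
          apply lintegral_mono_ae
          filter_upwards [hle] with x hx
          have hp : 0 ≤ ‖f x‖ ^ (α - 2) := by positivity
          rw [Real.enorm_eq_ofReal_abs, ← ofReal_norm (f x), ← ofReal_norm (toL2 m h x),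
            ← ofReal_norm (toL2 m k x), ENNReal.ofReal_rpow_of_nonneg (norm_nonneg _) hα0,
            ← ENNReal.ofReal_mul (norm_nonneg _), ← ENNReal.ofReal_mul ha,
            ← ENNReal.ofReal_mul hp, ← ENNReal.ofReal_mul hb,
            ← ENNReal.ofReal_add (by positivity) (by positivity)]
          exact ENNReal.ofReal_le_ofReal (hx.trans (le_of_eq (by ring)))
      _ = ENNReal.ofReal a * (∫⁻ x, ‖toL2 m h x‖ₑ * ‖toL2 m k x‖ₑ) +
          ENNReal.ofReal b * (∫⁻ x, ‖f x‖ₑ ^ (α - 2) * (‖toL2 m h x‖ₑ * ‖toL2 m k x‖ₑ)) := by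
          rw [lintegral_add_left' (by fun_prop), lintegral_const_mul' _ _ ENNReal.ofReal_ne_top,
            lintegral_const_mul' _ _ ENNReal.ofReal_ne_top]
      _ ≤ ENNReal.ofReal a * ENNReal.ofReal (S ^ 2 * ‖h‖ * ‖k‖) +
          ENNReal.ofReal b * ENNReal.ofReal (r ^ (α - 2) * T ^ 2 * ‖h‖ * ‖k‖) :=
          add_le_add (mul_le_mul_right h1 _) (mul_le_mul_right h2 _)
      _ = _ := by
          have hA : 0 ≤ a * (S ^ 2 * ‖h‖ * ‖k‖) := by positivity
          have hB : 0 ≤ b * (r ^ (α - 2) * T ^ 2 * ‖h‖ * ‖k‖) := by positivity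
          rw [← ENNReal.ofReal_mul ha, ← ENNReal.ofReal_mul hb, ← ENNReal.ofReal_add hA hB]
          congr 1; ring
  refine ⟨⟨hg, h3.trans_lt ENNReal.ofReal_lt_top⟩, ?_⟩
  have h4 := (enorm_integral_le_lintegral_enorm g).trans h3
  rw [Real.enorm_eq_ofReal_abs] at h4
  exact (ENNReal.ofReal_le_ofReal_iff (by positivity)).1 h4

/-- `∫ F(ψ)`. -/
noncomputable def potential (F : C4 → ℝ) (ψ : X m) : ℝ := ∫ x, F (toL2 m ψ x)

theorem growth_split {φ : C4} (hα : 2 < α) : ‖φ‖ + μ * ‖φ‖ ^ (α - 1) =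
    (1 + μ * ‖φ‖ ^ (α - 2)) * ‖φ‖ := by
  rcases (norm_nonneg φ).eq_or_lt with h | h
  · rw [← h, Real.zero_rpow (by linarith)]; ring
  · rw [show α - 1 = (α - 2) + 1 by ring, Real.rpow_add_one h.ne']; ring

theorem aestronglyMeasurable_fderiv_apply (hF : Nonlinearity F α) (ψ k : X m) :
    AEStronglyMeasurable (fun x => fderiv ℝ F (toL2 m ψ x) (toL2 m k x)) volume := by
  have h : Continuous fun p : C4 × C4 => fderiv ℝ F p.1 p.2 :=
    (hF.continuous_fderiv.comp continuous_fst).clm_apply continuous_snd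
  exact h.comp_aestronglyMeasurable
    ((Lp.aestronglyMeasurable (toL2 m ψ)).prodMk (Lp.aestronglyMeasurable (toL2 m k)))

theorem coeFn_toL2_add (ψ k : X m) :
    ∀ᵐ x, toL2 m (ψ + k) x = toL2 m ψ x + toL2 m k x := by
  rw [map_add]
  filter_upwards [Lp.coeFn_add (toL2 m ψ) (toL2 m k)] with x hx
  rw [hx, Pi.add_apply]

theorem coeFn_toL2_smul (c : ℝ) (ψ : X m) :
    ∀ᵐ x, toL2 m (c • ψ) x = c • toL2 m ψ x := by
  have h : toL2 m (c • ψ) = (c : ℂ) • toL2 m ψ := (toL2 m).map_smul (c : ℂ) ψ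
  rw [h]
  filter_upwards [Lp.coeFn_smul (c : ℂ) (toL2 m ψ)] with x hx
  rw [hx, Pi.smul_apply, Complex.coe_smul]

theorem fderiv_integral_bound (hm : 0 < m) (hα : 2 < α) (hα' : α ≤ 8 / 3)
    (hF : Nonlinearity F α) {a b : ℝ} (ha : 0 ≤ a) (hb : 0 ≤ b)
    (hab : ∀ φ, ‖fderiv ℝ F φ‖ ≤ (a + b * ‖φ‖ ^ (α - 2)) * ‖φ‖) (ψ k : X m) {r : ℝ}
    (hr : normL2 ψ ≤ r) :
    Integrable (fun x => fderiv ℝ F (toL2 m ψ x) (toL2 m k x)) volume ∧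
      |∫ x, fderiv ℝ F (toL2 m ψ x) (toL2 m k x)| ≤ (a * sobolevConst m 2 ^ 2 +
      b * r ^ (α - 2) * sobolevConst m (4 / (4 - α)) ^ 2) * ‖ψ‖ * ‖k‖ := by
  refine integrable_of_growth hm hα hα' (aestronglyMeasurable_fderiv_apply hF ψ k)
    (Lp.aestronglyMeasurable (toL2 m ψ)) ((norm_nonneg _).trans hr) ?_ ha hb ψ k ?_
  · rw [eLpNorm_toL2]; exact ENNReal.ofReal_le_ofReal hr
  · refine Filter.Eventually.of_forall fun x => ?_
    refine ((fderiv ℝ F (toL2 m ψ x)).le_opNorm _).trans ?_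
    rw [← mul_assoc]
    exact mul_le_mul_of_nonneg_right (hab _) (norm_nonneg _)

theorem Nonlinearity.exists_growth (hF : Nonlinearity F α) (hα : 2 < α) :
    ∃ M, 0 ≤ M ∧ ∀ φ, ‖fderiv ℝ F φ‖ ≤ (M + 1 * ‖φ‖ ^ (α - 2)) * ‖φ‖ := by
  obtain ⟨M, hM0, hM⟩ := hF.exists_lipschitz hα
  refine ⟨M, hM0, fun φ => ?_⟩
  simpa [hF.grad_zero] using hM 0 φ

theorem integrable_fderiv_apply (hm : 0 < m) (hα : 2 < α) (hα' : α ≤ 8 / 3)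
    (hF : Nonlinearity F α) (ψ k : X m) :
    Integrable (fun x => fderiv ℝ F (toL2 m ψ x) (toL2 m k x)) volume := by
  obtain ⟨M, hM0, hM⟩ := hF.exists_growth hα
  exact (fderiv_integral_bound hm hα hα' hF hM0 zero_le_one hM ψ k le_rfl).1

/-- Dominated through 0 ≤ F(φ) ≤ ½ dF(φ)[φ]. -/
theorem integrable_potential (hm : 0 < m) (hα : 2 < α) (hα' : α ≤ 8 / 3)
    (hF : Nonlinearity F α) (ψ : X m) : Integrable (fun x => F (toL2 m ψ x)) volume := by
  refine ((integrable_fderiv_apply hm hα hα' hF ψ ψ).div_const 2).mono'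
    (hF.contDiff.continuous.comp_aestronglyMeasurable (Lp.aestronglyMeasurable (toL2 m ψ))) ?_
  refine Filter.Eventually.of_forall fun x => ?_
  rw [Real.norm_of_nonneg (hF.nonneg hα _)]
  linarith [hF.two_mul_le hα (toL2 m ψ x)]

theorem potential_nonneg (hα : 2 < α) (hF : Nonlinearity F α) (ψ : X m) : 0 ≤ potential F ψ :=
  integral_nonneg fun _ => hF.nonneg hα _

/-- The derivative `k ↦ ∫ ⟨∇F(ψ), k⟩` of the potential energy at `ψ`. -/
noncomputable def potentialDeriv (hm : 0 < m) (hα : 2 < α) (hα' : α ≤ 8 / 3)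
    (hF : Nonlinearity F α) (ψ : X m) : X m →L[ℝ] ℝ :=
  LinearMap.mkContinuousOfExistsBound
    { toFun := fun k => ∫ x, fderiv ℝ F (toL2 m ψ x) (toL2 m k x)
      map_add' := fun k l => by
        rw [← integral_add (integrable_fderiv_apply hm hα hα' hF ψ k)
          (integrable_fderiv_apply hm hα hα' hF ψ l)]
        apply integral_congr_ae
        filter_upwards [coeFn_toL2_add k l] with x hx
        rw [hx, map_add]
      map_smul' := fun c k => by
        rw [RingHom.id_apply, smul_eq_mul, ← integral_const_mul]
        apply integral_congr_ae
        filter_upwards [coeFn_toL2_smul c k] with x hx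
        rw [hx, map_smul, smul_eq_mul] }
    (by
      obtain ⟨M, hM0, hM⟩ := hF.exists_growth hα
      exact ⟨_, fun k => (fderiv_integral_bound hm hα hα' hF hM0 zero_le_one hM ψ k le_rfl).2⟩)

theorem potentialDeriv_apply (hm : 0 < m) (hα : 2 < α) (hα' : α ≤ 8 / 3)
    (hF : Nonlinearity F α) (ψ k : X m) :
    potentialDeriv hm hα hα' hF ψ k = ∫ x, fderiv ℝ F (toL2 m ψ x) (toL2 m k x) := rfl

theorem potential_tangent_le (hm : 0 < m) (hα : 2 < α) (hα' : α ≤ 8 / 3)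
    (hF : Nonlinearity F α) (ψ k : X m) :
    potential F ψ + potentialDeriv hm hα hα' hF ψ k ≤ potential F (ψ + k) := by
  rw [potentialDeriv_apply, potential, potential,
    ← integral_add (integrable_potential hm hα hα' hF ψ) (integrable_fderiv_apply hm hα hα' hF ψ k)]
  refine integral_mono_ae ((integrable_potential hm hα hα' hF ψ).add
    (integrable_fderiv_apply hm hα hα' hF ψ k)) (integrable_potential hm hα hα' hF (ψ + k)) ?_
  filter_upwards [coeFn_toL2_add ψ k] with x hx
  rw [hx]
  exact hF.tangent_le _ _

theorem two_mul_potential_le (hm : 0 < m) (hα : 2 < α) (hα' : α ≤ 8 / 3)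
    (hF : Nonlinearity F α) (ψ : X m) :
    2 * potential F ψ ≤ potentialDeriv hm hα hα' hF ψ ψ := by
  rw [potentialDeriv_apply, potential, ← integral_const_mul]
  exact integral_mono ((integrable_potential hm hα hα' hF ψ).const_mul 2)
    (integrable_fderiv_apply hm hα hα' hF ψ ψ) fun x => hF.two_mul_le hα _

/-- The Lipschitz constant depends only on the L² norms, because the factor (|ψ| + |h|)^{α−2} is
measured in L². -/
theorem exists_potentialDeriv_lipschitz (hm : 0 < m) (hα : 2 < α) (hα' : α ≤ 8 / 3)
    (hF : Nonlinearity F α) (r : ℝ) : ∃ L, 0 ≤ L ∧ ∀ ψ h k : X m, normL2 ψ ≤ r → normL2 h ≤ r →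
      |potentialDeriv hm hα hα' hF (ψ + h) k - potentialDeriv hm hα hα' hF ψ k| ≤
        L * ‖h‖ * ‖k‖ := by
  obtain ⟨M, hM0, hM⟩ := hF.exists_lipschitz hα
  by_cases hr : 0 ≤ r
  swap
  · exact ⟨0, le_rfl, fun ψ h k hψ _ => absurd ((norm_nonneg _).trans hψ) hr⟩
  refine ⟨M * sobolevConst m 2 ^ 2 + 1 * (r + r) ^ (α - 2) * sobolevConst m (4 / (4 - α)) ^ 2,
    by positivity, fun ψ h k hψ hh => ?_⟩
  rw [potentialDeriv_apply, potentialDeriv_apply,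
    ← integral_sub (integrable_fderiv_apply hm hα hα' hF (ψ + h) k)
      (integrable_fderiv_apply hm hα hα' hF ψ k)]
  refine (integrable_of_growth hm hα hα'
    (f := fun x => ‖toL2 m ψ x‖ + ‖toL2 m h x‖)
    ((aestronglyMeasurable_fderiv_apply hF (ψ + h) k).sub
      (aestronglyMeasurable_fderiv_apply hF ψ k))
    ((Lp.aestronglyMeasurable (toL2 m ψ)).norm.add (Lp.aestronglyMeasurable (toL2 m h)).norm)
    (add_nonneg hr hr) ?_ hM0 zero_le_one h k ?_).2
  · refine (eLpNorm_add_le (Lp.aestronglyMeasurable (toL2 m ψ)).norm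
      (Lp.aestronglyMeasurable (toL2 m h)).norm (by simp)).trans ?_
    rw [eLpNorm_norm, eLpNorm_norm, eLpNorm_toL2, eLpNorm_toL2, ENNReal.ofReal_add hr hr]
    exact add_le_add (ENNReal.ofReal_le_ofReal hψ) (ENNReal.ofReal_le_ofReal hh)
  · filter_upwards [coeFn_toL2_add ψ h] with x hx
    rw [Pi.sub_apply, hx, ← sub_apply, ← mul_assoc, one_mul, Real.norm_of_nonneg (add_nonneg (norm_nonneg _)
      (norm_nonneg _))]
    exact (ContinuousLinearMap.le_opNorm _ _).trans
      (mul_le_mul_of_nonneg_right (hM _ _) (norm_nonneg _))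

/-- `S₂² + μ λ^{(α-2)/2} S_{4/(4-α)}²`. -/
noncomputable def growthConst (m α lam μ : ℝ) : ℝ :=
  sobolevConst m 2 ^ 2 + μ * lam ^ ((α - 2) / 2) * sobolevConst m (4 / (4 - α)) ^ 2

theorem sqrt_rpow {lam : ℝ} (hlam : 0 ≤ lam) (s : ℝ) : √lam ^ s = lam ^ (s / 2) := by
  rw [Real.sqrt_eq_rpow, ← Real.rpow_mul hlam]; congr 1; ring

theorem potentialDeriv_le_growthConst (hm : 0 < m) (hα : 2 < α) (hα' : α ≤ 8 / 3)
    (hF : Nonlinearity F α) (hμ : ∀ φ : C4, ‖fderiv ℝ F φ‖ ≤ ‖φ‖ + μ * ‖φ‖ ^ (α - 1))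
    {lam : ℝ} (hlam : 0 ≤ lam) (ψ k : X m) (hψ : normL2 ψ ^ 2 ≤ lam) :
    |potentialDeriv hm hα hα' hF ψ k| ≤ growthConst m α lam μ * ‖ψ‖ * ‖k‖ := by
  have h := (fderiv_integral_bound hm hα hα' hF zero_le_one (Nonlinearity.growth_nonneg hα hμ)
    (fun φ => (hμ φ).trans_eq (growth_split hα)) ψ k (Real.le_sqrt_of_sq_le hψ)).2
  rwa [sqrt_rpow hlam, one_mul] at h

/-- The factor 16/5 is harmless: the final constant only requires (6/5)(16/5) ≤ 4. If S₂ ≤ 1, then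
S₂^{8−3α} ≤ S₂^{3α−8} and the `growthConst` bound is enough. If S₂ > 1, the pure power bound of
`Nonlinearity.fderiv_le_rpow` replaces the growth hypothesis, and S₃ ≤ 1, λ ≤ 1 and S₂^{8−3α} ≤ S₂²
leave only the term S₂². -/
theorem potentialDeriv_le_sizeConst (hm : 0 < m) (hα : 2 < α) (hα' : α ≤ 8 / 3)
    (hF : Nonlinearity F α) (hμ : ∀ φ : C4, ‖fderiv ℝ F φ‖ ≤ ‖φ‖ + μ * ‖φ‖ ^ (α - 1))
    {lam : ℝ} (hlam : 0 < lam) (hlam' : lam ≤ 1) (ψ k : X m) (hψ : normL2 ψ ^ 2 ≤ lam) :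
    |potentialDeriv hm hα hα' hF ψ k| ≤ 16 / 5 * sizeConst m α lam μ * ‖ψ‖ * ‖k‖ := by
  have hμ0 := Nonlinearity.growth_nonneg hα hμ
  rcases eq_or_ne ψ 0 with h0 | h0
  · have h1 := potentialDeriv_le_growthConst hm hα hα' hF hμ hlam.le ψ k hψ
    rw [h0, norm_zero] at h1 ⊢
    simpa using h1
  have hS2 := (isSobolevBound_sobolevConst_two hm).1
  have hS3 := (isSobolevBound_three m).sobolevConst.1
  have hSp := sobolevConst_exponent_sq_le hm hα hα'
  -- A nonzero ψ forces S₂ > 0, needed to compare powers whose exponents may be negative.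
  have hS2pos : 0 < sobolevConst m 2 := by
    have h1 : 0 < normL2 ψ := norm_pos_iff.2 fun h => h0 (Subtype.ext h)
    exact pos_of_mul_pos_left (h1.trans_le (normL2_le_sobolevConst hm ψ)) (norm_nonneg ψ)
  have hl : 0 ≤ lam ^ ((α - 2) / 2) := by positivity
  have h3pow : 0 ≤ sobolevConst m 3 ^ (3 * (α - 2)) := by positivity
  rcases le_or_gt (sobolevConst m 2) 1 with hle | hgt
  · have h1 := potentialDeriv_le_growthConst hm hα hα' hF hμ hlam.le ψ k hψ
    have h2 : growthConst m α lam μ ≤ sizeConst m α lam μ := by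
      have h3 : sobolevConst m 2 ^ (8 - 3 * α) ≤ sobolevConst m 2 ^ (3 * α - 8) :=
        Real.rpow_le_rpow_of_exponent_ge hS2pos hle (by linarith)
      have h4 := hSp.trans (mul_le_mul_of_nonneg_left h3 h3pow)
      have h5 := mul_le_mul_of_nonneg_left h4 (mul_nonneg hμ0 hl)
      rw [growthConst, sizeConst]
      linarith
    have h3 : 0 ≤ sizeConst m α lam μ := by rw [sizeConst]; positivity
    refine h1.trans ?_
    gcongr
    linarith
  · have h1 := (fderiv_integral_bound hm hα hα' hF le_rfl (show (0 : ℝ) ≤ 16 / 5 by norm_num)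
      (fun φ => by
        refine (hF.fderiv_le_rpow hα hα' φ).trans_eq ?_
        have := growth_split (φ := φ) (μ := 1) hα
        linear_combination 16 / 5 * this) ψ k (Real.le_sqrt_of_sq_le hψ)).2
    rw [← potentialDeriv_apply hm hα hα' hF, sqrt_rpow hlam.le, zero_mul, zero_add] at h1
    refine h1.trans ?_
    have h2 : sobolevConst m 3 ^ (3 * (α - 2)) ≤ 1 :=
      Real.rpow_le_one hS3 (sobolevConst_three_le_one m) (by linarith)
    have h3 : sobolevConst m 2 ^ (8 - 3 * α) ≤ sobolevConst m 2 ^ 2 := by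
      rw [← Real.rpow_natCast]
      exact Real.rpow_le_rpow_of_exponent_le hgt.le (by push_cast; linarith)
    have h4 : lam ^ ((α - 2) / 2) ≤ 1 := Real.rpow_le_one hlam.le hlam' (by linarith)
    have h5 : sobolevConst m (4 / (4 - α)) ^ 2 ≤ sobolevConst m 2 ^ 2 := by
      refine hSp.trans (le_trans (mul_le_of_le_one_left (by positivity) h2) h3)
    have h6 : lam ^ ((α - 2) / 2) * sobolevConst m (4 / (4 - α)) ^ 2 ≤ sizeConst m α lam μ := by
      have h7 : 0 ≤ μ * lam ^ ((α - 2) / 2) * sobolevConst m 3 ^ (3 * (α - 2)) *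
        sobolevConst m 2 ^ (3 * α - 8) := by positivity
      rw [sizeConst]
      exact (mul_le_of_le_one_left (sq_nonneg _) h4).trans (by linarith)
    rw [mul_assoc (16 / 5 : ℝ)]
    gcongr

end Potential

/-! ### Constrained maximization for strongly indefinite functionals -/

theorem hasFDerivAt_of_quadratic_bound {V : Type*} [NormedAddCommGroup V] [NormedSpace ℝ V]
    {f : V → ℝ} {f' : V →L[ℝ] ℝ} {x : V} {C : ℝ}
    (h : ∀ᶠ k in nhds (0 : V), |f (x + k) - f x - f' k| ≤ C * ‖k‖ ^ 2) : HasFDerivAt f f' x := by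
  rw [hasFDerivAt_iff_isLittleO_nhds_zero]
  have h1 : (fun k => f (x + k) - f x - f' k) =O[nhds 0] fun k : V => ‖k‖ ^ 2 := by
    refine Asymptotics.IsBigO.of_bound C (h.mono fun k hk => ?_)
    rw [Real.norm_of_nonneg (sq_nonneg ‖k‖)]
    exact hk
  refine h1.trans_isLittleO ?_
  have := (Asymptotics.isLittleO_pow_id (𝕜 := ℝ) (n := 2) (by norm_num)).comp_tendsto
    (tendsto_norm_zero (E := V))
  exact this.of_norm_right

/-- A space `V` with an energy norm and a weaker scalar product `b`, split orthogonally for both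
as `P ⊕ N`, and a convex potential `G` with derivative `dG`, of size controlled by `K` on the
`b`-ball of squared radius `lam`. -/
structure SplitProblem (V P N : Type*) [NormedAddCommGroup V] [NormedSpace ℝ V]
    [NormedAddCommGroup P] [NormedSpace ℝ P] [NormedAddCommGroup N] [NormedSpace ℝ N] where
  e : V →L[ℝ] V →L[ℝ] ℝ
  b : V →L[ℝ] V →L[ℝ] ℝ
  e_symm : ∀ x y, e x y = e y x
  e_self : ∀ x, e x x = ‖x‖ ^ 2
  b_symm : ∀ x y, b x y = b y x
  b_pos : ∀ x, x ≠ 0 → 0 < b x x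
  jp : P →ₗᵢ[ℝ] V
  jn : N →ₗᵢ[ℝ] V
  pp : V →L[ℝ] P
  pn : V →L[ℝ] N
  split : ∀ x, jp (pp x) + jn (pn x) = x
  e_orth : ∀ u v, e (jp u) (jn v) = 0
  b_orth : ∀ u v, b (jp u) (jn v) = 0
  G : V → ℝ
  dG : V → V →L[ℝ] ℝ
  γ : ℝ
  lam : ℝ
  K : ℝ
  γ_pos : 0 < γ
  lam_pos : 0 < lam
  K_nonneg : 0 ≤ K
  γK_lt : γ * K < 1 / 4
  G_nonneg : ∀ x, 0 ≤ G x
  tangent_le : ∀ x k, G x + dG x k ≤ G (x + k)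
  two_mul_le : ∀ x, 2 * G x ≤ dG x x
  dG_le : ∀ x k, b x x ≤ lam → |dG x k| ≤ K * ‖x‖ * ‖k‖
  dG_lipschitz : ∀ r, ∃ L, 0 ≤ L ∧ ∀ x h k, b x x ≤ r → b h h ≤ r →
    |dG (x + h) k - dG x k| ≤ L * ‖h‖ * ‖k‖

namespace SplitProblem

variable {V P N : Type*} [NormedAddCommGroup V] [NormedSpace ℝ V]
  [NormedAddCommGroup P] [NormedSpace ℝ P] [NormedAddCommGroup N] [NormedSpace ℝ N]
  (S : SplitProblem V P N)

/-! ### The two forms and the orthogonal splitting -/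

theorem b_nonneg (x : V) : 0 ≤ S.b x x := by
  rcases eq_or_ne x 0 with h | h
  · simp [h]
  · exact (S.b_pos x h).le

theorem b_cauchy (x y : V) : S.b x y ^ 2 ≤ S.b x x * S.b y y := by
  rcases eq_or_ne y 0 with h | h
  · simp [h]
  have hy := S.b_pos y h
  have h1 := S.b_nonneg (S.b y y • x - S.b x y • y)
  simp only [map_sub, map_smul, sub_apply, smul_apply, smul_eq_mul, S.b_symm y x] at h1
  have h2 : 0 ≤ S.b y y * (S.b x x * S.b y y - S.b x y ^ 2) := by linarith
  linarith [nonneg_of_mul_nonneg_right h2 hy]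

theorem b_add_le (x y : V) : S.b (x + y) (x + y) ≤ 2 * (S.b x x + S.b y y) := by
  have h := S.b_nonneg (x - y)
  simp only [map_sub, map_add, sub_apply, add_apply] at h ⊢
  linarith

theorem b_sub_le (x y : V) : S.b (x - y) (x - y) ≤ 2 * (S.b x x + S.b y y) := by
  have h := S.b_nonneg (x + y)
  simp only [map_sub, map_add, sub_apply, add_apply] at h ⊢
  linarith

theorem e_le (x y : V) : |S.e x y| ≤ ‖x‖ * ‖y‖ := by
  have h1 (t : ℝ) : 0 ≤ ‖x‖ ^ 2 * t ^ 2 + 2 * S.e x y * t + ‖y‖ ^ 2 := by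
    have := S.e_self (t • x + y)
    simp only [map_add, map_smul, add_apply, smul_apply, smul_eq_mul, S.e_self, S.e_symm y x]
      at this
    nlinarith [sq_nonneg ‖t • x + y‖]
  apply abs_le_of_sq_le_sq _ (by positivity)
  have := discrim_le_zero (a := ‖x‖ ^ 2) (b := 2 * S.e x y) (c := ‖y‖ ^ 2)
    (fun t => by linarith [h1 t, sq t])
  rw [discrim] at this
  nlinarith

theorem e_orth' (u : P) (v : N) : S.e (S.jn v) (S.jp u) = 0 := by rw [S.e_symm, S.e_orth]

theorem b_orth' (u : P) (v : N) : S.b (S.jn v) (S.jp u) = 0 := by rw [S.b_symm, S.b_orth]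

theorem split_unique {u u' : P} {v v' : N} (h : S.jp u + S.jn v = S.jp u' + S.jn v') :
    u = u' ∧ v = v' := by
  have h1 : S.jp (u - u') = S.jn (v' - v) := by
    rw [map_sub, map_sub, sub_eq_sub_iff_add_eq_add, h]; abel
  have h2 : S.e (S.jp (u - u')) (S.jp (u - u')) = 0 := by
    nth_rw 2 [h1]
    rw [S.e_orth]
  rw [S.e_self] at h2
  have h3 : S.jp (u - u') = 0 := by simpa using h2
  have h4 : u - u' = 0 := S.jp.injective (h3.trans S.jp.map_zero.symm)
  rw [h3] at h1
  have h5 : v' - v = 0 := S.jn.injective (h1.symm.trans S.jn.map_zero.symm)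
  exact ⟨sub_eq_zero.1 h4, (sub_eq_zero.1 h5).symm⟩

theorem pp_add (u : P) (v : N) : S.pp (S.jp u + S.jn v) = u :=
  (S.split_unique (S.split (S.jp u + S.jn v))).1

theorem pn_add (u : P) (v : N) : S.pn (S.jp u + S.jn v) = v :=
  (S.split_unique (S.split (S.jp u + S.jn v))).2

theorem norm_add_sq (u : P) (v : N) : ‖S.jp u + S.jn v‖ ^ 2 = ‖u‖ ^ 2 + ‖v‖ ^ 2 := by
  rw [← S.e_self]
  simp only [map_add, add_apply, S.e_orth, S.e_orth', S.e_self, LinearIsometry.norm_map]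
  ring

theorem norm_sq_eq (x : V) : ‖x‖ ^ 2 = ‖S.pp x‖ ^ 2 + ‖S.pn x‖ ^ 2 := by
  rw [← S.norm_add_sq, S.split]

theorem norm_pp_le (x : V) : ‖S.pp x‖ ≤ ‖x‖ :=
  le_of_sq_le_sq (by nlinarith [S.norm_sq_eq x, sq_nonneg ‖S.pn x‖]) (norm_nonneg x)

theorem norm_pn_le (x : V) : ‖S.pn x‖ ≤ ‖x‖ :=
  le_of_sq_le_sq (by nlinarith [S.norm_sq_eq x, sq_nonneg ‖S.pp x‖]) (norm_nonneg x)

/-! ### The action and its derivative -/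

/-- The functional `½‖x₊‖² - ½‖x₋‖² - γ G(x)`. -/
noncomputable def action (x : V) : ℝ :=
  1 / 2 * ‖S.pp x‖ ^ 2 - 1 / 2 * ‖S.pn x‖ ^ 2 - S.γ * S.G x

/-- The derivative of the action. -/
noncomputable def dAction (x : V) : V →L[ℝ] ℝ :=
  S.e (S.jp (S.pp x)) - S.e (S.jn (S.pn x)) - S.γ • S.dG x

theorem dAction_apply (x h : V) : S.dAction x h =
    S.e (S.jp (S.pp x)) h - S.e (S.jn (S.pn x)) h - S.γ * S.dG x h := rfl

theorem norm_add_jp_sq (u v : P) : ‖u + v‖ ^ 2 = ‖u‖ ^ 2 + 2 * S.e (S.jp u) (S.jp v) + ‖v‖ ^ 2 := by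
  rw [← S.jp.norm_map (u + v), ← S.jp.norm_map u, ← S.jp.norm_map v, ← S.e_self]
  simp only [map_add, add_apply, S.e_self, S.e_symm (S.jp v) (S.jp u)]
  ring

theorem norm_add_jn_sq (u v : N) : ‖u + v‖ ^ 2 = ‖u‖ ^ 2 + 2 * S.e (S.jn u) (S.jn v) + ‖v‖ ^ 2 := by
  rw [← S.jn.norm_map (u + v), ← S.jn.norm_map u, ← S.jn.norm_map v, ← S.e_self]
  simp only [map_add, add_apply, S.e_self, S.e_symm (S.jn v) (S.jn u)]
  ring

theorem e_jp_pp (u : P) (h : V) : S.e (S.jp u) h = S.e (S.jp u) (S.jp (S.pp h)) := by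
  conv_lhs => rw [← S.split h, map_add, S.e_orth, add_zero]

theorem e_jn_pn (v : N) (h : V) : S.e (S.jn v) h = S.e (S.jn v) (S.jn (S.pn h)) := by
  conv_lhs => rw [← S.split h, map_add, S.e_orth', zero_add]

theorem abs_dAction_le {x : V} (hx : S.b x x ≤ S.lam) (h : V) :
    |S.dAction x h| ≤ (2 + S.γ * S.K) * ‖x‖ * ‖h‖ := by
  have h1 := S.e_le (S.jp (S.pp x)) h
  have h2 := S.e_le (S.jn (S.pn x)) h
  have h3 := S.dG_le x h hx
  rw [LinearIsometry.norm_map] at h1 h2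
  have h4 := mul_le_mul_of_nonneg_right (S.norm_pp_le x) (norm_nonneg h)
  have h5 := mul_le_mul_of_nonneg_right (S.norm_pn_le x) (norm_nonneg h)
  have h6 := mul_le_mul_of_nonneg_left h3 S.γ_pos.le
  rw [dAction_apply]
  calc _ ≤ |S.e (S.jp (S.pp x)) h| + |S.e (S.jn (S.pn x)) h| + |S.γ * S.dG x h| :=
        (abs_sub _ _).trans (add_le_add_left (abs_sub _ _) _)
    _ ≤ _ := by
      rw [abs_mul, abs_of_pos S.γ_pos]
      linarith

theorem dAction_lipschitz (r : ℝ) : ∃ L, 0 ≤ L ∧ ∀ x h k, S.b x x ≤ r → S.b h h ≤ r →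
    |S.dAction (x + h) k - S.dAction x k| ≤ L * ‖h‖ * ‖k‖ := by
  obtain ⟨L, hL, hL'⟩ := S.dG_lipschitz r
  refine ⟨2 + S.γ * L, by have := S.γ_pos; positivity, fun x h k hx hh => ?_⟩
  have h1 := S.e_le (S.jp (S.pp h)) k
  have h2 := S.e_le (S.jn (S.pn h)) k
  have h3 := hL' x h k hx hh
  rw [LinearIsometry.norm_map] at h1 h2
  have h4 := mul_le_mul_of_nonneg_right (S.norm_pp_le h) (norm_nonneg k)
  have h5 := mul_le_mul_of_nonneg_right (S.norm_pn_le h) (norm_nonneg k)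
  have h6 := mul_le_mul_of_nonneg_left h3 S.γ_pos.le
  have h7 : S.dAction (x + h) k - S.dAction x k = S.e (S.jp (S.pp h)) k - S.e (S.jn (S.pn h)) k -
      S.γ * (S.dG (x + h) k - S.dG x k) := by
    simp only [dAction_apply, map_add, add_apply]; ring
  rw [h7]
  calc _ ≤ |S.e (S.jp (S.pp h)) k| + |S.e (S.jn (S.pn h)) k| +
          |S.γ * (S.dG (x + h) k - S.dG x k)| :=
        (abs_sub _ _).trans (add_le_add_left (abs_sub _ _) _)
    _ ≤ _ := by
      rw [abs_mul, abs_of_pos S.γ_pos]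
      linarith

/-- Convexity places G(x + h) − G(x) − dG(x)h between 0 and (dG(x + h) − dG(x))h, so the Lipschitz
bound on dG gives a quadratic remainder without second derivatives of G. The constant is uniform on
balls of the weak form b. -/
theorem action_taylor (r : ℝ) : ∃ L, 0 ≤ L ∧ ∀ x h, S.b x x ≤ r → S.b h h ≤ r →
    |S.action (x + h) - S.action x - S.dAction x h| ≤ L * ‖h‖ ^ 2 := by
  obtain ⟨L, hL, hL'⟩ := S.dG_lipschitz r
  refine ⟨1 + S.γ * L, by have := S.γ_pos; positivity, fun x h hx hh => ?_⟩
  have h1 := hL' x h h hx hh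
  have h2 := S.tangent_le x h
  have h3 := S.tangent_le (x + h) (-h)
  rw [add_neg_cancel_right, map_neg] at h3
  have h4 : S.action (x + h) - S.action x - S.dAction x h = 1 / 2 * ‖S.pp h‖ ^ 2 -
      1 / 2 * ‖S.pn h‖ ^ 2 - S.γ * (S.G (x + h) - S.G x - S.dG x h) := by
    simp only [dAction_apply, action, map_add, S.norm_add_jp_sq, S.norm_add_jn_sq]
    rw [S.e_jp_pp _ h, S.e_jn_pn _ h]
    ring
  have h5 := S.norm_sq_eq h
  have h6 : |S.γ * (S.G (x + h) - S.G x - S.dG x h)| ≤ S.γ * (L * ‖h‖ ^ 2) := by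
    rw [abs_mul, abs_of_pos S.γ_pos]
    apply mul_le_mul_of_nonneg_left _ S.γ_pos.le
    rw [abs_of_nonneg (by linarith)]
    have := le_abs_self (S.dG (x + h) h - S.dG x h)
    nlinarith
  rw [h4]
  have h7 := abs_le.1 h6
  rw [abs_le]
  constructor <;> nlinarith [sq_nonneg ‖S.pp h‖, sq_nonneg ‖S.pn h‖]

theorem hasFDerivAt_action (x : V) : HasFDerivAt S.action (S.dAction x) x := by
  obtain ⟨L, -, hL⟩ := S.action_taylor (max (S.b x x) 1)
  apply hasFDerivAt_of_quadratic_bound (C := L)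
  have hc : Continuous fun h => S.b h h := S.b.continuous.clm_apply continuous_id
  have h1 : ∀ᶠ h in nhds (0 : V), S.b h h < 1 := by
    apply hc.tendsto' 0 0 (by simp) |>.eventually_lt_const
    norm_num
  filter_upwards [h1] with h hh
  exact hL x h (le_max_left _ _) (hh.le.trans (le_max_right _ _))

/-! ### The fibre functional J_w -/

/-- The square of the weak norm on the negative space. -/
noncomputable def sq (η : N) : ℝ := S.b (S.jn η) (S.jn η)

/-- The coefficient `a(η)`. -/
noncomputable def coef (η : N) : ℝ := √(S.lam - S.sq η)

/-- The point `a(η) w + η`. -/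
noncomputable def point (w : P) (η : N) : V := S.coef η • S.jp w + S.jn η

/-- The functional `J_w(η) = I(a(η) w + η)`. -/
noncomputable def reduced (w : P) (η : N) : ℝ := S.action (S.point w η)

/-- The derivative of `J_w` at `η`. -/
noncomputable def dReduced (w : P) (η ζ : N) : ℝ :=
  S.dAction (S.point w η) (S.jn ζ - (S.b (S.jn η) (S.jn ζ) / S.coef η) • S.jp w)

/-- `η` maximizes `J_w` on the ball. -/
def IsMax (w : P) (η : N) : Prop :=
  S.sq η < S.lam ∧ ∀ η', S.sq η' < S.lam → S.reduced w η' ≤ S.reduced w η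

theorem sq_nonneg (η : N) : 0 ≤ S.sq η := S.b_nonneg _

theorem coef_nonneg (η : N) : 0 ≤ S.coef η := Real.sqrt_nonneg _

theorem coef_pos {η : N} (h : S.sq η < S.lam) : 0 < S.coef η := Real.sqrt_pos.2 (by linarith)

theorem coef_sq {η : N} (h : S.sq η ≤ S.lam) : S.coef η ^ 2 = S.lam - S.sq η :=
  Real.sq_sqrt (by linarith)

theorem coef_sq_le (η : N) : S.coef η ^ 2 ≤ S.lam := by
  rcases le_total (S.sq η) S.lam with h | h
  · rw [S.coef_sq h]; linarith [S.sq_nonneg η]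
  · rw [coef, Real.sqrt_eq_zero_of_nonpos (by linarith)]
    simpa using S.lam_pos.le

theorem point_eq (w : P) (η : N) : S.point w η = S.jp (S.coef η • w) + S.jn η := by
  rw [point, map_smul]

theorem pp_point (w : P) (η : N) : S.pp (S.point w η) = S.coef η • w := by
  rw [point_eq, pp_add]

theorem pn_point (w : P) (η : N) : S.pn (S.point w η) = η := by
  rw [point_eq, pn_add]

theorem norm_point_sq (w : P) (η : N) :
    ‖S.point w η‖ ^ 2 = S.coef η ^ 2 * ‖w‖ ^ 2 + ‖η‖ ^ 2 := by
  rw [point_eq, norm_add_sq, norm_smul, mul_pow, Real.norm_of_nonneg (S.coef_nonneg η)]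

theorem b_point {w : P} (hw : S.b (S.jp w) (S.jp w) = 1) {η : N} (h : S.sq η ≤ S.lam) :
    S.b (S.point w η) (S.point w η) = S.lam := by
  simp only [point, map_add, map_smul, add_apply, smul_apply, smul_eq_mul, S.b_orth, S.b_orth', hw]
  have := S.coef_sq h
  rw [sq] at this
  linarith

theorem b_point_jp (w : P) (η : N) (v : P) :
    S.b (S.point w η) (S.jp v) = S.coef η * S.b (S.jp w) (S.jp v) := by
  simp [point, S.b_orth']

theorem b_point_jn (w : P) (η ζ : N) :
    S.b (S.point w η) (S.jn ζ) = S.b (S.jn η) (S.jn ζ) := by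
  simp [point, S.b_orth]

theorem reduced_eq (w : P) (η : N) : S.reduced w η =
    1 / 2 * (S.coef η ^ 2 * ‖w‖ ^ 2) - 1 / 2 * ‖η‖ ^ 2 - S.γ * S.G (S.point w η) := by
  rw [reduced, action, pp_point, pn_point, norm_smul, mul_pow,
    Real.norm_of_nonneg (S.coef_nonneg η)]

theorem dAction_point_jp (w : P) (η : N) (v : P) : S.dAction (S.point w η) (S.jp v) =
    S.coef η * S.e (S.jp w) (S.jp v) - S.γ * S.dG (S.point w η) (S.jp v) := by
  rw [dAction_apply, pp_point, pn_point, map_smul, map_smul, S.e_orth']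
  simp

theorem dAction_point_jn (w : P) (η ζ : N) : S.dAction (S.point w η) (S.jn ζ) =
    -S.e (S.jn η) (S.jn ζ) - S.γ * S.dG (S.point w η) (S.jn ζ) := by
  rw [dAction_apply, pp_point, pn_point, S.e_orth]
  simp

theorem sq_add (x y : N) : S.sq (x + y) = S.sq x + 2 * S.b (S.jn x) (S.jn y) + S.sq y := by
  simp only [sq, map_add, add_apply, S.b_symm (S.jn y) (S.jn x)]; ring

/-! ### Strong concavity on the small set -/

/-- The small set in which `J_w` is strongly concave. -/
def Small (w : P) (η : N) : Prop := S.sq η ≤ S.lam / 4 ∧ ‖η‖ ^ 2 ≤ S.lam * ‖w‖ ^ 2 / 4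

/-- Here a² ≥ 3λ/4, so ‖η‖² ≤ a²‖w‖²/3, and 4/3 ≤ (6/5)². -/
theorem Small.norm_point_le {S : SplitProblem V P N} {w : P} {η : N} (h : S.Small w η) :
    ‖S.point w η‖ ≤ 6 / 5 * (S.coef η * ‖w‖) := by
  have h0 := S.lam_pos
  have h1 := S.coef_sq (η := η) (by linarith [h.1])
  have h2 := S.coef_nonneg η
  apply le_of_sq_le_sq _ (by positivity)
  rw [S.norm_point_sq]
  nlinarith [h.1, h.2, mul_nonneg (show 0 ≤ S.lam / 4 - S.sq η by linarith [h.1]) (_root_.sq_nonneg ‖w‖),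
    mul_nonneg h0.le (_root_.sq_nonneg ‖w‖)]

/-- Factor a(y)² − a(x)² = −b(y − x, x + y), apply Cauchy–Schwarz, and divide by (a(x) + a(y))² ≥
3λ. -/
theorem coef_sub_sq_le {x y : N} (hx : S.sq x ≤ S.lam / 4) (hy : S.sq y ≤ S.lam / 4) :
    (S.coef y - S.coef x) ^ 2 ≤ S.sq (y - x) / 3 := by
  have h0 := S.lam_pos
  have hax := S.coef_sq (η := x) (by linarith)
  have hay := S.coef_sq (η := y) (by linarith)
  have hax0 := S.coef_nonneg x
  have hay0 := S.coef_nonneg y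
  have h1 : (3 * S.lam / 4) ≤ S.coef x * S.coef y := by
    apply le_of_sq_le_sq _ (by positivity)
    rw [mul_pow, hax, hay]
    nlinarith [S.sq_nonneg x, S.sq_nonneg y]
  have h2 : (S.coef y - S.coef x) * (S.coef y + S.coef x) = -S.b (S.jn (y - x)) (S.jn (x + y)) := by
    have : S.b (S.jn (y - x)) (S.jn (x + y)) = S.sq y - S.sq x := by
      simp only [sq, map_add, map_sub, sub_apply, S.b_symm (S.jn y) (S.jn x)]; ring
    rw [this]; linarith
  have h3 : ((S.coef y - S.coef x) * (S.coef y + S.coef x)) ^ 2 ≤ S.sq (y - x) * S.lam := by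
    rw [h2, neg_sq]
    refine (S.b_cauchy _ _).trans (mul_le_mul_of_nonneg_left ?_ (S.sq_nonneg _))
    rw [map_add]
    refine (S.b_add_le _ _).trans ?_
    change 2 * (S.sq x + S.sq y) ≤ S.lam
    linarith
  have h4 : 3 * S.lam ≤ (S.coef y + S.coef x) ^ 2 := by nlinarith
  rw [mul_pow] at h3
  have h5 := mul_le_mul_of_nonneg_left h4 (_root_.sq_nonneg (S.coef y - S.coef x))
  have h6 : (S.coef y - S.coef x) ^ 2 * 3 * S.lam ≤ S.sq (y - x) * S.lam := by linarith
  have := le_of_mul_le_mul_right h6 h0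
  linarith

/-- Strong concavity of `J_w` on the small set, as a tangent inequality. -/
theorem reduced_le_tangent {w : P} (hw : S.b (S.jp w) (S.jp w) = 1) {x y : N} (hx : S.Small w x)
    (hy : S.sq y ≤ S.lam / 4) :
    S.reduced w y ≤ S.reduced w x + S.dReduced w x (y - x) - 1 / 2 * ‖y - x‖ ^ 2 := by
  have h0 := S.lam_pos
  obtain ⟨ζ, rfl⟩ : ∃ ζ, y = x + ζ := ⟨y - x, by abel⟩
  have hax := S.coef_sq (η := x) (by linarith [hx.1])
  have hay := S.coef_sq (η := x + ζ) (by linarith)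
  have hax0 := S.coef_pos (η := x) (by linarith [hx.1])
  have h1 := S.coef_sub_sq_le hx.1 hy
  rw [add_sub_cancel_left] at h1 ⊢
  rw [S.sq_add] at hay
  set a := S.coef x with ha
  set a' := S.coef (x + ζ) with ha'
  set β := S.b (S.jn x) (S.jn ζ) with hβ
  set ρ := (S.sq ζ + (a' - a) ^ 2) / (2 * a) with hρ
  -- Solving a'² − a² = −2β − |ζ|₂² for a' − a: the first term is the derivative of a along ζ, and ρ
  -- is the nonnegative curvature remainder.
  have h2 : a' - a = -(β / a) - ρ := by
    rw [hρ]; field_simp; linarith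
  have h3 : ρ * a ≤ 2 / 3 * S.sq ζ := by
    rw [hρ]; field_simp; linarith
  have hρ0 : 0 ≤ ρ := by
    have := S.sq_nonneg ζ
    rw [hρ]; positivity
  have h4 : S.point w (x + ζ) = S.point w x + ((a' - a) • S.jp w + S.jn ζ) := by
    simp only [point, ← ha, ← ha', map_add, sub_smul]; abel
  have h5 := S.tangent_le (S.point w x) ((a' - a) • S.jp w + S.jn ζ)
  rw [← h4, map_add, map_smul, smul_eq_mul] at h5
  have h6 : S.dReduced w x ζ = -S.e (S.jn x) (S.jn ζ) - S.γ * S.dG (S.point w x) (S.jn ζ) -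
      (β / a) * (a * ‖w‖ ^ 2 - S.γ * S.dG (S.point w x) (S.jp w)) := by
    rw [dReduced, map_sub, map_smul, dAction_point_jp, dAction_point_jn, S.e_self,
      LinearIsometry.norm_map, smul_eq_mul]
  have h7 : S.dG (S.point w x) (S.jp w) ≤ S.K * (6 / 5 * (a * ‖w‖)) * ‖w‖ := by
    refine (le_abs_self _).trans ((S.dG_le _ _ (S.b_point hw (by linarith [hx.1])).le).trans ?_)
    rw [LinearIsometry.norm_map]
    have := hx.norm_point_le
    have hK := S.K_nonneg
    gcongr
  have hb2 : 0 ≤ S.sq ζ * ‖w‖ ^ 2 := mul_nonneg (S.sq_nonneg ζ) (_root_.sq_nonneg _)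
  -- The only term working against concavity. It is at most (6/5)(1/4)(2/3)|ζ|₂²‖w‖² =
  -- (1/5)|ζ|₂²‖w‖², below the gain ½|ζ|₂²‖w‖² from a'²; the whole −½‖ζ‖² remains.
  have h8 : S.γ * (ρ * S.dG (S.point w x) (S.jp w)) ≤ 1 / 2 * (S.sq ζ * ‖w‖ ^ 2) := by
    have hγ := S.γ_pos
    have hK := S.K_nonneg
    calc S.γ * (ρ * S.dG (S.point w x) (S.jp w)) ≤
          S.γ * (ρ * (S.K * (6 / 5 * (a * ‖w‖)) * ‖w‖)) := by gcongr
      _ = 6 / 5 * (S.γ * S.K) * ((ρ * a) * ‖w‖ ^ 2) := by ring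
      _ ≤ 6 / 5 * (1 / 4) * ((2 / 3 * S.sq ζ) * ‖w‖ ^ 2) := by
          have := S.γK_lt
          have := S.sq_nonneg ζ
          gcongr
      _ ≤ _ := by linarith
  have h9 := mul_le_mul_of_nonneg_left h5 S.γ_pos.le
  rw [h2] at h9
  rw [S.reduced_eq, S.reduced_eq, h6, S.norm_add_jn_sq, ← ha, ← ha', hay, hax]
  have h10 : β / a * (a * ‖w‖ ^ 2 - S.γ * S.dG (S.point w x) (S.jp w)) =
      β * ‖w‖ ^ 2 - β / a * (S.γ * S.dG (S.point w x) (S.jp w)) := by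
    field_simp
  rw [h10]
  linarith

theorem G_le {x : V} (hx : S.b x x ≤ S.lam) : S.G x ≤ 1 / 2 * (S.K * ‖x‖ ^ 2) := by
  have := (S.two_mul_le x).trans ((le_abs_self _).trans (S.dG_le x x hx))
  linarith

theorem sq_zero : S.sq 0 = 0 := by simp [sq]

/-- A priori estimate for competitors that do not lose against `η = 0`. -/
theorem le_of_reduced_zero_le {w : P} (hw : S.b (S.jp w) (S.jp w) = 1) {η : N}
    (hη : S.sq η < S.lam) (h : S.reduced w 0 ≤ S.reduced w η) :
    S.sq η ≤ S.γ * S.K * S.lam ∧ ‖η‖ ^ 2 ≤ S.γ * S.K * S.lam * ‖w‖ ^ 2 := by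
  have h0 := S.lam_pos
  have hz : S.sq (0 : N) ≤ S.lam := by rw [S.sq_zero]; exact h0.le
  rw [S.reduced_eq, S.reduced_eq, S.coef_sq hη.le, S.coef_sq hz, S.sq_zero] at h
  have h1 := mul_le_mul_of_nonneg_left (S.G_le (S.b_point hw hz).le) S.γ_pos.le
  rw [S.norm_point_sq, S.coef_sq hz, S.sq_zero] at h1
  have h2 := mul_nonneg S.γ_pos.le (S.G_nonneg (S.point w η))
  simp only [norm_zero] at h h1
  have h3 : S.sq η * ‖w‖ ^ 2 + ‖η‖ ^ 2 ≤ S.γ * S.K * S.lam * ‖w‖ ^ 2 := by linarith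
  have hw0 : w ≠ 0 := by rintro rfl; simp at hw
  have hw1 : 0 < ‖w‖ ^ 2 := by have := norm_pos_iff.2 hw0; positivity
  refine ⟨le_of_mul_le_mul_right (by nlinarith [_root_.sq_nonneg ‖η‖]) hw1, ?_⟩
  nlinarith [mul_nonneg (S.sq_nonneg η) hw1.le]

theorem small_of_reduced_zero_le {w : P} (hw : S.b (S.jp w) (S.jp w) = 1) {η : N}
    (hη : S.sq η < S.lam) (h : S.reduced w 0 ≤ S.reduced w η) : S.Small w η := by
  obtain ⟨h1, h2⟩ := S.le_of_reduced_zero_le hw hη h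
  have h3 : S.γ * S.K * S.lam ≤ S.lam / 4 := by nlinarith [S.lam_pos, S.γK_lt]
  refine ⟨h1.trans h3, h2.trans ?_⟩
  have := mul_le_mul_of_nonneg_right h3 (_root_.sq_nonneg ‖w‖)
  linarith

variable {S} in
theorem IsMax.small {w : P} (hw : S.b (S.jp w) (S.jp w) = 1) {η : N} (h : S.IsMax w η) :
    S.Small w η :=
  S.small_of_reduced_zero_le hw h.1 (h.2 0 (by rw [S.sq_zero]; exact S.lam_pos))

theorem continuous_sq : Continuous S.sq := by
  have h : Continuous fun η => S.b (S.jn η) :=  S.b.continuous.comp S.jn.continuous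
  exact h.clm_apply S.jn.continuous

-- The ball is open, so t ↦ J_w(η + tζ) has a local maximum at 0; its derivative there is
-- `dReduced`, since a(η + tζ) has derivative −b(η, ζ)/a(η).
variable {S} in
theorem IsMax.dReduced_eq_zero {w : P} {η : N} (h : S.IsMax w η) (ζ : N) :
    S.dReduced w η ζ = 0 := by
  have hsq (t : ℝ) : S.sq (η + t • ζ) =
      S.sq η + 2 * t * S.b (S.jn η) (S.jn ζ) + t ^ 2 * S.sq ζ := by
    rw [S.sq_add]
    simp only [sq, map_smul, smul_apply, smul_eq_mul]
    ring
  have hd1 : HasDerivAt (fun t : ℝ => S.lam - S.sq (η + t • ζ))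
      (-(2 * S.b (S.jn η) (S.jn ζ))) 0 := by
    simp only [hsq, add_assoc]
    have h1 := (((hasDerivAt_id' (0 : ℝ)).const_mul 2).mul_const (S.b (S.jn η) (S.jn ζ))).fun_add
      ((hasDerivAt_pow 2 (0 : ℝ)).mul_const (S.sq ζ))
    exact ((h1.const_add (S.sq η)).const_sub S.lam).congr_deriv (by simp)
  have hpos := S.coef_pos h.1
  have hd2 : HasDerivAt (fun t : ℝ => S.coef (η + t • ζ))
      (-(S.b (S.jn η) (S.jn ζ) / S.coef η)) 0 := by
    have h2 := hd1.sqrt (by simp only [zero_smul, add_zero]; linarith [h.1])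
    refine h2.congr_deriv ?_
    simp only [zero_smul, add_zero]
    change _ / (2 * S.coef η) = _
    field_simp
  have hd3 : HasDerivAt (fun t : ℝ => S.point w (η + t • ζ))
      (S.jn ζ - (S.b (S.jn η) (S.jn ζ) / S.coef η) • S.jp w) 0 := by
    have h3 : HasDerivAt (fun t : ℝ => S.jn (η + t • ζ)) (S.jn ζ) 0 := by
      simp only [map_add, map_smul]
      simpa using ((hasDerivAt_id (0 : ℝ)).smul_const (S.jn ζ)).const_add (S.jn η)
    refine ((hd2.smul_const (S.jp w)).fun_add h3).congr_deriv ?_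
    rw [neg_smul]; abel
  have hd4 : HasDerivAt (fun t : ℝ => S.reduced w (η + t • ζ)) (S.dReduced w η ζ) 0 := by
    have h4 := S.hasFDerivAt_action (S.point w (η + (0 : ℝ) • ζ))
    have h5 := h4.comp_hasDerivAt (0 : ℝ) hd3
    rw [zero_smul, add_zero] at h5
    exact h5
  have hloc : IsLocalMax (fun t : ℝ => S.reduced w (η + t • ζ)) 0 := by
    have hc : Continuous fun t : ℝ => S.sq (η + t • ζ) := S.continuous_sq.comp (by fun_prop)
    have h6 : ∀ᶠ t in nhds (0 : ℝ), S.sq (η + t • ζ) < S.lam :=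
      (hc.tendsto' 0 (S.sq η) (by simp)).eventually_lt_const h.1
    filter_upwards [h6] with t ht
    simpa using h.2 _ ht
  exact hloc.hasDerivAt_eq_zero hd4

variable {S} in
/-- A maximizer beats every competitor by a quadratic amount. -/
theorem IsMax.reduced_le {w : P} (hw : S.b (S.jp w) (S.jp w) = 1) {x y : N} (h : S.IsMax w x)
    (hy : S.sq y ≤ S.lam / 4) : S.reduced w y ≤ S.reduced w x - 1 / 2 * ‖y - x‖ ^ 2 := by
  have h1 := S.reduced_le_tangent hw (h.small hw) hy
  rw [h.dReduced_eq_zero] at h1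
  linarith

/-- A small critical point of `J_w` is a maximizer provided some maximizer exists. -/
theorem isMax_of_critical {w : P} (hw : S.b (S.jp w) (S.jp w) = 1) {x y : N} (hx : S.Small w x)
    (hc : ∀ ζ, S.dReduced w x ζ = 0) (hy : S.IsMax w y) : x = y := by
  have h1 := S.reduced_le_tangent hw hx (hy.small hw).1
  rw [hc] at h1
  have h2 := hy.2 x (by linarith [hx.1, S.lam_pos])
  have h3 : ‖y - x‖ ^ 2 ≤ 0 := by linarith
  have h4 : y - x = 0 := by simpa using le_antisymm h3 (by positivity)
  exact (sub_eq_zero.1 h4).symm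

variable {S} in
theorem IsMax.unique {w : P} (hw : S.b (S.jp w) (S.jp w) = 1) {x y : N} (hx : S.IsMax w x)
    (hy : S.IsMax w y) : x = y :=
  S.isMax_of_critical hw (hx.small hw) hx.dReduced_eq_zero hy

theorem continuous_reduced (w : P) : Continuous (S.reduced w) := by
  have h1 : Continuous S.action :=
    continuous_iff_continuousAt.2 fun x => (S.hasFDerivAt_action x).continuousAt
  have h2 : Continuous S.coef := Real.continuous_sqrt.comp (continuous_const.sub S.continuous_sq)
  exact h1.comp ((h2.smul continuous_const).add S.jn.continuous)

theorem reduced_le (w : P) (η : N) : S.reduced w η ≤ 1 / 2 * (S.lam * ‖w‖ ^ 2) := by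
  rw [reduced_eq]
  have h1 := mul_nonneg S.γ_pos.le (S.G_nonneg (S.point w η))
  have h2 := mul_le_mul_of_nonneg_right (S.coef_sq_le η) (_root_.sq_nonneg ‖w‖)
  nlinarith [_root_.sq_nonneg ‖η‖]

theorem Small.midpoint {S : SplitProblem V P N} {w : P} {x y : N} (hx : S.Small w x)
    (hy : S.Small w y) : S.Small w ((1 / 2 : ℝ) • (x + y)) := by
  constructor
  · have h1 : S.sq ((1 / 2 : ℝ) • (x + y)) ≤ 1 / 2 * (S.sq x + S.sq y) := by
      have := S.b_add_le (S.jn x) (S.jn y)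
      simp only [sq, map_smul, map_add S.jn, smul_apply, smul_eq_mul]
      linarith
    linarith [hx.1, hy.1]
  · rw [norm_smul, mul_pow]
    have h2 := norm_add_le x y
    have h3 : ‖x + y‖ ^ 2 ≤ 2 * (‖x‖ ^ 2 + ‖y‖ ^ 2) := by
      nlinarith [norm_nonneg (x + y), norm_nonneg x, norm_nonneg y, _root_.sq_nonneg (‖x‖ - ‖y‖)]
    norm_num
    linarith [hx.2, hy.2]

/-- Midpoint strong concavity of `J_w` on the small set. -/
theorem reduced_midpoint {w : P} (hw : S.b (S.jp w) (S.jp w) = 1) {x y : N} (hx : S.Small w x)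
    (hy : S.Small w y) : S.reduced w x + S.reduced w y ≤
      2 * S.reduced w ((1 / 2 : ℝ) • (x + y)) - 1 / 4 * ‖x - y‖ ^ 2 := by
  have h1 := S.reduced_le_tangent hw (hx.midpoint hy) hx.1
  have h2 := S.reduced_le_tangent hw (hx.midpoint hy) hy.1
  have h3 : x - (1 / 2 : ℝ) • (x + y) = (1 / 2 : ℝ) • (x - y) := by module
  have h4 : y - (1 / 2 : ℝ) • (x + y) = -((1 / 2 : ℝ) • (x - y)) := by module
  rw [h3] at h1
  rw [h4, norm_neg] at h2
  have h5 : ∀ z ζ : N, S.dReduced w z (-ζ) = -S.dReduced w z ζ := by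
    intro z ζ
    simp only [dReduced, map_neg, map_sub, map_smul, smul_eq_mul]; ring
  rw [h5] at h2
  have h6 : ‖(1 / 2 : ℝ)‖ ^ 2 = 1 / 4 := by norm_num
  rw [norm_smul, mul_pow, h6] at h1 h2
  linarith

theorem exists_isMax [CompleteSpace N] {w : P} (hw : S.b (S.jp w) (S.jp w) = 1) :
    ∃ η, S.IsMax w η := by
  set A : Set ℝ := S.reduced w '' {η | S.sq η < S.lam} with hA
  have hbdd : BddAbove A := ⟨1 / 2 * (S.lam * ‖w‖ ^ 2), by
    rintro _ ⟨η, -, rfl⟩; exact S.reduced_le w η⟩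
  have h0mem : S.sq (0 : N) < S.lam := by rw [S.sq_zero]; exact S.lam_pos
  have hne : A.Nonempty := ⟨_, 0, h0mem, rfl⟩
  have hle : ∀ η, S.sq η < S.lam → S.reduced w η ≤ sSup A := fun η hη =>
    le_csSup hbdd ⟨η, hη, rfl⟩
  have hseq (n : ℕ) : ∃ η, S.Small w η ∧ sSup A - 1 / (n + 1) < S.reduced w η := by
    have hn : (0 : ℝ) < 1 / (n + 1) := Nat.one_div_pos_of_nat
    obtain ⟨_, ⟨η, hη, rfl⟩, h1⟩ := exists_lt_of_lt_csSup hne (show sSup A - 1 / (n + 1) < sSup A by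
      linarith)
    -- A competitor that loses against 0 is replaced by 0, so the whole maximizing sequence lies in
    -- the small set.
    rcases le_total (S.reduced w 0) (S.reduced w η) with h2 | h2
    · exact ⟨η, S.small_of_reduced_zero_le hw hη h2, h1⟩
    · exact ⟨0, S.small_of_reduced_zero_le hw h0mem le_rfl, h1.trans_le h2⟩
  choose u hu hu' using hseq
  have hlt {η : N} (h : S.Small w η) : S.sq η < S.lam := by linarith [h.1, S.lam_pos]
  have hcauchy : CauchySeq u := by
    -- Midpoint concavity bounds ¼‖u_n − u_k‖² by the sum of the two deficits, each at most 1/(N +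
    -- 1); hence the 8.
    refine cauchySeq_of_le_tendsto_0 (fun n : ℕ => √(8 * (1 / ((n : ℝ) + 1)))) (fun n k j hn hk => ?_) ?_
    · rw [dist_eq_norm]
      apply Real.le_sqrt_of_sq_le
      have h1 := S.reduced_midpoint hw (hu n) (hu k)
      have h2 := hle _ (hlt ((hu n).midpoint (hu k)))
      have h3 := Nat.one_div_le_one_div (α := ℝ) hn
      have h4 := Nat.one_div_le_one_div (α := ℝ) hk
      linarith [hu' n, hu' k]
    · have h5 := (tendsto_one_div_add_atTop_nhds_zero_nat (𝕜 := ℝ)).const_mul 8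
      have h6 := h5.sqrt
      simpa using h6
  obtain ⟨η, hη⟩ := cauchySeq_tendsto_of_complete hcauchy
  have h1 : S.sq η ≤ S.lam / 4 :=
    le_of_tendsto ((S.continuous_sq.tendsto η).comp hη) (Filter.Eventually.of_forall fun n => (hu n).1)
  have h2 : sSup A ≤ S.reduced w η := by
    have h3 := ((S.continuous_reduced w).tendsto η).comp hη
    have h4 := (tendsto_one_div_add_atTop_nhds_zero_nat (𝕜 := ℝ)).const_sub (sSup A)
    rw [sub_zero] at h4
    exact le_of_tendsto_of_tendsto' h4 h3 fun n => (hu' n).le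
  exact ⟨η, by linarith [S.lam_pos], fun η' hη' => (hle η' hη').trans h2⟩

/-! ### The value function and the envelope argument -/

/-- The value `sup_η J_w(η)`. -/
noncomputable def value (w : P) : ℝ := ⨆ η : {η | S.sq η < S.lam}, S.reduced w η

variable {S} in
theorem IsMax.value_eq {w : P} {η : N} (h : S.IsMax w η) : S.value w = S.reduced w η := by
  have hne : Nonempty {η | S.sq η < S.lam} := ⟨⟨η, h.1⟩⟩
  apply le_antisymm
  · exact ciSup_le fun η' => h.2 η' η'.2
  · exact le_ciSup (f := fun η' : {η | S.sq η < S.lam} => S.reduced w η')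
      ⟨_, by rintro _ ⟨η', rfl⟩; exact h.2 η' η'.2⟩ ⟨η, h.1⟩

theorem sq_le (ζ : N) : S.sq ζ ≤ ‖S.b‖ * ‖ζ‖ ^ 2 := by
  have := S.b.le_opNorm₂ (S.jn ζ) (S.jn ζ)
  rw [LinearIsometry.norm_map] at this
  rw [sq, pow_two, ← mul_assoc]
  exact (le_abs_self _).trans this

theorem coef_le (η : N) : S.coef η ≤ S.lam + 1 := by
  apply le_of_sq_le_sq _ (by linarith [S.lam_pos])
  nlinarith [S.coef_sq_le η, S.lam_pos]

theorem coef_sub_le {x y : N} (hx : S.sq x ≤ S.lam / 4) (hy : S.sq y ≤ S.lam / 4) :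
    |S.coef y - S.coef x| ≤ (‖S.b‖ + 1) * ‖y - x‖ := by
  apply abs_le_of_sq_le_sq _ (by positivity)
  have h1 := S.coef_sub_sq_le hx hy
  have h2 := S.sq_le (y - x)
  have h3 : ‖S.b‖ ≤ (‖S.b‖ + 1) ^ 2 := by nlinarith [norm_nonneg S.b]
  have h4 := mul_le_mul_of_nonneg_right h3 (_root_.sq_nonneg ‖y - x‖)
  have h5 : 0 ≤ ‖S.b‖ * ‖y - x‖ ^ 2 := by positivity
  rw [mul_pow]
  linarith

theorem point_add (u u' : P) (η : N) :
    S.point u' η = S.point u η + S.coef η • S.jp (u' - u) := by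
  simp only [point, map_sub, smul_sub]; abel

theorem norm_point_le_of {u : P} {η : N} {R : ℝ} (hR : ‖u‖ ≤ R) (hη : ‖η‖ ^ 2 ≤ S.lam * R ^ 2) :
    ‖S.point u η‖ ≤ 2 * (S.lam + 1) * R := by
  have h0 := S.lam_pos
  have hR0 := (norm_nonneg u).trans hR
  apply le_of_sq_le_sq _ (by positivity)
  rw [S.norm_point_sq]
  have h1 : S.coef η ^ 2 * ‖u‖ ^ 2 ≤ S.lam * R ^ 2 :=
    mul_le_mul (S.coef_sq_le η) (pow_le_pow_left₀ (norm_nonneg u) hR 2) (by positivity) h0.le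
  nlinarith [mul_nonneg h0.le (_root_.sq_nonneg R), mul_nonneg (mul_nonneg h0.le h0.le)
    (_root_.sq_nonneg R), _root_.sq_nonneg R]

/-- The envelope estimate: first order expansion of the value along the unit sphere. -/
theorem value_expansion [CompleteSpace N] {u : P} (hu : S.b (S.jp u) (S.jp u) = 1) {η : N}
    (hη : S.IsMax u η) : ∃ C₁ C₂, 0 ≤ C₁ ∧ 0 ≤ C₂ ∧
      ∀ u', S.b (S.jp u') (S.jp u') = 1 → ‖u' - u‖ ≤ 1 →
        |S.value u' - S.value u - S.coef η * S.dAction (S.point u η) (S.jp (u' - u))| ≤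
          (C₁ * √‖u' - u‖ + C₂ * ‖u' - u‖) * ‖u' - u‖ := by
  have h0 := S.lam_pos
  have hγ := S.γ_pos
  have hK := S.K_nonneg
  -- R bounds both base points, M bounds dI at the points of the fibre over u, β is a Lipschitz
  -- constant of a on the small set, and D is one for the dependence of J_u(ζ) on u.
  set R := ‖u‖ + 1 with hR
  have hR0 : 0 ≤ R := by positivity
  set M := (2 + S.γ * S.K) * (2 * (S.lam + 1) * R) with hM
  have hM0 : 0 ≤ M := by positivity
  set β := ‖S.b‖ + 1 with hβ
  have hβ0 : 0 ≤ β := by positivity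
  -- Points have weak square λ; the increments a(ζ)(u' − u) and the differences of two points have
  -- weak square at most 4λ.
  obtain ⟨L, hL0, hL⟩ := S.action_taylor (4 * S.lam)
  obtain ⟨L', hL0', hL'⟩ := S.dAction_lipschitz (4 * S.lam)
  set D := M * (S.lam + 1) + L * (S.lam + 1) ^ 2 with hD
  have hD0 : 0 ≤ D := by positivity
  refine ⟨((S.lam + 1) * L' * (β * R + 1) + β * M) * √(4 * D), L * (S.lam + 1) ^ 2,
    by positivity, by positivity, fun u' hu' hδ => ?_⟩
  obtain ⟨η', hη'⟩ := S.exists_isMax hu'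
  have hsm := hη.small hu
  have hsm' := hη'.small hu'
  have hq : S.sq η ≤ S.lam := hη.1.le
  have hq' : S.sq η' ≤ S.lam := hη'.1.le
  have hu'R : ‖u'‖ ≤ R := by
    have := norm_add_le (u' - u) u
    rw [sub_add_cancel] at this
    linarith
  have hηR {v : P} {ζ : N} (hv : ‖v‖ ≤ R) (h : S.Small v ζ) : ‖ζ‖ ^ 2 ≤ S.lam * R ^ 2 := by
    have h1 := mul_le_mul_of_nonneg_left (pow_le_pow_left₀ (norm_nonneg v) hv 2) h0.le
    nlinarith [h.2, mul_nonneg h0.le (_root_.sq_nonneg R)]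
  have hηR0 := hηR (by linarith) hsm
  have hηR' := hηR hu'R hsm'
  have hbδ : S.b (S.jp (u' - u)) (S.jp (u' - u)) ≤ 4 := by
    rw [map_sub]
    exact (S.b_sub_le _ _).trans (by rw [hu, hu']; norm_num)
  have hincr (ζ : N) : S.b (S.coef ζ • S.jp (u' - u)) (S.coef ζ • S.jp (u' - u)) ≤ 4 * S.lam := by
    simp only [map_smul, smul_apply, smul_eq_mul]
    nlinarith [S.coef_sq_le ζ, S.b_nonneg (S.jp (u' - u)), _root_.sq_nonneg (S.coef ζ)]
  have hincr_norm (ζ : N) : ‖S.coef ζ • S.jp (u' - u)‖ ≤ (S.lam + 1) * ‖u' - u‖ := by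
    rw [norm_smul, LinearIsometry.norm_map, Real.norm_of_nonneg (S.coef_nonneg ζ)]
    exact mul_le_mul_of_nonneg_right (S.coef_le ζ) (norm_nonneg _)
  -- first order expansion of the reduced functional in `w`
  have hexp {ζ : N} (hζ : S.sq ζ ≤ S.lam) : |S.reduced u' ζ - S.reduced u ζ -
      S.coef ζ * S.dAction (S.point u ζ) (S.jp (u' - u))| ≤
        L * (S.lam + 1) ^ 2 * ‖u' - u‖ * ‖u' - u‖ := by
    have h1 := hL (S.point u ζ) (S.coef ζ • S.jp (u' - u))
      ((S.b_point hu hζ).le.trans (by linarith)) (hincr ζ)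
    rw [← S.point_add, map_smul, smul_eq_mul] at h1
    refine h1.trans ?_
    have h2 := pow_le_pow_left₀ (norm_nonneg _) (hincr_norm ζ) 2
    calc _ ≤ L * ((S.lam + 1) * ‖u' - u‖) ^ 2 := mul_le_mul_of_nonneg_left h2 hL0
      _ = _ := by ring
  have hdA {ζ : N} (hζ : S.sq ζ ≤ S.lam) (hζR : ‖ζ‖ ^ 2 ≤ S.lam * R ^ 2) (k : V) :
      |S.dAction (S.point u ζ) k| ≤ M * ‖k‖ := by
    refine (S.abs_dAction_le (S.b_point hu hζ).le k).trans ?_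
    have := S.norm_point_le_of (u := u) (by linarith) hζR
    rw [hM]
    gcongr
  have hlip {ζ : N} (hζ : S.sq ζ ≤ S.lam) (hζR : ‖ζ‖ ^ 2 ≤ S.lam * R ^ 2) :
      |S.reduced u' ζ - S.reduced u ζ| ≤ D * ‖u' - u‖ := by
    have h1 := hexp hζ
    have h2 : |S.coef ζ * S.dAction (S.point u ζ) (S.jp (u' - u))| ≤
        (S.lam + 1) * (M * ‖u' - u‖) := by
      rw [abs_mul, abs_of_nonneg (S.coef_nonneg ζ)]
      have h3 := hdA hζ hζR (S.jp (u' - u))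
      rw [LinearIsometry.norm_map] at h3
      exact mul_le_mul (S.coef_le ζ) h3 (abs_nonneg _) (by positivity)
    have h4 : L * (S.lam + 1) ^ 2 * ‖u' - u‖ * ‖u' - u‖ ≤ L * (S.lam + 1) ^ 2 * ‖u' - u‖ :=
      mul_le_of_le_one_right (by positivity) hδ
    have h5 := abs_add_le (S.reduced u' ζ - S.reduced u ζ -
      S.coef ζ * S.dAction (S.point u ζ) (S.jp (u' - u)))
      (S.coef ζ * S.dAction (S.point u ζ) (S.jp (u' - u)))
    rw [sub_add_cancel] at h5
    rw [hD]
    linarith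
  -- the maximizer depends continuously on `w`
  have hτ : ‖η' - η‖ ≤ √(4 * D) * √‖u' - u‖ := by
    rw [← Real.sqrt_mul (by positivity)]
    apply Real.le_sqrt_of_sq_le
    have h1 := hη.reduced_le hu hsm'.1
    have h2 := abs_le.1 (hlip hq hηR0)
    have h3 := abs_le.1 (hlip hq' hηR')
    have h4 := hη'.2 η hη.1
    linarith [h2.1, h3.2]
  have hcoef : |S.coef η' - S.coef η| ≤ β * ‖η' - η‖ := S.coef_sub_le hsm.1 hsm'.1
  have hdiff : |S.coef η' * S.dAction (S.point u η') (S.jp (u' - u)) -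
      S.coef η * S.dAction (S.point u η) (S.jp (u' - u))| ≤
        ((S.lam + 1) * L' * (β * R + 1) + β * M) * ‖η' - η‖ * ‖u' - u‖ := by
    set h := S.point u η' - S.point u η with hh
    have hbh : S.b h h ≤ 4 * S.lam := by
      refine (S.b_sub_le _ _).trans ?_
      rw [S.b_point hu hq, S.b_point hu hq']
      linarith
    have hnh : ‖h‖ ≤ (β * R + 1) * ‖η' - η‖ := by
      have h1 : h = (S.coef η' - S.coef η) • S.jp u + S.jn (η' - η) := by
        rw [hh, point, point, map_sub, sub_smul]; abel
      rw [h1]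
      refine (norm_add_le _ _).trans ?_
      rw [norm_smul, LinearIsometry.norm_map, LinearIsometry.norm_map, Real.norm_eq_abs]
      have h2 : |S.coef η' - S.coef η| * ‖u‖ ≤ β * ‖η' - η‖ * R :=
        mul_le_mul hcoef (by linarith) (norm_nonneg u) (by positivity)
      linarith
    have h3 := hL' (S.point u η) h (S.jp (u' - u))
      ((S.b_point hu hq).le.trans (by linarith)) hbh
    rw [hh, add_sub_cancel, ← hh, LinearIsometry.norm_map] at h3
    have h4 := hdA hq hηR0 (S.jp (u' - u))
    rw [LinearIsometry.norm_map] at h4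
    have h5 : S.coef η' * S.dAction (S.point u η') (S.jp (u' - u)) -
        S.coef η * S.dAction (S.point u η) (S.jp (u' - u)) =
        S.coef η' * (S.dAction (S.point u η') (S.jp (u' - u)) -
          S.dAction (S.point u η) (S.jp (u' - u))) +
        (S.coef η' - S.coef η) * S.dAction (S.point u η) (S.jp (u' - u)) := by ring
    rw [h5]
    refine (abs_add_le _ _).trans ?_
    rw [abs_mul, abs_mul, abs_of_nonneg (S.coef_nonneg η')]
    calc _ ≤ (S.lam + 1) * (L' * ((β * R + 1) * ‖η' - η‖) * ‖u' - u‖) +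
          (β * ‖η' - η‖) * (M * ‖u' - u‖) := by
          refine add_le_add (mul_le_mul (S.coef_le η') (h3.trans ?_) (abs_nonneg _) (by positivity))
            (mul_le_mul hcoef h4 (abs_nonneg _) (by positivity))
          gcongr
      _ = _ := by ring
  have hA0 : 0 ≤ (S.lam + 1) * L' * (β * R + 1) + β * M := by positivity
  have hτ' : ((S.lam + 1) * L' * (β * R + 1) + β * M) * ‖η' - η‖ * ‖u' - u‖ ≤
      ((S.lam + 1) * L' * (β * R + 1) + β * M) * √(4 * D) * √‖u' - u‖ * ‖u' - u‖ := by
    have h1 := mul_le_mul_of_nonneg_left hτ hA0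
    have h2 := mul_le_mul_of_nonneg_right h1 (norm_nonneg (u' - u))
    linarith
  have hrest : 0 ≤ ((S.lam + 1) * L' * (β * R + 1) + β * M) * ‖η' - η‖ * ‖u' - u‖ := by positivity
  have e1 := abs_le.1 (hexp hq)
  have e2 := abs_le.1 (hexp hq')
  have e3 := abs_le.1 hdiff
  -- Sandwich: J_{u'}(η) − J_u(η) ≤ E(u') − E(u) ≤ J_{u'}(η') − J_u(η'). Both ends have the same
  -- linear part up to the error `hdiff`.
  have h1 := hη.2 η' hη'.1
  have h2 := hη'.2 η hη.1
  rw [hη.value_eq, hη'.value_eq, abs_le]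
  constructor <;> linarith [e1.1, e2.2, e3.2]

theorem hasFDerivWithinAt_value [CompleteSpace N] {u : P} (hu : S.b (S.jp u) (S.jp u) = 1) {η : N}
    (hη : S.IsMax u η) : HasFDerivWithinAt S.value
      (S.coef η • (S.dAction (S.point u η)).comp S.jp.toContinuousLinearMap)
      {u | S.b (S.jp u) (S.jp u) = 1} u := by
  obtain ⟨C₁, C₂, hC₁, hC₂, h⟩ := S.value_expansion hu hη
  rw [hasFDerivWithinAt_iff_isLittleO]
  refine Asymptotics.isLittleO_iff.2 fun c hc => ?_
  have hcont : Continuous fun u' : P => C₁ * √‖u' - u‖ + C₂ * ‖u' - u‖ := by fun_prop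
  have h1 : ∀ᶠ u' in nhdsWithin u {u | S.b (S.jp u) (S.jp u) = 1},
      C₁ * √‖u' - u‖ + C₂ * ‖u' - u‖ < c :=
    ((hcont.tendsto' u 0 (by simp)).mono_left nhdsWithin_le_nhds).eventually_lt_const hc
  have h2 : ∀ᶠ u' in nhdsWithin u {u | S.b (S.jp u) (S.jp u) = 1}, ‖u' - u‖ < 1 :=
    ((Continuous.tendsto' (by fun_prop : Continuous fun u' : P => ‖u' - u‖) u 0
      (by simp)).mono_left nhdsWithin_le_nhds).eventually_lt_const zero_lt_one
  filter_upwards [h1, h2, self_mem_nhdsWithin] with u' h3 h4 h5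
  exact (h u' h5 h4.le).trans (mul_le_mul_of_nonneg_right h3.le (norm_nonneg _))

/-! ### Extension of the value off the sphere by homogeneity -/

/-- The projection of `P ∖ {0}` on the unit sphere. -/
noncomputable def normalize (w : P) : P := (√(S.b (S.jp w) (S.jp w)))⁻¹ • w

theorem b_jp_pos {w : P} (hw : w ≠ 0) : 0 < S.b (S.jp w) (S.jp w) :=
  S.b_pos _ fun h => hw (S.jp.injective (h.trans S.jp.map_zero.symm))

theorem b_normalize {w : P} (hw : w ≠ 0) :
    S.b (S.jp (S.normalize w)) (S.jp (S.normalize w)) = 1 := by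
  have h := S.b_jp_pos hw
  have h1 := (Real.sqrt_pos.2 h).ne'
  simp only [normalize, map_smul, smul_apply, smul_eq_mul]
  field_simp
  rw [Real.sq_sqrt h.le]

theorem normalize_of_unit {w : P} (hw : S.b (S.jp w) (S.jp w) = 1) : S.normalize w = w := by
  rw [normalize, hw]; simp

/-- The form `b(w, ·)` on `P`. -/
noncomputable def bP (w : P) : P →L[ℝ] ℝ := (S.b (S.jp w)).comp S.jp.toContinuousLinearMap

theorem bP_apply (w v : P) : S.bP w v = S.b (S.jp w) (S.jp v) := rfl

theorem hasFDerivAt_normalize {w : P} (hw : w ≠ 0) : HasFDerivAt S.normalize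
    ((√(S.b (S.jp w) (S.jp w)))⁻¹ • ContinuousLinearMap.id ℝ P -
      ((√(S.b (S.jp w) (S.jp w)) ^ 3)⁻¹ • S.bP w).smulRight w) w := by
  have hs := S.b_jp_pos hw
  have hs' := Real.sqrt_pos.2 hs
  have h1 : HasFDerivAt (fun w => S.b (S.jp w) (S.jp w)) ((2 : ℝ) • S.bP w) w := by
    have h2 := (S.b.hasFDerivAt.comp w S.jp.toContinuousLinearMap.hasFDerivAt).clm_apply
      (S.jp.toContinuousLinearMap.hasFDerivAt (x := w))
    refine h2.congr_fderiv ?_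
    ext v
    simp [bP_apply, S.b_symm (S.jp v) (S.jp w), two_mul]
  have h3 : HasDerivAt (fun t : ℝ => (√t)⁻¹) (-(2 * √(S.b (S.jp w) (S.jp w)) ^ 3)⁻¹)
      (S.b (S.jp w) (S.jp w)) := by
    refine ((Real.hasDerivAt_sqrt hs.ne').fun_inv hs'.ne').congr_deriv ?_
    field_simp
  have h4 := (h3.comp_hasFDerivAt w h1).smul (hasFDerivAt_id w)
  refine h4.congr_fderiv ?_
  ext v
  simp only [Function.comp_apply, id_eq, add_apply, smul_apply, sub_apply, bP_apply,
    ContinuousLinearMap.smulRight_apply, ContinuousLinearMap.id_apply, smul_eq_mul]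
  rw [sub_eq_add_neg, ← neg_smul]
  congr 2
  field_simp

/-- A derivative within the sphere is enough for the chain rule, because `normalize` takes its
values in the sphere near w. -/
theorem hasFDerivAt_value_normalize [CompleteSpace N] {w : P} (hw : w ≠ 0) {η : N}
    (hη : S.IsMax (S.normalize w) η) : HasFDerivAt (fun w => S.value (S.normalize w))
      ((S.coef η • (S.dAction (S.point (S.normalize w) η)).comp S.jp.toContinuousLinearMap).comp
        ((√(S.b (S.jp w) (S.jp w)))⁻¹ • ContinuousLinearMap.id ℝ P -
          ((√(S.b (S.jp w) (S.jp w)) ^ 3)⁻¹ • S.bP w).smulRight w)) w := by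
  refine (S.hasFDerivWithinAt_value (S.b_normalize hw) hη).comp_hasFDerivAt w
    (S.hasFDerivAt_normalize hw) ?_
  filter_upwards [isOpen_ne.mem_nhds hw] with w' hw'
  exact S.b_normalize hw'

theorem differentiableAt_value [CompleteSpace N] {w : P} (hw : w ≠ 0) :
    DifferentiableAt ℝ (fun w => S.value (S.normalize w)) w := by
  obtain ⟨η, hη⟩ := S.exists_isMax (S.b_normalize hw)
  exact (S.hasFDerivAt_value_normalize hw hη).differentiableAt

theorem ne_zero_of_unit {w : P} (hw : S.b (S.jp w) (S.jp w) = 1) : w ≠ 0 := by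
  rintro rfl; simp at hw

theorem fderiv_value [CompleteSpace N] {w : P} (hw : S.b (S.jp w) (S.jp w) = 1) {η : N}
    (hη : S.IsMax w η) (v : P) : fderiv ℝ (fun w => S.value (S.normalize w)) w v =
      S.coef η * S.dAction (S.point w η) (S.jp (v - S.b (S.jp w) (S.jp v) • w)) := by
  have h1 : S.IsMax (S.normalize w) η := by rwa [S.normalize_of_unit hw]
  rw [(S.hasFDerivAt_value_normalize (S.ne_zero_of_unit hw) h1).fderiv, S.normalize_of_unit hw, hw]
  simp [bP_apply]
  ring

/-! ### Critical points of the value and the multiplier equation -/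

variable {S} in
/-- Critical points of the value on the unit sphere give solutions of the multiplier equation. -/
theorem IsMax.dAction_eq [CompleteSpace N] {w : P} (hw : S.b (S.jp w) (S.jp w) = 1) {η : N}
    (hη : S.IsMax w η)
    (hc : ∀ v, S.b (S.jp w) (S.jp v) = 0 → fderiv ℝ (fun w => S.value (S.normalize w)) w v = 0)
    (h : V) : S.dAction (S.point w η) h =
      (S.coef η)⁻¹ * S.dAction (S.point w η) (S.jp w) * S.b (S.point w η) h := by
  have ha := S.coef_pos hη.1
  have h1 (v : P) : S.dAction (S.point w η) (S.jp v) =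
      S.b (S.jp w) (S.jp v) * S.dAction (S.point w η) (S.jp w) := by
    -- The tangential part of v; criticality makes dI(ψ) proportional to b(w, ·) on P. Along N the
    -- proportionality comes from stationarity of J_w at η.
    have h2 := hc (v - S.b (S.jp w) (S.jp v) • w) (by simp [hw])
    rw [S.fderiv_value hw hη] at h2
    simp only [map_sub, map_smul, smul_eq_mul, hw, mul_one, sub_self, zero_smul, sub_zero,
      mul_eq_zero, ha.ne', false_or] at h2
    linarith
  have h3 (ζ : N) : S.dAction (S.point w η) (S.jn ζ) =
      S.b (S.jn η) (S.jn ζ) / S.coef η * S.dAction (S.point w η) (S.jp w) := by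
    have h4 := hη.dReduced_eq_zero ζ
    rw [dReduced, map_sub, map_smul, smul_eq_mul] at h4
    linarith
  rw [← S.split h, map_add, map_add, h1, h3, S.b_point_jp, S.b_point_jn]
  field_simp

/-- The derivative of the value evaluates dI(ψ) = ω b(ψ, ·) at v − b(w, v)w, which is b-orthogonal
to ψ. -/
theorem fderiv_value_eq_zero [CompleteSpace N] {w : P} (hw : S.b (S.jp w) (S.jp w) = 1) {η : N}
    (hη : S.IsMax w η) {ω : ℝ} (hω : ∀ h, S.dAction (S.point w η) h = ω * S.b (S.point w η) h)
    (v : P) : fderiv ℝ (fun w => S.value (S.normalize w)) w v = 0 := by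
  rw [S.fderiv_value hw hη, hω, S.b_point_jp, map_sub, map_smul, map_sub, map_smul, hw]
  simp

-- Since dI(ψ)[w] = a‖w‖² − γ dG(ψ)[w] and ‖ψ‖ ≤ (6/5)a‖w‖ on the small set, dividing by a gives the
-- bound.
variable {S} in
theorem IsMax.le_multiplier {w : P} (hw : S.b (S.jp w) (S.jp w) = 1) {η : N}
    (hη : S.IsMax w η) {C : ℝ} (hC : 0 ≤ C)
    (hG : S.dG (S.point w η) (S.jp w) ≤ C * ‖S.point w η‖ * ‖w‖) :
    (1 - S.γ * (6 / 5 * C)) * ‖w‖ ^ 2 ≤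
      (S.coef η)⁻¹ * S.dAction (S.point w η) (S.jp w) := by
  have ha := S.coef_pos hη.1
  have h1 := (hη.small hw).norm_point_le
  have h2 : S.γ * S.dG (S.point w η) (S.jp w) ≤ S.γ * (C * (6 / 5 * (S.coef η * ‖w‖)) * ‖w‖) := by
    have := S.γ_pos
    refine mul_le_mul_of_nonneg_left (hG.trans ?_) this.le
    gcongr
  rw [S.dAction_point_jp, S.e_self, LinearIsometry.norm_map, ← div_eq_inv_mul, le_div_iff₀ ha]
  linarith

/-- Testing the equation with x itself: dI(x)[x] = 2I(x) + γ(2G(x) − dG(x)[x]). -/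
theorem multiplier_mul_le {x : V} {ω : ℝ} (hω : S.dAction x x = ω * S.b x x) :
    S.b x x * ω ≤ 2 * S.action x := by
  have h1 := S.dAction_apply x x
  rw [S.e_jp_pp _ x, S.e_jn_pn _ x, S.e_self, S.e_self, LinearIsometry.norm_map,
    LinearIsometry.norm_map] at h1
  have h2 := mul_le_mul_of_nonneg_left (S.two_mul_le x) S.γ_pos.le
  rw [action]
  linarith

/-- Solutions of the multiplier equation with positive multiplier come from maximizers. -/
theorem isMax_of_multiplier [CompleteSpace N] {x : V} (hx : S.b x x = S.lam) {ω : ℝ} (hω : 0 < ω)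
    (h : ∀ k, S.dAction x k = ω * S.b x k) :
    S.pp x ≠ 0 ∧ S.IsMax (S.normalize (S.pp x)) (S.pn x) ∧
      S.point (S.normalize (S.pp x)) (S.pn x) = x := by
  have h0 := S.lam_pos
  have hγ := S.γ_pos
  have hbx : S.b (S.jp (S.pp x)) (S.jp (S.pp x)) + S.sq (S.pn x) = S.lam := by
    rw [← hx]
    conv_rhs => rw [← S.split x]
    simp only [map_add, add_apply, S.b_orth, S.b_orth', sq]
    ring
  -- Otherwise λω ≤ 2I(x) ≤ 0.
  have hp : S.pp x ≠ 0 := by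
    intro hp
    have h1 := S.multiplier_mul_le (h x)
    have h2 := mul_nonneg hγ.le (S.G_nonneg x)
    rw [action, hp, hx] at h1
    have h3 := mul_pos h0 hω
    have h4 := _root_.sq_nonneg ‖S.pn x‖
    simp only [norm_zero] at h1
    linarith
  have hpos := S.b_jp_pos hp
  have hcoef : S.coef (S.pn x) = √(S.b (S.jp (S.pp x)) (S.jp (S.pp x))) := by
    rw [coef, ← hbx, add_sub_cancel_right]
  have ha := Real.sqrt_pos.2 hpos
  rw [← hcoef] at ha
  have hpt : S.point (S.normalize (S.pp x)) (S.pn x) = x := by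
    rw [point, normalize, ← hcoef, map_smul, smul_smul, mul_inv_cancel₀ ha.ne', one_smul, S.split]
  refine ⟨hp, ?_, hpt⟩
  have hw := S.b_normalize hp
  set w := S.normalize (S.pp x)
  set η := S.pn x
  have hq : S.sq η < S.lam := by linarith
  have hn := S.norm_point_sq w η
  have hγK : S.γ * S.K ≤ 1 / 4 := S.γK_lt.le
  have hdG (k : V) : S.γ * |S.dG (S.point w η) k| ≤ 1 / 4 * (‖S.point w η‖ * ‖k‖) := by
    have h1 := mul_le_mul_of_nonneg_left (S.dG_le _ k (S.b_point hw hq.le).le) hγ.le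
    have h2 := mul_le_mul_of_nonneg_right hγK
      (mul_nonneg (norm_nonneg (S.point w η)) (norm_nonneg k))
    linarith
  have hq0 := S.sq_nonneg η
  -- testing with `η` and with `w`
  have t1 := h (S.jn η)
  have t2 := h (S.jp w)
  rw [← hpt, S.dAction_point_jn, S.b_point_jn, S.e_self, LinearIsometry.norm_map] at t1
  rw [← hpt, S.dAction_point_jp, S.b_point_jp, S.e_self, LinearIsometry.norm_map, hw] at t2
  change _ = ω * S.sq η at t1
  have b1 := hdG (S.jn η)
  have b2 := hdG (S.jp w)
  rw [LinearIsometry.norm_map] at b1 b2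
  have c1 := mul_le_mul_of_nonneg_left (neg_abs_le (S.dG (S.point w η) (S.jn η))) hγ.le
  have c2 := mul_le_mul_of_nonneg_left (le_abs_self (S.dG (S.point w η) (S.jp w))) hγ.le
  set n := ‖S.point w η‖
  set a := S.coef η with ha'
  have hn0 : 0 ≤ n := norm_nonneg _
  have hη0 : 0 ≤ ‖η‖ := norm_nonneg _
  have hw0 : 0 ≤ ‖w‖ := norm_nonneg _
  -- From the test with η. As ω > 0 both terms on the left are nonnegative, which first gives ‖η‖ ≤
  -- n/4 and hence control of n by a‖w‖.
  have d1 : ‖η‖ ^ 2 + ω * S.sq η ≤ 1 / 4 * (n * ‖η‖) := by linarith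
  have d2 : ‖η‖ ≤ n / 4 := by
    rcases hη0.eq_or_lt with h3 | h3
    · rw [← h3]; positivity
    · have : ‖η‖ * ‖η‖ ≤ n / 4 * ‖η‖ := by nlinarith [mul_nonneg hω.le hq0]
      exact le_of_mul_le_mul_right this h3
  have d3 : 15 * ‖η‖ ^ 2 ≤ a ^ 2 * ‖w‖ ^ 2 := by nlinarith
  have d4 : n ≤ 26 / 25 * (a * ‖w‖) := by
    apply le_of_sq_le_sq _ (by positivity)
    rw [hn]
    nlinarith [mul_nonneg (_root_.sq_nonneg a) (_root_.sq_nonneg ‖w‖)]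
  -- From the test with w: 1 − (1/4)(26/25) = 37/50.
  have d5 : 37 / 50 * ‖w‖ ^ 2 ≤ ω := by
    have : a * (37 / 50 * ‖w‖ ^ 2) ≤ a * ω := by
      have := mul_le_mul_of_nonneg_right d4 hw0
      nlinarith
    exact le_of_mul_le_mul_left this ha
  have hw1 : 0 < ‖w‖ ^ 2 := by
    have := norm_pos_iff.2 (S.ne_zero_of_unit hw)
    positivity
  -- Insert the lower bound for ω in `d1`; n‖η‖/4 − ‖η‖² is at most n²/64, and n² ≤ (16/15)a²‖w‖²
  -- turns this into a²‖w‖²/60.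
  have d6 : ‖w‖ ^ 2 * (37 / 50 * S.sq η) ≤ ‖w‖ ^ 2 * (a ^ 2 / 60) := by
    have e1 := mul_le_mul_of_nonneg_right d5 hq0
    have e2 : 1 / 4 * (n * ‖η‖) - ‖η‖ ^ 2 ≤ n ^ 2 / 64 := by nlinarith [_root_.sq_nonneg (n / 8 - ‖η‖)]
    have e3 : n ^ 2 ≤ 16 / 15 * (a ^ 2 * ‖w‖ ^ 2) := by rw [hn]; linarith
    linarith
  have d7 := le_of_mul_le_mul_left d6 hw1
  have d8 : a ^ 2 ≤ S.lam := S.coef_sq_le η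
  have hsmall : S.Small w η := by
    refine ⟨by linarith, ?_⟩
    have := mul_le_mul_of_nonneg_right d8 hw1.le
    linarith [mul_pos h0 hw1]
  obtain ⟨y, hy⟩ := S.exists_isMax hw
  -- The direction ζ − (b(η, ζ)/a)w is tangent to the b-sphere at x, so ω b(x, ·) vanishes on it.
  have hcrit (ζ : N) : S.dReduced w η ζ = 0 := by
    rw [dReduced, hpt, h, ← hpt, map_sub, map_smul, S.b_point_jp, S.b_point_jn, hw, smul_eq_mul,
      ← ha', mul_one, div_mul_cancel₀ _ ha.ne', sub_self, mul_zero]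
  rwa [S.isMax_of_critical hw hsmall hcrit hy]

end SplitProblem

/-! ### The sign operator and the splitting of `X` -/

section Splitting

variable {m : ℝ}

theorem signSymbol_signSymbol (hm : 0 < m) (ξ : R3) (v : C4) :
    signSymbol m ξ (signSymbol m ξ v) = v := by
  have he : energy m ξ ≠ 0 := (hm.trans_le (mass_le_energy m ξ)).ne'
  set A := Matrix.toEuclideanCLM (n := Fin 4) (𝕜 := ℂ) (diracSymbol m ξ) with hA
  have hAA : A * A = ((energy m ξ ^ 2 : ℝ) : ℂ) • 1 := by
    rw [hA, ← map_mul, diracSymbol_mul_self, map_smul, map_one]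
  have h1 : A (A v) = ((energy m ξ ^ 2 : ℝ) : ℂ) • v := by
    rw [← mul_apply_eq_comp, hAA]; simp
  rw [signSymbol, ← hA, smul_apply, smul_apply, map_smul, h1, smul_smul, smul_smul,
    ← Complex.ofReal_mul, ← Complex.ofReal_mul]
  have : (energy m ξ)⁻¹ * (energy m ξ)⁻¹ * energy m ξ ^ 2 = 1 := by field_simp
  rw [this, Complex.ofReal_one, one_smul]

theorem coeFn_signMul (m : ℝ) (f : L2) : signMul m f =ᵐ[volume] fun ξ => signSymbol m ξ (f ξ) :=
  (memLp_signSymbol m (Lp.memLp f)).coeFn_toLp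

theorem signMul_signMul (hm : 0 < m) (f : L2) : signMul m (signMul m f) = f := by
  apply Lp.ext
  filter_upwards [coeFn_signMul m (signMul m f), coeFn_signMul m f] with ξ h1 h2
  rw [h1, h2, signSymbol_signSymbol hm]

theorem norm_signMul_le (m : ℝ) (f : L2) : ‖signMul m f‖ ≤ ‖f‖ := by
  apply Lp.norm_le_norm_of_ae_le
  filter_upwards [coeFn_signMul m f] with ξ h
  rw [h]
  exact norm_signSymbol_le m ξ _

theorem norm_signMul (hm : 0 < m) (f : L2) : ‖signMul m f‖ = ‖f‖ := by
  refine le_antisymm (norm_signMul_le m f) ?_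
  conv_lhs => rw [← signMul_signMul hm f]
  exact norm_signMul_le m _

theorem toL2_injective (m : ℝ) : Function.Injective (toL2 m) := fun _ _ h => Subtype.ext h

theorem toL2_signX (ψ : X m) : toL2 m (signX m ψ) = signL2 m (toL2 m ψ) := rfl

theorem signX_signX (hm : 0 < m) (ψ : X m) : signX m (signX m ψ) = ψ := by
  apply toL2_injective
  rw [toL2_signX, toL2_signX]
  apply (Lp.fourierTransformₗᵢ R3 C4).injective
  change 𝓕 (signL2 m (signL2 m (toL2 m ψ))) = 𝓕 (toL2 m ψ)
  rw [fourier_signL2, fourier_signL2, signMul_signMul hm]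

theorem normL2_signX (hm : 0 < m) (ψ : X m) : normL2 (signX m ψ) = normL2 ψ := by
  rw [normL2, toL2_signX, ← Lp.norm_fourier_eq, fourier_signL2, norm_signMul hm,
    Lp.norm_fourier_eq, normL2]

theorem weightedFourier_signX (ψ : X m) :
    weightedFourier m (signX m ψ) = signMul m (weightedFourier m ψ) := by
  apply Lp.ext
  have h1 : weightedFourier m (signX m ψ) =ᵐ[volume]
      fun ξ => √(energy m ξ) • (𝓕 (toL2 m (signX m ψ)) : L2) ξ := (memLp_weighted m (signX m ψ)).coeFn_toLp
  have h2 : weightedFourier m ψ =ᵐ[volume]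
      fun ξ => √(energy m ξ) • (𝓕 (toL2 m ψ) : L2) ξ :=
    (memLp_weighted m ψ).coeFn_toLp
  rw [toL2_signX, fourier_signL2] at h1
  filter_upwards [h1, h2, coeFn_signMul m (weightedFourier m ψ),
    coeFn_signMul m (𝓕 (toL2 m ψ))] with ξ h3 h4 h5 h6
  rw [h3, h5, h4, h6, ContinuousLinearMap.map_smul_of_tower]

theorem norm_signX (hm : 0 < m) (ψ : X m) : ‖signX m ψ‖ = ‖ψ‖ := by
  rw [norm_eq, weightedFourier_signX, norm_signMul hm, norm_eq]

theorem lambdaPos_add_lambdaNeg (ψ : X m) : lambdaPos m ψ + lambdaNeg m ψ = ψ := by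
  simp only [lambdaPos, lambdaNeg, LinearMap.smul_apply, LinearMap.add_apply,
    LinearMap.sub_apply, LinearMap.id_apply]
  module

theorem signX_of_mem_XPos (hm : 0 < m) {u : X m} (hu : u ∈ XPos m) : signX m u = u := by
  obtain ⟨ψ, rfl⟩ := hu
  simp only [lambdaPos, LinearMap.smul_apply, LinearMap.add_apply, LinearMap.id_apply, map_smul,
    map_add, signX_signX hm]
  module

theorem signX_of_mem_XNeg (hm : 0 < m) {v : X m} (hv : v ∈ XNeg m) : signX m v = -v := by
  obtain ⟨ψ, rfl⟩ := hv
  simp only [lambdaNeg, LinearMap.smul_apply, LinearMap.sub_apply, LinearMap.id_apply, map_smul,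
    map_sub, signX_signX hm]
  module

theorem norm_lambdaPos_le (hm : 0 < m) (ψ : X m) : ‖lambdaPos m ψ‖ ≤ ‖ψ‖ := by
  have h := norm_add_le ψ (signX m ψ)
  rw [norm_signX hm] at h
  simp only [lambdaPos, LinearMap.smul_apply, LinearMap.add_apply, LinearMap.id_apply, norm_smul]
  norm_num
  linarith

theorem norm_lambdaNeg_le (hm : 0 < m) (ψ : X m) : ‖lambdaNeg m ψ‖ ≤ ‖ψ‖ := by
  have h := norm_sub_le ψ (signX m ψ)
  rw [norm_signX hm] at h
  simp only [lambdaNeg, LinearMap.smul_apply, LinearMap.sub_apply, LinearMap.id_apply, norm_smul]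
  norm_num
  linarith

theorem re_inner_eq_zero_of_norm_add_eq {E : Type*} [NormedAddCommGroup E] [InnerProductSpace ℂ E]
    {x y : E} (h : ‖x + y‖ = ‖x - y‖) : (inner ℂ x y).re = 0 := by
  have h1 := norm_add_sq (𝕜 := ℂ) x y
  have h2 := norm_sub_sq (𝕜 := ℂ) x y
  rw [← h, h1] at h2
  simp only [RCLike.re_to_complex] at h2
  linarith

/-- The sign operator is an isometry sending u + v to u − v; equal norms mean orthogonality. The
same argument works in L². -/
theorem re_inner_pos_neg (hm : 0 < m) (u : XPos m) (v : XNeg m) :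
    (inner ℂ (u : X m) (v : X m)).re = 0 := by
  apply re_inner_eq_zero_of_norm_add_eq
  rw [← norm_signX hm, map_add, signX_of_mem_XPos hm u.2, signX_of_mem_XNeg hm v.2, sub_eq_add_neg]

theorem reInnerL2_pos_neg (hm : 0 < m) (u : XPos m) (v : XNeg m) :
    reInnerL2 (u : X m) (v : X m) = 0 := by
  apply re_inner_eq_zero_of_norm_add_eq
  rw [← map_add, ← map_sub]
  change normL2 _ = normL2 _
  rw [← normL2_signX hm, map_add, signX_of_mem_XPos hm u.2, signX_of_mem_XNeg hm v.2,
    sub_eq_add_neg]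

/-- Dividing by √energy ≥ √m keeps functions in L². So X is isometric to L², hence complete. -/
theorem weightedFourier_surjective (hm : 0 < m) : Function.Surjective (weightedFourier m) := by
  intro g
  have hpos (ξ : R3) : 0 < √(energy m ξ) :=
    Real.sqrt_pos.2 (hm.trans_le (mass_le_energy m ξ))
  have hmeas : AEStronglyMeasurable (fun ξ => (√(energy m ξ))⁻¹ • g ξ) volume :=
    ((measurable_energy m).sqrt.inv.aestronglyMeasurable).smul (Lp.aestronglyMeasurable g)
  have hmem : MemLp (fun ξ => (√(energy m ξ))⁻¹ • g ξ) 2 volume := by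
    refine (Lp.memLp g).of_le_mul (c := (√m)⁻¹) hmeas (Filter.Eventually.of_forall fun ξ => ?_)
    rw [norm_smul, Real.norm_of_nonneg (inv_nonneg.2 (hpos ξ).le)]
    have : (√(energy m ξ))⁻¹ ≤ (√m)⁻¹ :=
      inv_anti₀ (Real.sqrt_pos.2 hm) (Real.sqrt_le_sqrt (mass_le_energy m ξ))
    exact mul_le_mul_of_nonneg_right this (norm_nonneg _)
  have hF : (𝓕 ((Lp.fourierTransformₗᵢ R3 C4).symm (hmem.toLp _)) : L2) = hmem.toLp _ :=
    (Lp.fourierTransformₗᵢ R3 C4).apply_symm_apply _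
  have hae : (fun ξ => √(energy m ξ) • (𝓕 ((Lp.fourierTransformₗᵢ R3 C4).symm (hmem.toLp _)) : L2) ξ)
      =ᵐ[volume] g := by
    rw [hF]
    filter_upwards [hmem.coeFn_toLp] with ξ hξ
    rw [hξ, smul_smul, mul_inv_cancel₀ (hpos ξ).ne', one_smul]
  refine ⟨⟨(Lp.fourierTransformₗᵢ R3 C4).symm (hmem.toLp _), (memLp_congr_ae hae).2 (Lp.memLp g)⟩, ?_⟩
  exact Lp.ext ((memLp_weighted m ⟨_, _⟩).coeFn_toLp.trans hae)

theorem completeSpace_X (hm : 0 < m) : CompleteSpace (X m) := by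
  have h : Isometry (weightedFourier m) :=
    AddMonoidHomClass.isometry_of_norm (weightedFourier m) fun ψ => (norm_eq m ψ).symm
  rw [completeSpace_iff_isComplete_range h.isUniformInducing,
    (weightedFourier_surjective hm).range_eq]
  exact completeSpace_iff_isComplete_univ.1 inferInstance

theorem completeSpace_XNeg (hm : 0 < m) : CompleteSpace (XNeg m) := by
  have := completeSpace_X hm
  have hc : Continuous (signX m) :=
    (AddMonoidHomClass.isometry_of_norm (signX m) (norm_signX hm)).continuous
  have h : (XNeg m : Set (X m)) = {v | signX m v = -v} := by
    ext v
    refine ⟨fun hv => signX_of_mem_XNeg hm hv, fun hv => ⟨v, ?_⟩⟩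
    have hv' : signX m v = -v := hv
    simp only [lambdaNeg, LinearMap.smul_apply, LinearMap.sub_apply, LinearMap.id_apply, hv']
    module
  have hcl : IsClosed (XNeg m : Set (X m)) := by
    rw [h]; exact isClosed_eq hc continuous_neg
  exact hcl.isComplete.completeSpace_coe

/-- The real part of the scalar product of `X`. -/
noncomputable def energyForm (m : ℝ) : X m →L[ℝ] X m →L[ℝ] ℝ :=
  LinearMap.mkContinuous₂ (LinearMap.mk₂ ℝ (fun x y : X m => (inner ℂ x y).re)
    (fun x y z => by rw [inner_add_left, add_re])
    (fun c x y => by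
      change (inner ℂ ((c : ℂ) • x) y).re = _
      rw [inner_smul_left, conj_ofReal, re_ofReal_mul, smul_eq_mul])
    (fun x y z => by rw [inner_add_right, add_re])
    (fun c x y => by
      change (inner ℂ x ((c : ℂ) • y)).re = _
      rw [inner_smul_right, re_ofReal_mul, smul_eq_mul])) 1
    (fun x y => by
      rw [one_mul]
      exact (abs_re_le_norm _).trans (norm_inner_le_norm x y))

theorem energyForm_apply (x y : X m) : energyForm m x y = (inner ℂ x y).re := rfl

/-- The real part of the `L²` scalar product as a bounded form on `X`. -/
noncomputable def massForm (hm : 0 < m) : X m →L[ℝ] X m →L[ℝ] ℝ :=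
  LinearMap.mkContinuous₂ (LinearMap.mk₂ ℝ (fun x y : X m => reInnerL2 x y)
    (fun x y z => by rw [reInnerL2, map_add, inner_add_left, add_re]; rfl)
    (fun c x y => by
      change (inner ℂ (toL2 m ((c : ℂ) • x)) (toL2 m y)).re = _
      rw [map_smul, inner_smul_left, conj_ofReal, re_ofReal_mul, smul_eq_mul]; rfl)
    (fun x y z => by rw [reInnerL2, map_add, inner_add_right, add_re]; rfl)
    (fun c x y => by
      change (inner ℂ (toL2 m x) (toL2 m ((c : ℂ) • y))).re = _
      rw [map_smul, inner_smul_right, re_ofReal_mul, smul_eq_mul]; rfl))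
    (sobolevConst m 2 ^ 2)
    (fun x y => by
      have h1 := normL2_le_sobolevConst hm x
      have h2 := normL2_le_sobolevConst hm y
      have h3 : |reInnerL2 x y| ≤ normL2 x * normL2 y :=
        (abs_re_le_norm _).trans (norm_inner_le_norm _ _)
      have h4 := mul_le_mul h1 h2 (norm_nonneg _) ((norm_nonneg _).trans h1)
      exact h3.trans (h4.trans_eq (by ring)))

theorem massForm_apply (hm : 0 < m) (x y : X m) : massForm hm x y = reInnerL2 x y := rfl

theorem massForm_self (hm : 0 < m) (x : X m) : massForm hm x x = normL2 x ^ 2 :=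
  (norm_sq_eq_re_inner (𝕜 := ℂ) (toL2 m x)).symm

variable {α : ℝ} {F : C4 → ℝ} {μ lam γ : ℝ}

/-- The normalized Dirac problem as a split problem on `X = X₊ ⊕ X₋`. -/
noncomputable def diracProblem (hm : 0 < m) (hα : 2 < α) (hα' : α ≤ 8 / 3) (hF : Nonlinearity F α)
    (hμ : ∀ φ : C4, ‖fderiv ℝ F φ‖ ≤ ‖φ‖ + μ * ‖φ‖ ^ (α - 1)) (hlam : 0 < lam) (hγ : 0 < γ)
    (hγK : γ * growthConst m α lam μ < 1 / 4) : SplitProblem (X m) (XPos m) (XNeg m) where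
  e := energyForm m
  b := massForm hm
  e_symm x y := by rw [energyForm_apply, energyForm_apply, ← inner_conj_symm, conj_re]
  e_self x := (norm_sq_eq_re_inner (𝕜 := ℂ) x).symm
  b_symm x y := by
    rw [massForm_apply, massForm_apply, reInnerL2, reInnerL2, ← inner_conj_symm, conj_re]
  b_pos x hx := by
    have : 0 < normL2 x := norm_pos_iff.2 fun h => hx (toL2_injective m (h.trans (map_zero _).symm))
    rw [massForm_self]; positivity
  jp := { toFun := fun u => u, map_add' := fun _ _ => rfl, map_smul' := fun _ _ => rfl,
          norm_map' := fun _ => rfl }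
  jn := { toFun := fun v => v, map_add' := fun _ _ => rfl, map_smul' := fun _ _ => rfl,
          norm_map' := fun _ => rfl }
  pp := LinearMap.mkContinuous
    { toFun := (lambdaPos m).rangeRestrict
      map_add' := map_add _
      map_smul' := fun c x => (lambdaPos m).rangeRestrict.map_smul (c : ℂ) x } 1
    fun x => (norm_lambdaPos_le hm x).trans_eq (one_mul _).symm
  pn := LinearMap.mkContinuous
    { toFun := (lambdaNeg m).rangeRestrict
      map_add' := map_add _
      map_smul' := fun c x => (lambdaNeg m).rangeRestrict.map_smul (c : ℂ) x } 1
    fun x => (norm_lambdaNeg_le hm x).trans_eq (one_mul _).symm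
  split x := lambdaPos_add_lambdaNeg x
  e_orth := re_inner_pos_neg hm
  b_orth := reInnerL2_pos_neg hm
  G := potential F
  dG := potentialDeriv hm hα hα' hF
  γ := γ
  lam := lam
  K := growthConst m α lam μ
  γ_pos := hγ
  lam_pos := hlam
  K_nonneg := by
    have := Nonlinearity.growth_nonneg hα hμ
    rw [growthConst]; positivity
  γK_lt := hγK
  G_nonneg := potential_nonneg hα hF
  tangent_le := potential_tangent_le hm hα hα' hF
  two_mul_le := two_mul_potential_le hm hα hα' hF
  dG_le x k hx := potentialDeriv_le_growthConst hm hα hα' hF hμ hlam.le x k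
    (by rwa [massForm_self] at hx)
  dG_lipschitz r := by
    obtain ⟨L, hL, h⟩ := exists_potentialDeriv_lipschitz hm hα hα' hF √r
    refine ⟨L, hL, fun x y k hx hy => h x y k ?_ ?_⟩
    · rw [massForm_self] at hx; exact Real.le_sqrt_of_sq_le hx
    · rw [massForm_self] at hy; exact Real.le_sqrt_of_sq_le hy

end Splitting

/-! ### Dictionary between the abstract problem and the Dirac functionals -/

section Reduction

variable {m α : ℝ} {F : C4 → ℝ} {μ lam γ : ℝ}
  (hm : 0 < m) (hα : 2 < α) (hα' : α ≤ 8 / 3) (hF : Nonlinearity F α)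
  (hμ : ∀ φ : C4, ‖fderiv ℝ F φ‖ ≤ ‖φ‖ + μ * ‖φ‖ ^ (α - 1)) (hlam : 0 < lam) (hγ : 0 < γ)
  (hγK : γ * growthConst m α lam μ < 1 / 4)

theorem diracProblem_sq (η : XNeg m) :
    (diracProblem hm hα hα' hF hμ hlam hγ hγK).sq η = normL2 (η : X m) ^ 2 :=
  massForm_self hm (η : X m)

theorem diracProblem_b_jp (w : XPos m) :
    (diracProblem hm hα hα' hF hμ hlam hγ hγK).b
      ((diracProblem hm hα hα' hF hμ hlam hγ hγK).jp w)
      ((diracProblem hm hα hα' hF hμ hlam hγ hγK).jp w) = normL2 (w : X m) ^ 2 :=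
  massForm_self hm (w : X m)

theorem diracProblem_coef (η : XNeg m) :
    (diracProblem hm hα hα' hF hμ hlam hγ hγK).coef η = coefA lam η := by
  rw [SplitProblem.coef, diracProblem_sq, coefA]; rfl

theorem diracProblem_point (w : XPos m) (η : XNeg m) :
    (diracProblem hm hα hα' hF hμ hlam hγ hγK).point w η = combine lam w η := by
  rw [SplitProblem.point, diracProblem_coef]; rfl

theorem diracProblem_reduced (w : XPos m) (η : XNeg m) :
    (diracProblem hm hα hα' hF hμ hlam hγ hγK).reduced w η = J m γ F lam w η := by
  rw [SplitProblem.reduced, diracProblem_point]; rfl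

theorem diracProblem_isMax (w : XPos m) (η : XNeg m) :
    (diracProblem hm hα hα' hF hμ hlam hγ hγK).IsMax w η ↔ IsMaximizer m γ F lam w η := by
  simp only [SplitProblem.IsMax, diracProblem_reduced, diracProblem_sq]; rfl

theorem diracProblem_normalize (w : XPos m) :
    (diracProblem hm hα hα' hF hμ hlam hγ hγK).normalize w = (normL2 (w : X m))⁻¹ • w := by
  have h : 0 ≤ normL2 (w : X m) := norm_nonneg _
  rw [SplitProblem.normalize, diracProblem_b_jp, Real.sqrt_sq h]

theorem diracProblem_value :
    (fun w => (diracProblem hm hα hα' hF hμ hlam hγ hγK).value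
      ((diracProblem hm hα hα' hF hμ hlam hγ hγK).normalize w)) = reducedE m γ F lam := by
  funext w
  have h : {η | (diracProblem hm hα hα' hF hμ hlam hγ hγK).sq η <
      (diracProblem hm hα hα' hF hμ hlam hγ hγK).lam} = negBall m lam := by
    simp only [diracProblem_sq]; rfl
  simp only [SplitProblem.value, diracProblem_normalize, diracProblem_reduced]
  exact congrArg (fun s : Set (XNeg m) => ⨆ η : s, J m γ F lam ((normL2 (w : X m))⁻¹ • w) η) h

theorem sizeConst_nonneg (hα : 2 < α) (hμ : ∀ φ : C4, ‖fderiv ℝ F φ‖ ≤ ‖φ‖ + μ * ‖φ‖ ^ (α - 1))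
    (hlam : 0 ≤ lam) : 0 ≤ sizeConst m α lam μ := by
  have h := Nonlinearity.growth_nonneg hα hμ
  have h2 : 0 ≤ sobolevConst m 2 := Real.sInf_nonneg fun _ h => h.1
  have h3 : 0 ≤ sobolevConst m 3 := Real.sInf_nonneg fun _ h => h.1
  rw [sizeConst]; positivity

end Reduction

end NLDirac

/-! ### The theorem -/

theorem mainTheorem3 (m : ℝ) (hm : 0 < m) (α : ℝ) (hα : 2 < α) (hα' : α ≤ 8 / 3)
    (F : NLDirac.C4 → ℝ) (hF : NLDirac.Nonlinearity F α)
    (μ : ℝ) (hμ : ∀ φ : NLDirac.C4, ‖fderiv ℝ F φ‖ ≤ ‖φ‖ + μ * ‖φ‖ ^ (α - 1))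
    (lam : ℝ) (hlam : 0 < lam) (hlam' : lam ≤ 1)
    (γ : ℝ) (hγ : 0 < γ)
    (hγ₁ : γ * NLDirac.sizeConst m α lam μ < 1 / 16)
    (hγ₂ : γ * (NLDirac.sobolevConst m 2 ^ 2 +
      μ * lam ^ ((α - 2) / 2) * NLDirac.sobolevConst m (4 / (4 - α)) ^ 2) < 1 / 4) :
    -- the reduced functional is well defined and differentiable
    (∀ w : NLDirac.XPos m, NLDirac.normL2 (w : NLDirac.X m) = 1 →
      ∃! η : NLDirac.XNeg m, NLDirac.IsMaximizer m γ F lam w η) ∧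
    (∀ w : NLDirac.XPos m, w ≠ 0 → DifferentiableAt ℝ (NLDirac.reducedE m γ F lam) w) ∧
    -- critical points of `E` on `Σ₊` give constrained critical points of `I`
    (∀ (w₀ : NLDirac.XPos m) (η₀ : NLDirac.XNeg m) (ψ₀ : NLDirac.X m),
      NLDirac.normL2 (w₀ : NLDirac.X m) = 1 →
      NLDirac.IsCriticalOnPosSphere (NLDirac.reducedE m γ F lam) w₀ →
      NLDirac.IsMaximizer m γ F lam w₀ η₀ →
      ψ₀ = NLDirac.coefA lam η₀ • (w₀ : NLDirac.X m) + (η₀ : NLDirac.X m) →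
      NLDirac.IsCriticalPoint (NLDirac.reducedE m γ F lam) w₀ ∧
      NLDirac.normL2 ψ₀ ^ 2 = lam ∧
      NLDirac.IsCriticalOnSphere (NLDirac.action m γ F) ψ₀ ∧
      NLDirac.action m γ F ψ₀ = NLDirac.reducedE m γ F lam w₀ ∧
      ∃ ω : ℝ,
        ω = (NLDirac.coefA lam η₀)⁻¹ *
          fderiv ℝ (NLDirac.action m γ F) ψ₀ (w₀ : NLDirac.X m) ∧
        NLDirac.SolvesMultiplierEq (NLDirac.action m γ F) ψ₀ ω ∧
        (1 - γ * NLDirac.constC m α lam μ) * ‖(w₀ : NLDirac.X m)‖ ^ 2 ≤ ω ∧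
        lam * ω ≤ 2 * NLDirac.reducedE m γ F lam w₀) ∧
    -- constrained critical points of `I` with positive multiplier give critical points of `E`
    (∀ (ψ₀ : NLDirac.X m) (ω : ℝ), NLDirac.normL2 ψ₀ ^ 2 = lam → 0 < ω →
      NLDirac.SolvesMultiplierEq (NLDirac.action m γ F) ψ₀ ω →
      NLDirac.lambdaPos m ψ₀ ≠ 0 ∧
      NLDirac.IsCriticalPoint (NLDirac.reducedE m γ F lam)
        ((NLDirac.normL2 (NLDirac.lambdaPos m ψ₀))⁻¹ •
          (NLDirac.lambdaPos m).rangeRestrict ψ₀)) := by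
  have : CompleteSpace (NLDirac.XNeg m) := NLDirac.completeSpace_XNeg hm
  have hγK : γ * NLDirac.growthConst m α lam μ < 1 / 4 := hγ₂
  let S := NLDirac.diracProblem hm hα hα' hF hμ hlam hγ hγK
  have hval : (fun w => S.value (S.normalize w)) = NLDirac.reducedE m γ F lam :=
    NLDirac.diracProblem_value hm hα hα' hF hμ hlam hγ hγK
  have hmax (w : NLDirac.XPos m) (η : NLDirac.XNeg m) :
      S.IsMax w η ↔ NLDirac.IsMaximizer m γ F lam w η :=
    NLDirac.diracProblem_isMax hm hα hα' hF hμ hlam hγ hγK w η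
  have hpoint (w : NLDirac.XPos m) (η : NLDirac.XNeg m) :
      S.point w η = NLDirac.coefA lam η • (w : NLDirac.X m) + (η : NLDirac.X m) :=
    NLDirac.diracProblem_point hm hα hα' hF hμ hlam hγ hγK w η
  have hcoef (η : NLDirac.XNeg m) : S.coef η = NLDirac.coefA lam η :=
    NLDirac.diracProblem_coef hm hα hα' hF hμ hlam hγ hγK η
  have hunit {w : NLDirac.XPos m} (hw : NLDirac.normL2 (w : NLDirac.X m) = 1) :
      S.b (S.jp w) (S.jp w) = 1 :=
    (NLDirac.diracProblem_b_jp hm hα hα' hF hμ hlam hγ hγK w).trans (by rw [hw, one_pow])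
  have hb (ψ : NLDirac.X m) : S.b ψ ψ = NLDirac.normL2 ψ ^ 2 := NLDirac.massForm_self hm ψ
  have hd (ψ : NLDirac.X m) : HasFDerivAt (NLDirac.action m γ F) (S.dAction ψ) ψ :=
    S.hasFDerivAt_action ψ
  refine ⟨fun w hw => ?_, fun w hw => hval ▸ S.differentiableAt_value hw, ?_, ?_⟩
  · obtain ⟨η, hη⟩ := S.exists_isMax (hunit hw)
    exact ⟨η, (hmax w η).1 hη, fun η' hη' => ((hmax w η').2 hη').unique (hunit hw) hη⟩
  · intro w₀ η₀ ψ₀ hw hcrit hη hψ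
    have hw' := hunit hw
    have hη' := (hmax w₀ η₀).2 hη
    rw [← hpoint] at hψ
    have hsolve : ∀ h, S.dAction ψ₀ h =
        ((NLDirac.coefA lam η₀)⁻¹ * S.dAction ψ₀ (w₀ : NLDirac.X m)) * S.b ψ₀ h := by
      rw [← hcoef, hψ]
      exact hη'.dAction_eq hw' fun v hv => by rw [hval]; exact hcrit.2 v hv
    set ω : ℝ := (NLDirac.coefA lam η₀)⁻¹ * S.dAction ψ₀ (w₀ : NLDirac.X m) with hω
    have hmass : S.b ψ₀ ψ₀ = lam := by rw [hψ]; exact S.b_point hw' hη'.1.le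
    have heq : NLDirac.SolvesMultiplierEq (NLDirac.action m γ F) ψ₀ ω :=
      ⟨(hd ψ₀).differentiableAt, fun h => by rw [(hd ψ₀).fderiv]; exact hsolve h⟩
    have hE : NLDirac.action m γ F ψ₀ = NLDirac.reducedE m γ F lam w₀ := by
      rw [← hval]
      change _ = S.value (S.normalize w₀)
      rw [S.normalize_of_unit hw', hη'.value_eq, hψ]; rfl
    refine ⟨⟨hcrit.1, fun v => ?_⟩, (hb ψ₀).symm.trans hmass, ⟨heq.1, fun h hh => ?_⟩, hE,
      ω, by rw [(hd ψ₀).fderiv], heq, ?_, ?_⟩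
    · rw [← hval]
      exact S.fderiv_value_eq_zero hw' hη' (ω := ω) (by rw [← hψ]; exact hsolve) v
    · rw [heq.2, hh, mul_zero]
    · have hC := NLDirac.sizeConst_nonneg (m := m) hα hμ hlam.le
      have h1 := hη'.le_multiplier hw' (C := 16 / 5 * NLDirac.sizeConst m α lam μ) (by positivity)
        ((le_abs_self _).trans (NLDirac.potentialDeriv_le_sizeConst hm hα hα' hF hμ hlam hlam' _ _
          (by rw [← hψ, ← hb, hmass])))
      rw [← hψ, hcoef] at h1
      refine le_trans ?_ h1
      -- (6/5)(16/5) = 96/25 ≤ 4, the factor in `constC`.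
      have h2 : γ * (6 / 5 * (16 / 5 * NLDirac.sizeConst m α lam μ)) ≤
          γ * NLDirac.constC m α lam μ :=
        mul_le_mul_of_nonneg_left (by rw [NLDirac.constC]; linarith) hγ.le
      exact mul_le_mul_of_nonneg_right (sub_le_sub_left h2 1) (sq_nonneg _)
    · rw [← hE, ← hmass]
      exact S.multiplier_mul_le (hsolve ψ₀)
  · intro ψ₀ ω hψ hω heq
    have hsolve (k : NLDirac.X m) : S.dAction ψ₀ k = ω * S.b ψ₀ k := by
      rw [← (hd ψ₀).fderiv]; exact heq.2 k
    obtain ⟨h0, h1, h2⟩ := S.isMax_of_multiplier ((hb ψ₀).trans hψ) hω hsolve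
    have hn : S.normalize (S.pp ψ₀) = (NLDirac.normL2 (NLDirac.lambdaPos m ψ₀))⁻¹ •
        (NLDirac.lambdaPos m).rangeRestrict ψ₀ :=
      NLDirac.diracProblem_normalize hm hα hα' hF hμ hlam hγ hγK _
    have h3 := S.b_normalize h0
    refine ⟨fun h => h0 (Subtype.ext h), ?_⟩
    rw [← hn, ← hval]
    exact ⟨S.differentiableAt_value (S.ne_zero_of_unit h3),
      S.fderiv_value_eq_zero h3 h1 (by rw [h2]; exact hsolve)⟩
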